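/- Let $k$ be an algebraically closed field of characteristic $0$, let $H$ be a linear algebraic group over $k$, let $X$ be an $H$-variety (a reduced, separated scheme of finite type over $k$, not necessarily irreducible, with an action of $H$), and let $L\to X$ be a linearisation, i.e. a line bundle with an action of $H$ on its total space for which the projection is equivariant and which is linear on the fibres. The group $H$ acts on $H^0(X,L^{\otimes r})$ by $(h\cdot s)(x)=h(s(h^{-1}x))$. Put $$S^H=\bigoplus_{r\ge 0}H^0(X,L^{\otimes r})^H .$$ Consider the invariant sections $f\in H^0(X,L^{\otimes r})^H$, $r>0$, for which the $k$-algebra $(S^H)_{(f)}$ of degree-$0$ elements of $S^H[1/f]$ is finitely generated. Let $X^{\mathrm{ss,fg}}\subseteq X$ be the union of the open sets $X_f=\{f\neq 0\}$ and let $X/\!\!/\!\!/H\subseteq \operatorname{Proj}(S^H)$, the enveloping quotient, be the union of the open sets $\operatorname{Spec}((S^H)_{(f)})$, both over all such $f$. Let $q: X^{\mathrm{ss,fg}}\to X/\!\!/\!\!/H$ be the canonical morphism, i.e. the (unique) one induced by the inclusion of $S^H$ in $\bigoplus_{r\ge0}H^0(X,L^{\otimes r})$. For an open subscheme $\mathcal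 U\subseteq\operatorname{Proj}(S^H)$ write $\mathcal O_{\mathcal U}(r)$ for the restriction to $\mathcal U$ of the twisting sheaf $\mathcal O(r)$. For a finite-dimensional vector space $V$ write $\mathbb P(V^*)=\operatorname{Proj}(\operatorname{Sym}^\bullet V)$. For $r>0$ and a finite set $\mathcal S\subseteq H^0(X,L^{\otimes r})^H$, an *enveloping system adapted to $\mathcal S$* is a finite-dimensional $H$-stable linear subspace $V\subseteq H^0(X,L^{\otimes r})$ which contains $\mathcal S$ and is such that, for every $f\in\mathcal S$, the $k$-algebra $(S^H)_{(f)}$ is finitely generated and is generated by $\{\tilde f/f \mid \tilde f\in V^H\}$. **Proposition 3.9.** 1. For every quasi-compact open subscheme $\mathcal U\subseteq X/\!\!/\!\!/H$ there are $r>0$, a finite set $\mathcal S\subseteq H^0(X,L^{\otimes r})^H$ and an enveloping system $V\subseteq H^0(X,L^{\otimes r})^H$ adapted to $\mathcal S$ such that $\mathcal U=\bigcup_{f\in\mathcal S}\operatorname{Spec}((S^H)_{(f)})$ and $\mathcal O_{\mathcal U}(r)$ is a very ample line bundle on $\mathcal U$ over $k$. Moreover, the natural map $V\to H^0(\mathcal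 U,\mathcal O_{\mathcal U}(r))$ defines a locally closed embedding $\psi:\mathcal U\hookrightarrow\mathbb P(V^*)$ over $k$, i.e. there are such a $\psi$ and an isomorphism $\psi^*\mathcal O_{\mathbb P(V^*)}(1)\cong\mathcal O_{\mathcal U}(r)$ under which the pullback of the section $v$ of $\mathcal O_{\mathbb P(V^*)}(1)$ corresponds to the image of $v$ in $H^0(\mathcal U,\mathcal O_{\mathcal U}(r))$, for all $v\in V$. (In particular every inner enveloping quotient, i.e. every quasi-compact open $\mathcal U\subseteq X/\!\!/\!\!/H$ containing $q(X^{\mathrm{ss,fg}})$, is quasi-projective.) 2. Conversely, let $V\subseteq H^0(X,L^{\otimes r})$ be an enveloping system adapted to a finite subset $\mathcal S\subseteq H^0(X,L^{\otimes r})^H$, let $\mathcal U=\bigcup_{f\in\mathcal S}\operatorname{Spec}((S^H)_{(f)})\subseteq X/\!\!/\!\!/H$ and $U=\bigcup_{f\in\mathcal S}X_f\subseteq X^{\mathrm{ss,fg}}$, and let $\phi:U\to\mathbb P((V^H)^*)$ be the $H$-invariant morphism defined by the inclusion $V^H\subseteq H^0(X,L^{\otimes r})$ (this morphism exists and is unique).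 Then there is a locally closed embedding $\overline\phi:\mathcal U\hookrightarrow\mathbb P((V^H)^*)$ over $k$ such that $q$ maps $U$ to $\mathcal U$, $\phi=\overline\phi\circ q$ on $U$, and $\overline\phi^*\mathcal O_{\mathbb P((V^H)^*)}(1)\cong\mathcal O_{\mathcal U}(r)$, by an isomorphism under which the pullback of the section $v$ corresponds to the image of $v$ in $H^0(\mathcal U,\mathcal O_{\mathcal U}(r))$, for all $v\in V^H$. 3. If $V\subseteq H^0(X,L^{\otimes r})$ is an enveloping system adapted to $\mathcal S$, then for each $n>0$ the image of the multiplication map $V^{\otimes n}\to H^0(X,L^{\otimes rn})$ is an enveloping system adapted to $\{f^n\mid f\in\mathcal S\}$. -/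

import Mathlib

open CategoryTheory AlgebraicGeometry TopologicalSpace Opposite

universe u

noncomputable section

namespace NonReductiveGIT

/-! ### The twisting sheaves of Proj -/

section Twist

variable {k A : Type u} [CommRing k] [CommRing A] [Algebra k A]
  (𝒜 : ℕ → Submodule k A) [GradedAlgebra 𝒜]

/-- Homogeneous localizations of a graded `k`-algebra are `k`-algebras. -/
instance homogeneousLocalizationAlgebraBase (x : Submonoid A) :
    Algebra k (HomogeneousLocalization 𝒜 x) where
  algebraMap := (HomogeneousLocalization.fromZeroRingHom 𝒜 x).comp (algebraMap k (𝒜 0))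
  commutes' _ _ := mul_comm _ _
  smul_def' c y := by
    apply HomogeneousLocalization.val_injective
    rw [HomogeneousLocalization.val_smul, HomogeneousLocalization.val_mul, Algebra.smul_def]
    rfl

/-- The complement of the homogeneous prime ideal `x`. -/
abbrev fiberPrimeCompl (x : ProjectiveSpectrum 𝒜) : Submonoid A :=
  x.asHomogeneousIdeal.toIdeal.primeCompl

/-- The localization of `A` at the homogeneous prime `x` (all degrees). -/
abbrev ProjFiber (x : ProjectiveSpectrum 𝒜) : Type u :=
  Localization (fiberPrimeCompl 𝒜 x)

variable {𝒜} in
/-- `f` is given on `U` by a single fraction `a / s`, with `a` and `s` homogeneous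
and `deg a = deg s + r`. -/
def IsTwistFraction (r : ℕ) {U : Opens (ProjectiveSpectrum.top 𝒜)}
    (f : ∀ x : U, ProjFiber 𝒜 x.1) : Prop :=
  ∃ (i : ℕ) (a : 𝒜 (i + r)) (s : 𝒜 i)
    (hs : ∀ x : U, s.1 ∈ fiberPrimeCompl 𝒜 x.1),
    ∀ x : U, f x = Localization.mk a.1 ⟨s.1, hs x⟩

/-- Being a fraction of degree `r`, as a predicate stable under restriction. -/
def isTwistFractionPrelocal (r : ℕ) :
    TopCat.PrelocalPredicate (X := ProjectiveSpectrum.top 𝒜) (ProjFiber 𝒜) where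
  pred f := IsTwistFraction r f
  res := by rintro V U i f ⟨j, a, s, h, w⟩; exact ⟨j, a, s, fun x => h (i x), fun x => w (i x)⟩

/-- Being locally a fraction of degree `r`. -/
def isLocallyTwistFraction (r : ℕ) :
    TopCat.LocalPredicate (X := ProjectiveSpectrum.top 𝒜) (ProjFiber 𝒜) :=
  (isTwistFractionPrelocal 𝒜 r).sheafify

/-- The sections over `U` of the sheaf `𝒪(r)` on `Proj 𝒜`: the families of elements
of the localizations at the points of `U` which are locally fractions of degree `r`. -/
def twistSections (r : ℕ) (U : Opens (ProjectiveSpectrum.top 𝒜)) :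
    AddSubgroup (∀ x : U, ProjFiber 𝒜 x.1) where
  carrier := {f | (isLocallyTwistFraction 𝒜 r).pred f}
  zero_mem' := fun x => ⟨U, x.2, 𝟙 _, 0, 0, ⟨1, SetLike.GradedOne.one_mem⟩,
    fun y => Submonoid.one_mem _, fun y => (Localization.mk_zero _).symm⟩
  add_mem' := by
    intro f g hf hg x
    obtain ⟨V, hV, i, m, a, s, hs, h⟩ := hf x
    obtain ⟨W, hW, j, n, b, t, ht, h'⟩ := hg x
    refine ⟨V ⊓ W, ⟨hV, hW⟩, Opens.infLELeft _ _ ≫ i, m + n,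
      ⟨s.1 * b.1 + t.1 * a.1, add_mem ?_ ?_⟩, ⟨s.1 * t.1, SetLike.mul_mem_graded s.2 t.2⟩,
      fun y => mul_mem (hs ⟨y.1, y.2.1⟩) (ht ⟨y.1, y.2.2⟩), fun y => ?_⟩
    · exact (add_assoc m n r) ▸ SetLike.mul_mem_graded s.2 b.2
    · have : n + (m + r) = m + n + r := by ring
      exact this ▸ SetLike.mul_mem_graded t.2 a.2
    · have h1 := h ⟨y.1, y.2.1⟩
      have h2 := h' ⟨y.1, y.2.2⟩
      change f ⟨y.1, _⟩ + g ⟨y.1, _⟩ = _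
      refine (congrArg₂ (· + ·) h1 h2).trans ?_
      change Localization.mk _ _ + Localization.mk _ _ = _
      rw [Localization.add_mk]
      rfl
  neg_mem' := by
    intro f hf x
    obtain ⟨V, hV, i, m, a, s, hs, h⟩ := hf x
    exact ⟨V, hV, i, m, -a, s, hs, fun y => (congrArg Neg.neg (h y)).trans (Localization.neg_mk _ _)⟩

theorem smul_mem_twistSections (r : ℕ) (U : Opens (ProjectiveSpectrum.top 𝒜))
    (c : Γ(Proj 𝒜, U)) (f : twistSections 𝒜 r U) :
    (fun x : U => (c.1 x).val * f.1 x) ∈ twistSections 𝒜 r U := by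
  intro x
  obtain ⟨V, hV, i, m, a, s, hs, h⟩ := c.2 x
  obtain ⟨W, hW, j, n, b, t, ht, h'⟩ := f.2 x
  refine ⟨V ⊓ W, ⟨hV, hW⟩, Opens.infLELeft _ _ ≫ i, m + n,
      ⟨a.1 * b.1, ?_⟩, ⟨s.1 * t.1, SetLike.mul_mem_graded s.2 t.2⟩,
      fun y => mul_mem (hs ⟨y.1, y.2.1⟩) (ht ⟨y.1, y.2.2⟩), fun y => ?_⟩
  · exact (add_assoc m n r) ▸ SetLike.mul_mem_graded a.2 b.2
  · have h1 := congrArg HomogeneousLocalization.val (h ⟨y.1, y.2.1⟩)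
    have h2 := h' ⟨y.1, y.2.2⟩
    refine (congrArg₂ (· * ·) h1 h2).trans ?_
    exact Localization.mk_mul _ _ _ _

/-- The sections of `𝒪(r)` over `U` form a module over the functions on `U`. -/
instance twistSectionsModule (r : ℕ) (U : Opens (ProjectiveSpectrum.top 𝒜)) :
    Module Γ(Proj 𝒜, U) (twistSections 𝒜 r U) where
  smul c f := ⟨_, smul_mem_twistSections 𝒜 r U c f⟩
  one_smul f := Subtype.ext <| funext fun x => by
    change HomogeneousLocalization.val 1 * f.1 x = f.1 x
    rw [HomogeneousLocalization.val_one, one_mul]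
  mul_smul c d f := Subtype.ext <| funext fun x => by
    change HomogeneousLocalization.val (c.1 x * d.1 x) * f.1 x = (c.1 x).val * ((d.1 x).val * f.1 x)
    rw [HomogeneousLocalization.val_mul, mul_assoc]
  smul_zero c := Subtype.ext <| funext fun x => mul_zero _
  smul_add c f g := Subtype.ext <| funext fun x => mul_add _ _ _
  add_smul c d f := Subtype.ext <| funext fun x => by
    change HomogeneousLocalization.val (c.1 x + d.1 x) * f.1 x = (c.1 x).val * f.1 x + (d.1 x).val * f.1 x
    rw [HomogeneousLocalization.val_add, add_mul]
  zero_smul f := Subtype.ext <| funext fun x => by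
    change HomogeneousLocalization.val 0 * f.1 x = 0
    rw [HomogeneousLocalization.val_zero, zero_mul]

/-- The underlying presheaf of abelian groups of `𝒪(r)`. -/
def twistPresheaf (r : ℕ) : TopCat.Presheaf Ab (Proj 𝒜) where
  obj U := AddCommGrpCat.of (twistSections 𝒜 r U.unop)
  map {U V} i := AddCommGrpCat.ofHom
    { toFun := fun f => ⟨fun x => f.1 (i.unop x), (isLocallyTwistFraction 𝒜 r).res i.unop f.1 f.2⟩
      map_zero' := rfl
      map_add' := fun _ _ => rfl }

instance (r : ℕ) (U : (Opens (Proj 𝒜))ᵒᵖ) :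
    Module ((Proj 𝒜).ringCatSheaf.obj.obj U) ((twistPresheaf 𝒜 r).obj U) :=
  twistSectionsModule 𝒜 r U.unop

/-- The twisting sheaf `𝒪(r)` on `Proj 𝒜`. -/
def twistingSheaf (r : ℕ) : (Proj 𝒜).Modules where
  val := PresheafOfModules.ofPresheaf (twistPresheaf 𝒜 r) fun _ _ _ _ _ => rfl
  isSheaf := (TopCat.Presheaf.isSheaf_iff_isSheaf_comp (forget AddCommGrpCat) _).2
    (TopCat.subsheafToTypes (isLocallyTwistFraction 𝒜 r)).property

/-- The section of `𝒪(r)` over `U` given by an element `a` of degree `r`. -/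
def twistSection {r : ℕ} {a : A} (ha : a ∈ 𝒜 r) (U : (Proj 𝒜).Opens) :
    Γ(twistingSheaf 𝒜 r, U) :=
  show twistSections 𝒜 r U from
  ⟨fun x => algebraMap A (ProjFiber 𝒜 x.1) a,
    fun x => ⟨U, x.2, 𝟙 _, 0, ⟨a, (zero_add r).symm ▸ ha⟩,
    ⟨1, SetLike.GradedOne.one_mem⟩, fun _ => Submonoid.one_mem _,
    fun _ => (Localization.mk_one_eq_algebraMap a).symm⟩⟩

end Twist

/-! ### Symmetric algebras and direct sums as graded algebras -/

section Sym

variable (k V : Type u) [Field k] [AddCommGroup V] [Module k V]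

/-- The usual grading of the symmetric algebra: the `n`-th piece is spanned by the products
of `n` elements of `V`. -/
def symGrading (n : ℕ) : Submodule k (SymmetricAlgebra k V) :=
  LinearMap.range (SymmetricAlgebra.ι k V) ^ n

instance : SetLike.GradedMonoid (symGrading k V) :=
  inferInstanceAs (SetLike.GradedMonoid ((LinearMap.range (SymmetricAlgebra.ι k V) ^ ·)))

theorem ι_mem_symGrading (v : V) : SymmetricAlgebra.ι k V v ∈ symGrading k V 1 := by
  rw [symGrading, pow_one]; exact LinearMap.mem_range_self _ v

instance : GradedAlgebra (symGrading k V) :=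
  GradedAlgebra.ofAlgHom _
    (SymmetricAlgebra.lift (DirectSum.lof k ℕ (fun i => symGrading k V i) 1 ∘ₗ
      (SymmetricAlgebra.ι k V).codRestrict _ (ι_mem_symGrading k V)))
    (by
      apply SymmetricAlgebra.algHom_ext
      ext v
      change DirectSum.coeAlgHom (symGrading k V) (SymmetricAlgebra.lift _ (SymmetricAlgebra.ι k V v))
        = SymmetricAlgebra.ι k V v
      rw [SymmetricAlgebra.lift_ι_apply]
      exact DirectSum.coeAlgHom_of _ _ _)
    fun i x => by
    obtain ⟨x, hx⟩ := x
    dsimp only [Subtype.coe_mk, DirectSum.lof_eq_of]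
    induction hx using Submodule.pow_induction_on_left' with
    | algebraMap r =>
      rw [AlgHom.commutes, DirectSum.algebraMap_apply]; rfl
    | add x y i hx hy ihx ihy =>
      rw [map_add, ihx, ihy, ← map_add]
      rfl
    | mem_mul m hm i x hx ih =>
      obtain ⟨v, rfl⟩ := hm
      rw [map_mul, ih, SymmetricAlgebra.lift_ι_apply]
      simp only [LinearMap.comp_apply, DirectSum.lof_eq_of]
      rw [DirectSum.of_mul_of]
      exact DirectSum.of_eq_of_gradedMonoid_eq (Sigma.subtype_ext (add_comm _ _) rfl)
end Sym

section DS
variable {k : Type u} [Field k] {P : Type u} [CommRing P] [Algebra k P] (ℬ : ℕ → Submodule k P)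
  [SetLike.GradedMonoid ℬ]

open DirectSum

/-- The graded ring `⨁ n, ℬ n`. -/
def GradedSum : Type u := ⨁ n, ℬ n

instance : CommRing (GradedSum ℬ) := inferInstanceAs (CommRing (⨁ n, ℬ n))

instance : Algebra k (GradedSum ℬ) := inferInstanceAs (Algebra k (⨁ n, ℬ n))

/-- The inclusion of the `n`-th summand. -/
def GradedSum.of (n : ℕ) : ℬ n →ₗ[k] GradedSum ℬ := lof k ℕ (fun n => ℬ n) n

/-- The `n`-th summand, as a subspace. -/
def GradedSum.piece (n : ℕ) : Submodule k (GradedSum ℬ) := LinearMap.range (GradedSum.of ℬ n)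

/-- The ring homomorphism `⨁ n, ℬ n → P` induced by the inclusions. -/
def GradedSum.toRingHom : GradedSum ℬ →+* P := (DirectSum.coeAlgHom ℬ).toRingHom

instance : SetLike.GradedMonoid (GradedSum.piece ℬ) where
  one_mem := ⟨⟨1, SetLike.GradedOne.one_mem⟩, rfl⟩
  mul_mem := by
    rintro i j _ _ ⟨a, rfl⟩ ⟨b, rfl⟩
    exact ⟨⟨a.1 * b.1, SetLike.mul_mem_graded a.2 b.2⟩, (DirectSum.of_mul_of _ _).symm⟩

/-- The decomposition of `⨁ n, ℬ n` into its summands. -/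
def GradedSum.decomposeHom : GradedSum ℬ →ₗ[k] ⨁ n, GradedSum.piece ℬ n :=
  show (⨁ n, ℬ n) →ₗ[k] ⨁ n, GradedSum.piece ℬ n from
  DirectSum.toModule k ℕ _ fun n =>
     lof k ℕ (fun n => GradedSum.piece ℬ n) n ∘ₗ (GradedSum.of ℬ n).rangeRestrict

theorem GradedSum.decomposeHom_of (n : ℕ) (x : ℬ n) :
    GradedSum.decomposeHom ℬ (GradedSum.of ℬ n x) =
      DirectSum.of (fun n => GradedSum.piece ℬ n) n ⟨GradedSum.of ℬ n x, x, rfl⟩ :=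
  DirectSum.toModule_lof (φ := fun n =>
     lof k ℕ (fun n => GradedSum.piece ℬ n) n ∘ₗ (GradedSum.of ℬ n).rangeRestrict) k n x

@[elab_as_elim]
theorem GradedSum.induction {p : GradedSum ℬ → Prop} (x : GradedSum ℬ) (zero : p 0)
    (of : ∀ n (x : ℬ n), p (GradedSum.of ℬ n x)) (add : ∀ x y, p x → p y → p (x + y)) : p x :=
  DirectSum.induction_on (motive := p) x zero of add

instance : GradedAlgebra (GradedSum.piece ℬ) where
  decompose' := GradedSum.decomposeHom ℬ
  left_inv x := by
    induction x using GradedSum.induction with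
    | zero => rw [map_zero, map_zero]
    | of i x => rw [GradedSum.decomposeHom_of, DirectSum.coeAddMonoidHom_of]
    | add x y hx hy => rw [map_add, map_add, hx, hy]
  right_inv x := by
    induction x using DirectSum.induction_on with
    | zero => rw [map_zero, map_zero]
    | of i x =>
      obtain ⟨_, ⟨x, rfl⟩⟩ := x
      rw [DirectSum.coeAddMonoidHom_of, GradedSum.decomposeHom_of]
    | add x y hx hy => rw [map_add, map_add, hx, hy]
end DS

/-! ### Varieties, linear algebraic groups and actions -/

section Group

open MonoidalCategory CartesianMonoidalCategory MonObj

variable {k : Type u} [Field k]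

/-- Schemes over `k`. -/
abbrev Sch (k : Type u) [Field k] := Over (Spec (CommRingCat.of k))

/-- A variety over `k`: reduced, separated and of finite type (not necessarily irreducible). -/
structure IsVariety (X : Sch k) : Prop where
  isReduced : IsReduced X.left
  isSeparated : IsSeparated X.hom
  locallyOfFiniteType : LocallyOfFiniteType X.hom
  quasiCompact : QuasiCompact X.hom

/-- A linear algebraic group over `k`: a group object whose underlying scheme is an affine
variety. -/
structure IsLinearAlgebraicGroup (H : Sch k) [GrpObj H] : Prop where
  isVariety : IsVariety H
  isAffine : IsAffine H.left

/-- The `k`-points of `H`. -/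
abbrev Pt (H : Sch k) := 𝟙_ (Sch k) ⟶ H

variable {H : Sch k} [GrpObj H] (X : Sch k) [ModObj H X]

/-- The automorphism `x ↦ h x` of `X` given by a point `h` of `H`. -/
def translate (h : Pt H) : X ⟶ X := (toUnit X ≫ h) • 𝟙 X

theorem translate_comp {M N : Sch k} [ModObj H M] [ModObj H N] (f : M ⟶ N) [IsModHom H f]
    (h : Pt H) : translate M h ≫ f = f ≫ translate N h := by
  rw [translate, IsModHom.map_smul, translate, ModObj.comp_smul]
  simp

theorem translate_inv (h : Pt H) : translate X h⁻¹ ≫ translate X h = 𝟙 X := by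
  rw [translate, translate, ModObj.comp_smul, Category.comp_id, smul_smul, comp_toUnit_assoc,
    ← MonObj.comp_mul, mul_inv_cancel, MonObj.comp_one, one_smul]

theorem le_preimage_top (X : Sch k) (U : X.left.Opens) : U ≤ X.hom ⁻¹ᵁ ⊤ := le_top

/-- The structure map `k → 𝒪(U)` of an open subset `U` of a `k`-scheme. -/
def structureRingHom (X : Sch k) (U : X.left.Opens) : k →+* Γ(X.left, U) :=
  ((Scheme.ΓSpecIso (CommRingCat.of k)).inv ≫ X.hom.appLE ⊤ U (le_preimage_top _ U)).hom

theorem map_structureRingHom (X : Sch k) {U V : X.left.Opens} (h : V ≤ U) (a : k) :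
    X.left.presheaf.map (homOfLE h).op (structureRingHom X U a) = structureRingHom X V a := by
  have e : ((Scheme.ΓSpecIso (CommRingCat.of k)).inv ≫ X.hom.appLE ⊤ U (le_preimage_top _ U)) ≫
      X.left.presheaf.map (homOfLE h).op =
      (Scheme.ΓSpecIso (CommRingCat.of k)).inv ≫ X.hom.appLE ⊤ V (le_preimage_top _ V) := by
    rw [Category.assoc, Scheme.Hom.appLE_map]
  exact congr($(e).hom a)

theorem appLE_structureRingHom {X Y : Sch k} (f : X ⟶ Y) {U : Y.left.Opens} {V : X.left.Opens}
    (h : V ≤ f.left ⁻¹ᵁ U) (a : k) :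
    f.left.appLE U V h (structureRingHom Y U a) = structureRingHom X V a := by
  have e : ((Scheme.ΓSpecIso (CommRingCat.of k)).inv ≫ Y.hom.appLE ⊤ U (le_preimage_top _ U)) ≫
      f.left.appLE U V h =
      (Scheme.ΓSpecIso (CommRingCat.of k)).inv ≫ X.hom.appLE ⊤ V (le_preimage_top _ V) := by
    rw [Category.assoc, Scheme.Hom.appLE_comp_appLE]
    congr 2
    exact Over.w f
  exact congr($(e).hom a)

end Group

/-! ### Projective spaces and line bundles as invertible sheaves -/

section Projective

/-- The structure morphism `Proj A ⟶ Spec k` for a graded `k`-algebra `A`. -/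
def projToSpec {k A : Type u} [CommRing k] [CommRing A] [Algebra k A]
    (𝒜 : ℕ → Submodule k A) [GradedAlgebra 𝒜] : Proj 𝒜 ⟶ Spec (.of k) :=
  Proj.toSpecZero 𝒜 ≫ Spec.map (CommRingCat.ofHom (algebraMap k (𝒜 0)))

variable (k : Type u) [Field k]

/-- The projective space `ℙ(V^*) = Proj (Sym V)` of one-dimensional subspaces of the dual
of `V`. -/
abbrev ProjSpace (V : Type u) [AddCommGroup V] [Module k V] : Scheme.{u} := Proj (symGrading k V)

/-- The sheaf `𝒪(1)` on `ℙ(V^*)`. -/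
abbrev ProjSpace.O1 (V : Type u) [AddCommGroup V] [Module k V] : (ProjSpace k V).Modules :=
  twistingSheaf (symGrading k V) 1

/-- The global section of `𝒪(1)` on `ℙ(V^*)` given by `v ∈ V`. -/
def ProjSpace.coordinate {V : Type u} [AddCommGroup V] [Module k V] (v : V) :
    Γ(ProjSpace.O1 k V, ⊤) :=
  twistSection (symGrading k V) (ι_mem_symGrading k V v) ⊤

/-- The morphism `ψ : Y ⟶ ℙ(V^*)` is defined by the sheaf `M` and the map `α` from `V` to the
global sections of `M`: there is an isomorphism `ψ^* 𝒪(1) ≅ M` (the transpose of `η`) which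
sends the pullback of the section `v` of `𝒪(1)` to `α v`, for all `v ∈ V`. -/
def IsDefinedByLinearSystem {V : Type u} [AddCommGroup V] [Module k V] {Y : Scheme.{u}}
    (ψ : Y ⟶ ProjSpace k V) (M : Y.Modules) (α : V → Γ(M, ⊤)) : Prop :=
  ∃ η : ProjSpace.O1 k V ⟶ (Scheme.Modules.pushforward ψ).obj M,
    IsIso (((Scheme.Modules.pullbackPushforwardAdjunction ψ).homEquiv _ _).symm η) ∧
    ∀ v : V, η.app ⊤ (ProjSpace.coordinate k v) = α v

/-- A sheaf of modules is a line bundle if it is locally isomorphic to the structure sheaf. -/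
def IsLineBundle {Y : Scheme.{u}} (M : Y.Modules) : Prop :=
  ∀ y : Y, ∃ U : Y.Opens, y ∈ U ∧
    Nonempty (M.restrict U.ι ≅ SheafOfModules.unit U.toScheme.ringCatSheaf)

/-- A line bundle `M` on a `k`-scheme `p : Y ⟶ Spec k` is very ample if there is a locally closed
embedding `i` over `k` of `Y` in a projective space, with `i^* 𝒪(1) ≅ M`. -/
def IsVeryAmple {Y : Scheme.{u}} (p : Y ⟶ Spec (.of k)) (M : Y.Modules) : Prop :=
  IsLineBundle M ∧ ∃ (W : Type u) (_ : AddCommGroup W) (_ : Module k W)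
    (_ : FiniteDimensional k W) (i : Y ⟶ ProjSpace k W), IsImmersion i ∧
      i ≫ projToSpec (symGrading k W) = p ∧
      Nonempty ((Scheme.Modules.pullback i).obj (ProjSpace.O1 k W) ≅ M)

end Projective

/-! ### Line bundles and linearisations -/

/-- A (geometric) line bundle on a scheme `X`, given by its total space `proj : total ⟶ X`
together with its fibrewise linear coordinates: `IsCoord U t` says that the function `t` on
`proj⁻¹ U` is a linear coordinate on the fibres over `U`. -/
structure LineBundle (X : Scheme.{u}) where
  total : Scheme.{u}
  proj : total ⟶ X
  IsCoord : ∀ U : X.Opens, Γ(total, proj ⁻¹ᵁ U) → Prop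
  /-- A linear coordinate over `U` trivialises the bundle, `proj⁻¹ U ≅ U × 𝔸¹`. -/
  isIso_of_isCoord : ∀ (U : X.Opens) (t : Γ(total, proj ⁻¹ᵁ U)), IsCoord U t →
    IsIso (AffineSpace.homOfVector (n := PUnit.{u + 1}) (X := (proj ⁻¹ᵁ U).toScheme) (S := U.toScheme)
      (proj ∣_ U) (fun _ => (proj ⁻¹ᵁ U).topIso.inv t))
  /-- Two linear coordinates over `U` differ by a linear automorphism of `U × 𝔸¹`, that is by an
  invertible function on `U`. -/
  isCoord_iff : ∀ (U : X.Opens) (t t' : Γ(total, proj ⁻¹ᵁ U)), IsCoord U t →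
    (IsCoord U t' ↔ ∃ g : Γ(X, U)ˣ, t' = proj.app U g * t)
  /-- Being a linear coordinate is stable under restriction, and local. -/
  isCoord_res : ∀ (U V : X.Opens) (hVU : V ≤ U) (t : Γ(total, proj ⁻¹ᵁ U)), IsCoord U t →
    IsCoord V (total.presheaf.map (homOfLE (proj.preimage_mono hVU)).op t)
  isCoord_of_locally : ∀ (U : X.Opens) (t : Γ(total, proj ⁻¹ᵁ U)),
    (∀ x ∈ U, ∃ (V : X.Opens) (hVU : V ≤ U), x ∈ V ∧
      IsCoord V (total.presheaf.map (homOfLE (proj.preimage_mono hVU)).op t)) → IsCoord U t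
  /-- The bundle is locally trivial. -/
  exists_isCoord : ∀ x : X, ∃ (U : X.Opens) (t : Γ(total, proj ⁻¹ᵁ U)), x ∈ U ∧ IsCoord U t

namespace LineBundle

variable {X : Scheme.{u}} (L : LineBundle X)

/-- A local linear coordinate of `L`, on an open subset `U` of `X`. -/
structure Coord where
  U : X.Opens
  t : Γ(L.total, L.proj ⁻¹ᵁ U)
  isCoord : L.IsCoord U t

variable {L}

/-- Restriction of a coordinate to a smaller open subset. -/
def Coord.res (c : L.Coord) (V : X.Opens) (hVU : V ≤ c.U) : L.Coord :=
  ⟨V, _, L.isCoord_res c.U V hVU c.t c.isCoord⟩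

/-- The coordinate `g t`, where `g` is an invertible function on `U`. -/
def Coord.smul (c : L.Coord) (g : Γ(X, c.U)ˣ) : L.Coord :=
  ⟨c.U, L.proj.app c.U g * c.t, (L.isCoord_iff c.U c.t _ c.isCoord).2 ⟨g, rfl⟩⟩

end LineBundle

section Linearisation

open MonoidalCategory CartesianMonoidalCategory MonObj

variable {k : Type u} [Field k]

/-- A linearisation of an action of `H` on `X`: a line bundle `L → X` with an action of `H` on the
total space of `L`, such that the projection is equivariant and each `h : L_x → L_{hx}` is linear
(that is, fibrewise linear coordinates pull back to fibrewise linear coordinates). -/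
structure Linearisation (H X : Sch k) [GrpObj H] [ModObj H X] extends LineBundle X.left where
  [action : ModObj H (Over.mk (proj ≫ X.hom))]
  [equivariant : IsModHom H (Over.homMk proj rfl : Over.mk (proj ≫ X.hom) ⟶ X)]
  linear : ∀ (h : Pt H) (U : X.left.Opens) (t : Γ(total, proj ⁻¹ᵁ U)), IsCoord U t →
    ∀ hle : proj ⁻¹ᵁ ((translate X h).left ⁻¹ᵁ U) ≤
        (translate (Over.mk (proj ≫ X.hom)) h).left ⁻¹ᵁ (proj ⁻¹ᵁ U),
      IsCoord ((translate X h).left ⁻¹ᵁ U)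
        ((translate (Over.mk (proj ≫ X.hom)) h).left.appLE _ _ hle t)

namespace Linearisation

variable {H X : Sch k} [GrpObj H] [ModObj H X] (L : Linearisation H X)

attribute [instance] Linearisation.action Linearisation.equivariant

theorem preimage_le (h : Pt H) (U : X.left.Opens) :
    L.proj ⁻¹ᵁ ((translate X h).left ⁻¹ᵁ U) ≤
      (translate (Over.mk (L.proj ≫ X.hom)) h).left ⁻¹ᵁ (L.proj ⁻¹ᵁ U) := by
  have := congrArg Over.Hom.left (translate_comp
    (Over.homMk L.proj rfl : Over.mk (L.proj ≫ X.hom) ⟶ X) h)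
  simp only [Over.comp_left, Over.homMk_left] at this
  rw [← Scheme.Hom.comp_preimage, ← Scheme.Hom.comp_preimage, ← this]

theorem le_preimage_preimage (h : Pt H) (U : X.left.Opens) :
    U ≤ (translate X h⁻¹).left ⁻¹ᵁ ((translate X h).left ⁻¹ᵁ U) := by
  have := congrArg Over.Hom.left (translate_inv X h)
  simp only [Over.comp_left, Over.id_left] at this
  rw [← Scheme.Hom.comp_preimage, this]
  rfl

/-- The coordinate `l ↦ t (h l)` over `h⁻¹ U`, where `t` is a coordinate over `U`. -/
def pullCoord (h : Pt H) (c : L.Coord) : L.Coord :=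
  ⟨(translate X h).left ⁻¹ᵁ c.U, _, L.linear h c.U c.t c.isCoord (L.preimage_le h c.U)⟩

/-- Families `(s_t)`, indexed by the local linear coordinates `t` of `L`, of functions on the
domains of these coordinates. -/
def LocalFunctions : Type u := ∀ c : L.Coord, Γ(X.left, c.U)

instance : CommRing L.LocalFunctions := inferInstanceAs (CommRing (∀ c : L.Coord, Γ(X.left, c.U)))

/-- Scalars in `k` act through the structure maps `k → 𝒪(U)`. -/
instance : Algebra k L.LocalFunctions :=
  RingHom.toAlgebra (RingHom.pi fun c : L.Coord => structureRingHom X c.U)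

/-- The value of a family in the coordinate `c`. -/
def evalAt (c : L.Coord) : L.LocalFunctions →+* Γ(X.left, c.U) :=
  Pi.evalRingHom (fun c : L.Coord => (Γ(X.left, c.U) : Type u)) c

theorem evalAt_algebraMap (c : L.Coord) (a : k) :
    L.evalAt c (algebraMap k L.LocalFunctions a) = structureRingHom X c.U a := rfl

/-- The space `H⁰(X, L^{⊗ r})`. A section `s` of `L^{⊗ r}` is given by its values `s_t` in the
local linear coordinates `t` of `L`, which are compatible with restrictions and
satisfy `s_{g t} = g ^ r s_t` for invertible functions `g`. -/
def sections (r : ℕ) : Submodule k L.LocalFunctions where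
  carrier := {s | (∀ (c : L.Coord) (V : X.left.Opens) (hV : V ≤ c.U),
      L.evalAt (c.res V hV) s = X.left.presheaf.map (homOfLE hV).op (L.evalAt c s)) ∧
    ∀ (c : L.Coord) (g : Γ(X.left, c.U)ˣ), 
      L.evalAt (c.smul g) s = (g : Γ(X.left, c.U)) ^ r * L.evalAt c s}
  zero_mem' := ⟨fun c V hV => by rw [map_zero, map_zero, map_zero]; rfl,
    fun c g => by rw [map_zero, map_zero, mul_zero]; rfl⟩
  add_mem' := by
    rintro s s' ⟨h1, h2⟩ ⟨h1', h2'⟩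
    refine ⟨fun c V hV => ?_, fun c g => ?_⟩
    · rw [map_add, map_add, map_add, h1, h1']; rfl
    · rw [map_add, map_add, h2, h2', mul_add]; rfl
  smul_mem' := by
    rintro a s ⟨h1, h2⟩
    refine ⟨fun c V hV => ?_, fun c g => ?_⟩
    · rw [Algebra.smul_def, map_mul, map_mul, map_mul, h1, evalAt_algebraMap, evalAt_algebraMap]
      exact congrArg₂ (· * ·) (map_structureRingHom X hV a).symm rfl
    · rw [Algebra.smul_def, map_mul, map_mul, h2, evalAt_algebraMap, evalAt_algebraMap]
      exact mul_left_comm _ _ _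

instance : SetLike.GradedMonoid L.sections where
  one_mem := by
    refine ⟨fun c V hV => ?_, fun c g => ?_⟩
    · rw [map_one, map_one, map_one]; rfl
    · rw [map_one, map_one, pow_zero]; exact (one_mul (1 : Γ(X.left, c.U))).symm
  mul_mem := by
    rintro i j s s' ⟨h1, h2⟩ ⟨h1', h2'⟩
    refine ⟨fun c V hV => ?_, fun c g => ?_⟩
    · rw [map_mul, map_mul, map_mul, h1, h1']; rfl
    · rw [map_mul, map_mul, h2, h2', pow_add]
      exact mul_mul_mul_comm _ _ _ _

/-- The action of `h ∈ H` on sections, `(h s)(x) = h (s (h⁻¹ x))`. In a coordinate `t`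
this is `(h s)_t (x) = s_{t ∘ h} (h⁻¹ x)`. -/
def act (h : Pt H) : L.LocalFunctions →ₐ[k] L.LocalFunctions where
  toRingHom := RingHom.pi fun c : L.Coord =>
    ((translate X h⁻¹).left.appLE _ _ (le_preimage_preimage h c.U)).hom.comp
      (L.evalAt (L.pullCoord h c))
  commutes' a := funext fun _ => appLE_structureRingHom (translate X h⁻¹) _ a

/-- The space of invariant sections `H⁰(X, L^{⊗ r})^H`. -/
def invariants (r : ℕ) : Submodule k L.LocalFunctions where
  carrier := {s | s ∈ L.sections r ∧ ∀ h : Pt H, L.act h s = s}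
  zero_mem' := ⟨zero_mem _, fun h => map_zero _⟩
  add_mem' := fun ha hb => ⟨add_mem ha.1 hb.1, fun h => by rw [map_add, ha.2, hb.2]⟩
  smul_mem' := fun a _ hs => ⟨Submodule.smul_mem _ a hs.1, fun h => by rw [map_smul, hs.2]⟩

instance : SetLike.GradedMonoid L.invariants where
  one_mem := ⟨SetLike.GradedOne.one_mem, fun h => map_one _⟩
  mul_mem := fun _ _ _ _ ha hb =>
    ⟨SetLike.mul_mem_graded ha.1 hb.1, fun h => by rw [map_mul, ha.2, hb.2]⟩

/-- The ring of invariants `S^H = ⨁ H⁰(X, L^{⊗ r})^H`. -/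
abbrev InvariantRing : Type u := GradedSum L.invariants

/-- The grading of `S^H`. -/
abbrev grading : ℕ → Submodule k L.InvariantRing := GradedSum.piece L.invariants

/-- An invariant section of `L^{⊗ r}` as a homogeneous element of `S^H`. -/
def toRing {r : ℕ} (f : L.invariants r) : L.InvariantRing := GradedSum.of L.invariants r f

theorem toRing_mem {r : ℕ} (f : L.invariants r) : L.toRing f ∈ L.grading r :=
  LinearMap.mem_range_self _ f

/-- The open subset `X_f = {x | f x ≠ 0}`. -/
def nonvanishing (f : L.LocalFunctions) : X.left.Opens :=
  ⨆ c : L.Coord, X.left.basicOpen (L.evalAt c f)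

/-- `f` belongs to `I^{ss,fg}`: the algebra `(S^H)_(f)` is finitely generated over `k`. -/
def IsFG {r : ℕ} (f : L.invariants r) : Prop :=
  Algebra.FiniteType k (HomogeneousLocalization.Away L.grading (L.toRing f))

/-- The finitely generated semistable locus `X^{ss,fg}`. -/
def semistableFG : X.left.Opens :=
  ⨆ (r : ℕ) (_ : 0 < r) (f : L.invariants r) (_ : L.IsFG f), L.nonvanishing f.1

/-- The enveloping quotient `X⫽H`, as an open subset of `Proj (S^H)`. -/
def envelopingQuotient : (Proj L.grading).Opens :=
  ⨆ (r : ℕ) (_ : 0 < r) (f : L.invariants r) (_ : L.IsFG f),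
    Proj.basicOpen L.grading (L.toRing f)

/-- Let `B` be a graded ring and let `u` send the elements of `B` to (sums of) sections of tensor
powers of `L`. The morphism `φ : U ⟶ Proj B` is the one defined by `u` if, on each
open `W ⊆ U` with a coordinate `c` of `L` in which these sections generate the unit ideal, it is
the morphism `W ⟶ Proj B` given by the ring homomorphism `b ↦ (u b)_c` from `B` to `𝒪(W)`. -/
def IsMapDefinedBy {σ : Type*} {B : Type u} [CommRing B] [SetLike σ B] [AddSubgroupClass σ B]
    (ℬ : ℕ → σ) [GradedRing ℬ] (u : B →+* L.LocalFunctions) (U : X.left.Opens)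
    (φ : U.toScheme ⟶ Proj ℬ) : Prop :=
  ∀ (c : L.Coord) (hc : c.U ≤ U)
    (hgen : (HomogeneousIdeal.irrelevant ℬ).toIdeal.map
      ((c.U.topIso.inv.hom.comp (L.evalAt c)).comp u) = ⊤),
    X.left.homOfLE hc ≫ φ = Proj.fromOfGlobalSections ℬ
      ((c.U.topIso.inv.hom.comp (L.evalAt c)).comp u) hgen

/-- `q` is the canonical map `X^{ss,fg} ⟶ X⫽H`, induced by the inclusion of `S^H` in the
section ring of `L`. -/
def IsEnvelopingQuotientMap (q : L.semistableFG.toScheme ⟶ L.envelopingQuotient.toScheme) : Prop :=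
  L.IsMapDefinedBy L.grading (GradedSum.toRingHom L.invariants) L.semistableFG
    (q ≫ L.envelopingQuotient.ι)

/-- The fraction `v / f` in `(S^H)_(f)`, for invariant sections `v`, `f` of `L^{⊗ r}`. -/
def fraction {r : ℕ} (v f : L.invariants r) :
    HomogeneousLocalization.Away L.grading (L.toRing f) :=
  HomogeneousLocalization.Away.mk L.grading (L.toRing_mem f) 1 (L.toRing v)
    ((one_smul ℕ r).symm ▸ L.toRing_mem v)

/-- `V ⊆ H⁰(X, L^{⊗ r})` is an enveloping system adapted to the finite set `S` of invariant
sections. -/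
structure IsEnvelopingSystem (r : ℕ) (S : Set (L.invariants r))
    (V : Submodule k L.LocalFunctions) : Prop where
  pos : 0 < r
  finite : S.Finite
  le_sections : V ≤ L.sections r
  finiteDimensional : FiniteDimensional k V
  mem : ∀ f ∈ S, f.1 ∈ V
  stable : ∀ (h : Pt H), ∀ v ∈ V, L.act h v ∈ V
  isFG : ∀ f ∈ S, L.IsFG f
  adjoin_eq_top : ∀ f ∈ S,
    Algebra.adjoin k {y | ∃ v : L.invariants r, v.1 ∈ V ∧ y = L.fraction v f} = ⊤

/-- The open subset `⋃_{f ∈ S} X_f` of `X`. -/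
def unionNonvanishing {r : ℕ} (S : Set (L.invariants r)) : X.left.Opens :=
  ⨆ f ∈ S, L.nonvanishing f.1

/-- The open subset `⋃_{f ∈ S} Spec (S^H)_(f)` of `Proj (S^H)`. -/
def unionBasicOpen {r : ℕ} (S : Set (L.invariants r)) : (Proj L.grading).Opens :=
  ⨆ f ∈ S, Proj.basicOpen L.grading (L.toRing f)

/-- The sheaf `𝒪_𝒰(r)` on an open subscheme `𝒰` of `Proj (S^H)`. -/
def twist (𝒰 : (Proj L.grading).Opens) (r : ℕ) : 𝒰.toScheme.Modules :=
  (twistingSheaf L.grading r).restrict 𝒰.ι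

/-- The natural map `H⁰(X, L^{⊗ r})^H → H⁰(𝒰, 𝒪_𝒰(r))`. -/
def naturalMap (𝒰 : (Proj L.grading).Opens) {r : ℕ} (f : L.invariants r) :
    Γ(L.twist 𝒰 r, ⊤) :=
  ((twistingSheaf L.grading r).restrictAppIso 𝒰.ι ⊤).inv
    (twistSection L.grading (L.toRing_mem f) (𝒰.ι ''ᵁ ⊤))

/-- The structure morphism of an open subscheme `𝒰` of `Proj (S^H)` over `k`. -/
def structureMap (𝒰 : (Proj L.grading).Opens) : 𝒰.toScheme ⟶ Spec (.of k) :=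
  𝒰.ι ≫ projToSpec L.grading

/-- The `n`-th power of an invariant section of `L^{⊗ r}`. -/
def powInvariant {r : ℕ} (n : ℕ) (f : L.invariants r) : L.invariants (n * r) :=
  ⟨f.1 ^ n, SetLike.pow_mem_graded n f.2⟩

/-- The image of the multiplication map `V^{⊗ n} → H⁰(X, L^{⊗ rn})`. -/
def mulImage (V : Submodule k L.LocalFunctions) (n : ℕ) : Submodule k L.LocalFunctions :=
  LinearMap.range (PiTensorProduct.lift
    ((MultilinearMap.mkPiAlgebra k (Fin n) L.LocalFunctions).compLinearMap fun _ => V.subtype))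

end Linearisation
end Linearisation

end NonReductiveGIT
end

/-!
The enveloping quotient is glued from the affine schemes `D₊(f) = Spec (S^H)_(f)`, and an enveloping
system consists of coordinates on finitely many of them, all given by fractions with the same
denominators. The proof makes this precise with homogeneous coordinates.

*Morphisms to `Proj`.* A ring homomorphism `v` from a graded ring `B` to the functions on a scheme
defines a morphism to `Proj B` as soon as the image of the irrelevant ideal generates the unit
ideal; where `v t` is invertible it is the morphism to `Spec B_(t)` given by
`b / t ^ n ↦ v b / (v t) ^ n` (`comp_fromOfGlobalSections`). Hence proportional coordinates define
the same morphism (`comp_fromOfGlobalSections_eq`), and local coordinates which are proportional on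
overlaps glue (`existsUnique_of_local_sections`). Sections of the powers of `L` have values in local
coordinates of `L`, and a change of the coordinate multiplies the values of sections of
`L^{⊗ r}` by the `r`-th power of an invertible function (`Linearisation.exists_transition`). This
gives the canonical map `q`, the map `φ`, and the invariance of `φ`.

*Linear systems.* Let `θ : B → A` multiply degrees by `r`. On `D₊(θ t)`, for `t` of degree `1`, the
functions `θ b / θ t ^ n` are homogeneous coordinates of a morphism to `Proj B`; these morphisms glue
(`exists_linearMap`). The preimage of `D₊(t)` is `D₊(θ t)` (`linearMap_preimage`), over which the
morphism is `Spec` of the map `B_(t) → A_(θ t)`. If this map is surjective for the chosen `t`, the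
morphism is an immersion (`isImmersion_linearMap`). The sections `t` of `𝒪(1)` and `θ t` of `𝒪(r)`
are generators on these open sets, and a morphism of sheaves of modules can be prescribed on local
generators and is an isomorphism if it exchanges local generators; this identifies the pullback of
`𝒪(1)` with `𝒪(r)` (`exists_twist_transpose`).

*Enveloping systems.* For a space `W` of invariant sections apply this to `θ : Sym W → S^H`. That
the fractions with numerators in `W` and denominator `f` generate `(S^H)_(f)` is exactly the
surjectivity needed (`awayMapOfLinear_lift_surjective`, `Linearisation.exists_embedding`). Near a
point where `w ∈ W` does not vanish, the coordinates of the embedding, pulled back along `q`, are the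
coordinates of `φ` divided by powers of `w`, so that `φ` factors as required
(`Linearisation.homOfLE_comp_eq`). A quasi-compact open subset of the enveloping quotient is a finite
union of sets `D₊(f)` with finitely generated `(S^H)_(f)`; replacing each `f` by a power, the degrees
become equal, and so large that the finitely many generators can be written with denominator `f`
(`exists_common_degree`). The numerators span the enveloping system. The statement on powers holds
since `v / f = v f ^ (n - 1) / f ^ n` (`adjoin_fractions_pow`).
-/

noncomputable section

namespace NonReductiveGIT

/-! ### Morphisms to `Proj` -/

section MapsToProj

open HomogeneousLocalization

variable {σ : Type*} {B : Type u} [CommRing B] [SetLike σ B] [AddSubgroupClass σ B]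
  (ℬ : ℕ → σ) [GradedRing ℬ]

/-- The ring homomorphism `b / t ^ n ↦ v b / (v t) ^ n` from `B_(t)` to `R`, for a ring
homomorphism `v : B → R` which sends `t` to a unit. -/
def awayEval {R : Type*} [CommRing R] (v : B →+* R) {t : B} (ht : IsUnit (v t)) :
    Away ℬ t →+* R :=
  (IsLocalization.Away.lift t ht : Localization.Away t →+* R).comp
    (algebraMap (Away ℬ t) (Localization.Away t))

variable {ℬ}

theorem awayEval_mk_mul {R : Type*} [CommRing R] (v : B →+* R) {t : B} (ht : IsUnit (v t))
    {d : ℕ} (hd : t ∈ ℬ d) (n : ℕ) (b : B) (hb : b ∈ ℬ (n • d)) :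
    awayEval ℬ v ht (Away.mk ℬ hd n b hb) * v t ^ n = v b := by
  have e : Localization.mk b (⟨t ^ n, n, rfl⟩ : Submonoid.powers t) *
      algebraMap B (Localization.Away t) (t ^ n) =
      algebraMap B (Localization.Away t) b := by
    rw [Localization.mk_eq_mk']
    exact IsLocalization.mk'_spec _ b (⟨t ^ n, n, rfl⟩ : Submonoid.powers t)
  have := congrArg (IsLocalization.Away.lift t ht : Localization.Away t →+* R) e
  rw [map_mul, IsLocalization.Away.lift_eq, IsLocalization.Away.lift_eq, map_pow] at this
  exact this

theorem awayEval_comp {R S : Type*} [CommRing R] [CommRing S] (v : B →+* R) (g : R →+* S) {t : B}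
    (ht : IsUnit (v t)) (ht' : IsUnit (g.comp v t)) :
    awayEval ℬ (g.comp v) ht' = g.comp (awayEval ℬ v ht) := by
  rw [awayEval, awayEval, ← RingHom.comp_assoc]
  congr 1
  refine IsLocalization.ringHom_ext (Submonoid.powers t) ?_
  ext b
  simp

/-- Multiplying a homomorphism by the powers of a unit according to degrees does not change the
values of fractions of degree `0`. -/
theorem awayEval_eq_of_scale {R : Type*} [CommRing R] (v w : B →+* R) {t : B}
    (ht : IsUnit (v t)) (ht' : IsUnit (w t)) {d : ℕ} (hd : t ∈ ℬ d) (g : R)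
    (h : ∀ n, ∀ b ∈ ℬ n, w b = g ^ n * v b) : awayEval ℬ w ht' = awayEval ℬ v ht := by
  ext z
  obtain ⟨n, b, hb, rfl⟩ := Away.mk_surjective ℬ hd z
  refine (ht'.pow n).mul_right_cancel ?_
  rw [awayEval_mk_mul, h _ b hb, h _ t hd, mul_pow, mul_left_comm, awayEval_mk_mul, ← pow_mul,
    smul_eq_mul, mul_comm n]

/-- The pullback of the morphism defined by `v : B → Γ(X, ⊤)` to a scheme on which `v t` becomes
invertible factors through `Spec B_(t)`. -/
theorem comp_fromOfGlobalSections {X Y : Scheme.{u}} (g : Y ⟶ X) (v : B →+* Γ(X, ⊤))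
    (hv : (HomogeneousIdeal.irrelevant ℬ).toIdeal.map v = ⊤) {t : B} {d : ℕ} (hd : t ∈ ℬ d)
    (h0 : 0 < d) (ht : IsUnit (g.appTop.hom.comp v t)) :
    g ≫ Proj.fromOfGlobalSections ℬ v hv = Y.toSpecΓ ≫
      Spec.map (CommRingCat.ofHom (awayEval ℬ (g.appTop.hom.comp v) ht)) ≫
        Proj.awayι ℬ t hd h0 := by
  have hle : (⊤ : Y.Opens) ≤ g ⁻¹ᵁ X.basicOpen (v t) := by
    rw [Scheme.preimage_basicOpen]
    exact (Scheme.basicOpen_of_isUnit _ ht).ge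
  obtain ⟨g', hg'⟩ : ∃ g' : Y ⟶ (X.basicOpen (v t)).toScheme, g' ≫ (X.basicOpen (v t)).ι = g :=
    ⟨IsOpenImmersion.lift (X.basicOpen (v t)).ι g (by
      rw [Scheme.Opens.range_ι]; rintro _ ⟨y, rfl⟩; exact hle trivial),
      IsOpenImmersion.lift_fac _ _ _⟩
  have h1 : (X.basicOpen (v t)).ι ≫ Proj.fromOfGlobalSections ℬ v hv =
      Proj.toBasicOpenOfGlobalSections ℬ v rfl h0 hd ≫ (Proj.basicOpen ℬ t).ι :=
    by rw [← Proj.fromOfGlobalSections_resLE ℬ v hv h0 hd, Scheme.Hom.resLE_comp_ι]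
  have h2 : g ≫ Proj.fromOfGlobalSections ℬ v hv =
      g' ≫ (X.basicOpen (v t)).ι ≫ Proj.fromOfGlobalSections ℬ v hv := by
    rw [← Category.assoc, hg']
  rw [h2, h1, Proj.toBasicOpenOfGlobalSections]
  simp only [Category.assoc, Proj.basicOpenIsoSpec_inv_ι]
  rw [CommRingCat.ofHom_comp, Spec.map_comp_assoc, awayEval, CommRingCat.ofHom_comp,
    Spec.map_comp_assoc]
  have h3 : g' ≫ (X.isoOfEq (X.toSpecΓ_preimage_basicOpen (v t))).inv ≫
      X.toSpecΓ ∣_ PrimeSpectrum.basicOpen (v t) ≫ (basicOpenIsoSpecAway (v t)).hom =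
      Y.toSpecΓ ≫ Spec.map (CommRingCat.ofHom
        (IsLocalization.Away.lift (S := Localization.Away (v t)) (v t) (g := g.appTop.hom) ht)) := by
    rw [← cancel_mono (Spec.map (CommRingCat.ofHom
        (algebraMap Γ(X, ⊤) (Localization.Away (v t)))))]
    simp only [Category.assoc]
    rw [← Spec.map_comp, ← CommRingCat.ofHom_comp]
    have e : ((IsLocalization.Away.lift (S := Localization.Away (v t)) (v t)
        (g := g.appTop.hom) ht)).comp (algebraMap Γ(X, ⊤) (Localization.Away (v t))) =
        g.appTop.hom := by
      ext b; simp
    rw [e]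
    have e2 : (basicOpenIsoSpecAway (v t)).hom ≫ Spec.map (CommRingCat.ofHom
        (algebraMap Γ(X, ⊤) (Localization.Away (v t)))) =
          Scheme.Opens.ι (X := Spec Γ(X, ⊤)) (PrimeSpectrum.basicOpen (v t)) :=
      basicOpenIsoSpecAway_hom_SpecMap _
    have e3 : (X.isoOfEq (X.toSpecΓ_preimage_basicOpen (v t))).inv ≫
        X.toSpecΓ ∣_ PrimeSpectrum.basicOpen (v t) ≫
          Scheme.Opens.ι (X := Spec Γ(X, ⊤)) (PrimeSpectrum.basicOpen (v t)) =
        (X.basicOpen (v t)).ι ≫ X.toSpecΓ :=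
      (congrArg ((X.isoOfEq (X.toSpecΓ_preimage_basicOpen (v t))).inv ≫ ·)
        (morphismRestrict_ι X.toSpecΓ (PrimeSpectrum.basicOpen (v t)))).trans
        (Scheme.isoOfEq_inv_ι_assoc _ _ _)
    rw [e2]
    refine (congrArg (g' ≫ ·) e3).trans ?_
    rw [← Category.assoc, hg', Scheme.toSpecΓ_naturality]
    rfl
  rw [reassoc_of% h3, ← Spec.map_comp_assoc, ← CommRingCat.ofHom_comp]
  congr 4
  refine IsLocalization.ringHom_ext (Submonoid.powers t) ?_
  ext b
  simp

theorem isUnit_of_le_basicOpen {X : Scheme.{u}} {U : X.Opens} (f : Γ(X, U))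
    (h : U ≤ X.basicOpen f) : IsUnit f :=
  X.toRingedSpace.isUnit_of_isUnit_germ U f fun x hx =>
    (X.toRingedSpace.mem_basicOpen f x hx).1 (h hx)

/-- If the irrelevant ideal generates the unit ideal of `Γ(X, ⊤)`, then at each point some
homogeneous element of positive degree does not vanish. -/
theorem exists_mem_basicOpen {X : Scheme.{u}} (v : B →+* Γ(X, ⊤))
    (hv : (HomogeneousIdeal.irrelevant ℬ).toIdeal.map v = ⊤) (x : X) :
    ∃ d, 0 < d ∧ ∃ t ∈ ℬ d, x ∈ X.basicOpen (v t) := by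
  obtain ⟨i, y, hy⟩ := (Proj.openCoverOfMapIrrelevantEqTop ℬ v hv).exists_eq x
  refine ⟨i.1, i.2.2.1, i.2.1, i.2.2.2, ?_⟩
  rw [← hy]
  exact y.2

/-- Two morphisms to `Proj` whose homogeneous coordinates are proportional coincide. -/
theorem comp_fromOfGlobalSections_eq {X X' Y : Scheme.{u}} (a : Y ⟶ X) (a' : Y ⟶ X')
    (v : B →+* Γ(X, ⊤)) (v' : B →+* Γ(X', ⊤))
    (hv : (HomogeneousIdeal.irrelevant ℬ).toIdeal.map v = ⊤)
    (hv' : (HomogeneousIdeal.irrelevant ℬ).toIdeal.map v' = ⊤) (g : Γ(Y, ⊤))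
    (h : ∀ n, ∀ b ∈ ℬ n, a'.appTop (v' b) = g ^ n * a.appTop (v b)) :
    a ≫ Proj.fromOfGlobalSections ℬ v hv = a' ≫ Proj.fromOfGlobalSections ℬ v' hv' := by
  refine Scheme.hom_ext_of_forall _ _ fun y => ?_
  obtain ⟨d, h0, t, hd, hx⟩ := exists_mem_basicOpen v' hv' (a' y)
  have hy : y ∈ Y.basicOpen (a'.appTop (v' t)) := by
    rw [← Scheme.preimage_basicOpen_top]; exact hx
  set U := Y.basicOpen (a'.appTop (v' t)) with hU
  have hunit' : IsUnit ((U.ι ≫ a').appTop.hom.comp v' t) := by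
    have h1 : U.ι.appTop (a'.appTop (v' t)) = (U.ι ≫ a').appTop.hom.comp v' t := by
      rw [Scheme.Hom.comp_appTop]; rfl
    rw [← h1]
    have h2 := Scheme.preimage_basicOpen_top U.ι (a'.appTop (v' t))
    rw [← hU, Scheme.Opens.ι_preimage_self] at h2
    exact isUnit_of_le_basicOpen _ h2.le
  have hs : ∀ n, ∀ b ∈ ℬ n, (U.ι ≫ a').appTop.hom.comp v' b =
      U.ι.appTop g ^ n * (U.ι ≫ a).appTop.hom.comp v b := by
    intro n b hb
    have := congrArg U.ι.appTop (h n b hb)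
    rw [map_mul, map_pow] at this
    rw [Scheme.Hom.comp_appTop, Scheme.Hom.comp_appTop]
    exact this
  have hunit : IsUnit ((U.ι ≫ a).appTop.hom.comp v t) :=
    isUnit_of_mul_isUnit_right (hs d t hd ▸ hunit')
  refine ⟨U, hy, ?_⟩
  rw [← Category.assoc, ← Category.assoc, comp_fromOfGlobalSections _ v hv hd h0 hunit,
    comp_fromOfGlobalSections _ v' hv' hd h0 hunit',
    awayEval_eq_of_scale _ _ hunit hunit' hd _ hs]

/-- A morphism to `Proj` given by homogeneous coordinates `v` pulls back to the one given by `v'`,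
if `v'` is proportional to the pullback of `v`. -/
theorem comp_fromOfGlobalSections_of_proportional {Y Z : Scheme.{u}} (a : Y ⟶ Z)
    (v : B →+* Γ(Z, ⊤)) (v' : B →+* Γ(Y, ⊤))
    (hv : (HomogeneousIdeal.irrelevant ℬ).toIdeal.map v = ⊤)
    (hv' : (HomogeneousIdeal.irrelevant ℬ).toIdeal.map v' = ⊤) (g : Γ(Y, ⊤))
    (h : ∀ n, ∀ b ∈ ℬ n, v' b = g ^ n * a.appTop (v b)) :
    a ≫ Proj.fromOfGlobalSections ℬ v hv = Proj.fromOfGlobalSections ℬ v' hv' := by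
  rw [comp_fromOfGlobalSections_eq a (𝟙 Y) v v' hv hv' g fun n b hb => by
    rw [← h n b hb, Scheme.Hom.id_appTop]; rfl, Category.id_comp]

/-- Compatible local homogeneous coordinates define a unique morphism to `Proj`. -/
theorem existsUnique_of_local_coordinates {Z : Scheme.{u}} {U : Z.Opens} {ι : Type*}
    (V : ι → Z.Opens) (hVU : ∀ i, V i ≤ U) (hcov : ∀ x ∈ U, ∃ i, x ∈ V i)
    (v : ∀ i, B →+* Γ((V i).toScheme, ⊤))
    (hv : ∀ i, (HomogeneousIdeal.irrelevant ℬ).toIdeal.map (v i) = ⊤)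
    (hcompat : ∀ i j, ∃ g : Γ((V i ⊓ V j).toScheme, ⊤), ∀ n, ∀ b ∈ ℬ n,
      (Z.homOfLE (inf_le_right : V i ⊓ V j ≤ V j)).appTop (v j b) =
        g ^ n * (Z.homOfLE (inf_le_left : V i ⊓ V j ≤ V i)).appTop (v i b)) :
    ∃! φ : U.toScheme ⟶ Proj ℬ,
      ∀ i, Z.homOfLE (hVU i) ≫ φ = Proj.fromOfGlobalSections ℬ (v i) (hv i) := by
  let 𝒱 : U.toScheme.OpenCover := {
    I₀ := ι
    X i := V i
    f i := Z.homOfLE (hVU i)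
    mem₀ := by
      rw [Scheme.presieve₀_mem_precoverage_iff]
      refine ⟨fun x => ?_, inferInstance⟩
      obtain ⟨i, hi⟩ := hcov x.1 x.2
      exact ⟨i, ⟨x.1, hi⟩, Scheme.homOfLE_apply' (hVU i) x.1 hi⟩ }
  refine ⟨𝒱.glueMorphisms (fun i => Proj.fromOfGlobalSections ℬ (v i) (hv i)) fun i j => ?_,
    fun i => 𝒱.ι_glueMorphisms _ _ i, fun φ hφ => 𝒱.hom_ext _ _ fun i => ?_⟩
  · obtain ⟨g, hg⟩ := hcompat i j
    rw [← cancel_epi (isPullback_opens_inf_le (hVU i) (hVU j)).isoPullback.hom]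
    have := comp_fromOfGlobalSections_eq _ _ (v i) (v j) (hv i) (hv j) g hg
    rw [(isPullback_opens_inf_le (hVU i) (hVU j)).isoPullback_hom_fst_assoc,
      (isPullback_opens_inf_le (hVU i) (hVU j)).isoPullback_hom_snd_assoc]
    exact this
  · rw [𝒱.ι_glueMorphisms]
    exact hφ i

end MapsToProj

/-! ### Invertible sheaves given by local generators -/

section Generators

open Scheme.Modules

variable {Y Z : Scheme.{u}}

/-- The section `m` of `M` over `W` freely generates the restriction of `M` to `W`. -/
def IsGenerator (M : Y.Modules) {W : Y.Opens} (m : Γ(M, W)) : Prop :=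
  ∀ (W' : Y.Opens) (h : W' ≤ W),
    Function.Bijective fun a : Γ(Y, W') => a • M.presheaf.map (homOfLE h).op m

/-- Morphisms of sheaves of modules, from compatible linear maps on sections. -/
def homOfApp {M N : Y.Modules} (f : ∀ U : Y.Opens, Γ(M, U) →+ Γ(N, U))
    (hmap : ∀ (U V : Y.Opens) (i : V ⟶ U) (s : Γ(M, U)),
      f V (M.presheaf.map i.op s) = N.presheaf.map i.op (f U s))
    (hsmul : ∀ (U : Y.Opens) (a : Γ(Y, U)) (s : Γ(M, U)), f U (a • s) = a • f U s) : M ⟶ N :=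
  show SheafOfModules.Hom M N from
  ⟨PresheafOfModules.homMk
    { app := fun U => AddCommGrpCat.ofHom (f U.unop)
      naturality := fun U V i => by
        ext s
        exact hmap U.unop V.unop i.unop s }
    fun U a s => hsmul U.unop a s⟩

theorem app_map {M N : Y.Modules} (φ : M ⟶ N) {U V : Y.Opens} (i : V ⟶ U) (s : Γ(M, U)) :
    φ.app V (M.presheaf.map i.op s) = N.presheaf.map i.op (φ.app U s) :=
  congr($(φ.mapPresheaf.naturality i.op) s)

theorem map_map_apply (M : Y.Modules) {U V W : Y.Opens} (i : V ⟶ U) (j : W ⟶ V) (k : W ⟶ U)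
    (s : Γ(M, U)) : M.presheaf.map j.op (M.presheaf.map i.op s) = M.presheaf.map k.op s := by
  rw [← ConcreteCategory.comp_apply, ← M.presheaf.map_comp]
  rfl

theorem eq_of_map_eq (M : Y.Modules) {ι : Type*} {U : Y.Opens} (V : ι → Y.Opens)
    (hV : ∀ x ∈ U, ∃ i, x ∈ V i) (s t : Γ(M, U))
    (h : ∀ i, M.presheaf.map (homOfLE (inf_le_left : U ⊓ V i ≤ U)).op s =
      M.presheaf.map (homOfLE (inf_le_left : U ⊓ V i ≤ U)).op t) : s = t :=
  TopCat.Sheaf.eq_of_locally_eq' ⟨M.presheaf, M.isSheaf⟩ (fun i => U ⊓ V i) U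
    (fun i => homOfLE inf_le_left)
    (fun x hx => by
      obtain ⟨i, hi⟩ := hV x hx
      exact Opens.mem_iSup.2 ⟨i, hx, hi⟩) s t h

theorem exists_gluing (M : Y.Modules) {ι : Type*} {U : Y.Opens} (V : ι → Y.Opens)
    (hV : ∀ x ∈ U, ∃ i, x ∈ V i) (s : ∀ i, Γ(M, U ⊓ V i))
    (h : ∀ i j, M.presheaf.map (homOfLE (inf_le_left : (U ⊓ V i) ⊓ (U ⊓ V j) ≤ _)).op (s i) =
      M.presheaf.map (homOfLE (inf_le_right : (U ⊓ V i) ⊓ (U ⊓ V j) ≤ _)).op (s j)) :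
    ∃ t : Γ(M, U), ∀ i, M.presheaf.map (homOfLE (inf_le_left : U ⊓ V i ≤ U)).op t = s i :=
  (TopCat.Sheaf.existsUnique_gluing' ⟨M.presheaf, M.isSheaf⟩ (fun i => U ⊓ V i) U
    (fun i => homOfLE inf_le_left)
    (fun x hx => by
      obtain ⟨i, hi⟩ := hV x hx
      exact Opens.mem_iSup.2 ⟨i, hx, hi⟩) s h).exists

theorem IsGenerator.map {M : Y.Modules} {W : Y.Opens} {m : Γ(M, W)} (hm : IsGenerator M m)
    {W' : Y.Opens} (h : W' ≤ W) : IsGenerator M (M.presheaf.map (homOfLE h).op m) := by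
  intro W'' h'
  have := hm W'' (h'.trans h)
  simpa only [map_map_apply M (homOfLE h) (homOfLE h') (homOfLE (h'.trans h)) m] using this

/-- The map `Γ(E, U) → Γ(M, ψ⁻¹ U)` given by a morphism `E → ψ_* M`. -/
def transApp {ψ : Y ⟶ Z} {E : Z.Modules} {M : Y.Modules} (η : E ⟶ (pushforward ψ).obj M)
    (U : Z.Opens) (s : Γ(E, U)) : Γ(M, ψ ⁻¹ᵁ U) := η.app U s

theorem transApp_smul {ψ : Y ⟶ Z} {E : Z.Modules} {M : Y.Modules}
    (η : E ⟶ (pushforward ψ).obj M) (U : Z.Opens) (b : Γ(Z, U)) (s : Γ(E, U)) :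
    transApp η U (b • s) = ψ.app U b • transApp η U s :=
  Hom.app_smul η b s

theorem transApp_map {ψ : Y ⟶ Z} {E : Z.Modules} {M : Y.Modules}
    (η : E ⟶ (pushforward ψ).obj M) {U V : Z.Opens} (h : V ≤ U) (s : Γ(E, U)) :
    transApp η V (E.presheaf.map (homOfLE h).op s) =
      M.presheaf.map (homOfLE (ψ.preimage_mono h)).op (transApp η U s) :=
  app_map η (homOfLE h) s

theorem map_app_apply (ψ : Y ⟶ Z) {U V : Z.Opens} (h : V ≤ U) (a : Γ(Z, U)) :
    Y.presheaf.map (homOfLE (ψ.preimage_mono h)).op (ψ.app U a) =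
      ψ.app V (Z.presheaf.map (homOfLE h).op a) :=
  congr($(ψ.naturality (homOfLE h).op) a).symm

/-- A morphism `E → ψ_* N` can be prescribed on local generators of `E`, as soon as the preimages
of their domains cover `Y`. -/
theorem exists_hom_pushforward_of_generators (ψ : Y ⟶ Z) {E : Z.Modules} {N : Y.Modules}
    {ι : Type*} (V : ι → Z.Opens) (hV : ∀ y : Y, ∃ i, y ∈ ψ ⁻¹ᵁ V i) (m : ∀ i, Γ(E, V i))
    (hm : ∀ i, IsGenerator E (m i)) (n : ∀ i, Γ(N, ψ ⁻¹ᵁ V i))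
    (hn : ∀ (i j : ι) (W : Z.Opens) (hi : W ≤ V i) (hj : W ≤ V j) (a : Γ(Z, W)),
      E.presheaf.map (homOfLE hj).op (m j) = a • E.presheaf.map (homOfLE hi).op (m i) →
      N.presheaf.map (homOfLE (ψ.preimage_mono hj)).op (n j) =
        ψ.app W a • N.presheaf.map (homOfLE (ψ.preimage_mono hi)).op (n i)) :
    ∃ β : E ⟶ (pushforward ψ).obj N, ∀ i, transApp β (V i) (m i) = n i := by
  -- the coefficient of `s` with respect to the `i`-th generator
  have hc : ∀ (U : Z.Opens) (s : Γ(E, U)) (i : ι), ∃! a : Γ(Z, U ⊓ V i),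
      a • E.presheaf.map (homOfLE (inf_le_right : U ⊓ V i ≤ V i)).op (m i) =
        E.presheaf.map (homOfLE (inf_le_left : U ⊓ V i ≤ U)).op s :=
    fun U s i => ((hm i) _ inf_le_right).existsUnique _
  choose c hc hcu using hc
  have hcU : ∀ (U : Z.Opens) (s : Γ(E, U)) (i : ι) (W : Z.Opens) (hW : W ≤ U) (hWi : W ≤ V i)
      (a : Γ(Z, W)), a • E.presheaf.map (homOfLE hWi).op (m i) =
        E.presheaf.map (homOfLE hW).op s →
        Z.presheaf.map (homOfLE (le_inf hW hWi)).op (c U s i) = a := by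
    intro U s i W hW hWi a ha
    refine (hm i W hWi).injective ?_
    have := congrArg (E.presheaf.map (homOfLE (le_inf hW hWi)).op) (hc U s i)
    rw [Scheme.Modules.map_smul, map_map_apply E _ _ (homOfLE hWi),
      map_map_apply E _ _ (homOfLE hW)] at this
    exact this.trans ha.symm
  have hglue : ∀ (U : Z.Opens) (s : Γ(E, U)), ∃ t : Γ(N, ψ ⁻¹ᵁ U), ∀ i,
      N.presheaf.map (homOfLE (ψ.preimage_mono (inf_le_left : U ⊓ V i ≤ U))).op t =
        ψ.app _ (c U s i) •
          N.presheaf.map (homOfLE (ψ.preimage_mono (inf_le_right : U ⊓ V i ≤ V i))).op (n i) := by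
    intro U s
    refine exists_gluing N (U := ψ ⁻¹ᵁ U) (fun i => ψ ⁻¹ᵁ V i) (fun x _ => hV x) _ fun i j => ?_
    have h1 : (U ⊓ V i) ⊓ (U ⊓ V j) ≤ U ⊓ V i := inf_le_left
    have h2 : (U ⊓ V i) ⊓ (U ⊓ V j) ≤ U ⊓ V j := inf_le_right
    change N.presheaf.map (homOfLE (ψ.preimage_mono h1)).op _ =
      N.presheaf.map (homOfLE (ψ.preimage_mono h2)).op _
    rw [Scheme.Modules.map_smul, Scheme.Modules.map_smul,
      map_map_apply N _ _ (homOfLE (ψ.preimage_mono (h1.trans inf_le_right))),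
      map_map_apply N _ _ (homOfLE (ψ.preimage_mono (h2.trans inf_le_right))),
      map_app_apply, map_app_apply]
    obtain ⟨a, ha⟩ := (hm i _ (h1.trans inf_le_right)).surjective
      (E.presheaf.map (homOfLE (h2.trans inf_le_right)).op (m j))
    rw [hn i j _ (h1.trans inf_le_right) _ a ha.symm, smul_smul, ← map_mul]
    congr 2
    refine hcU U s i _ (h1.trans inf_le_left) (h1.trans inf_le_right) _ ?_
    dsimp only at ha
    rw [mul_smul, ha]
    have := congrArg (E.presheaf.map (homOfLE h2).op) (hc U s j)
    rw [Scheme.Modules.map_smul, map_map_apply E _ _ (homOfLE (h2.trans inf_le_right)),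
      map_map_apply E _ _ (homOfLE (h2.trans inf_le_left))] at this
    exact this
  choose t ht using hglue
  have ext : ∀ (U : Z.Opens) (s s' : Γ(N, ψ ⁻¹ᵁ U)),
      (∀ i, N.presheaf.map (homOfLE (ψ.preimage_mono (inf_le_left : U ⊓ V i ≤ U))).op s =
        N.presheaf.map (homOfLE (ψ.preimage_mono (inf_le_left : U ⊓ V i ≤ U))).op s') → s = s' :=
    fun U s s' => eq_of_map_eq N (U := ψ ⁻¹ᵁ U) (fun i => ψ ⁻¹ᵁ V i) (fun x _ => hV x) s s'
  refine ⟨homOfApp (N := (pushforward ψ).obj N) (fun U => AddMonoidHom.mk' (t U) fun s s' => ?_)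
    (fun U U' i s => ?_) fun U a s => ?_, fun i => ?_⟩
  · refine ext U _ _ fun i => ?_
    refine Eq.trans ?_ (map_add _ _ _).symm
    rw [ht, ht, ht, ← add_smul, ← map_add]
    congr 2
    refine (hm i _ inf_le_right).injective ?_
    dsimp only
    rw [hc, add_smul, hc, hc, map_add]
  · refine ext U' _ _ fun j => ?_
    change N.presheaf.map _ (t U' _) =
      N.presheaf.map _ (N.presheaf.map (homOfLE (ψ.preimage_mono i.le)).op (t U s))
    have hle : U' ⊓ V j ≤ U ⊓ V j := inf_le_inf_right _ i.le
    rw [ht, map_map_apply N _ _ (homOfLE (ψ.preimage_mono (inf_le_left.trans i.le))),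
      ← map_map_apply N (homOfLE (ψ.preimage_mono inf_le_left)) (homOfLE (ψ.preimage_mono hle))
        (homOfLE (ψ.preimage_mono (inf_le_left.trans i.le))), ht,
      Scheme.Modules.map_smul, map_map_apply N _ _ (homOfLE (ψ.preimage_mono inf_le_right)),
      map_app_apply]
    congr 2
    refine (hcU U s j _ (inf_le_left.trans i.le) inf_le_right _ ?_).symm
    rw [hc, map_map_apply E _ _ (homOfLE (inf_le_left.trans i.le))]
  · refine ext U _ _ fun i => ?_
    change N.presheaf.map _ (t U _) = N.presheaf.map _ (ψ.app U a • t U s)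
    rw [ht, Scheme.Modules.map_smul, ht, smul_smul, map_app_apply, ← map_mul]
    congr 2
    refine (hm i _ inf_le_right).injective ?_
    dsimp only
    rw [hc, mul_smul, hc, Scheme.Modules.map_smul]
  · refine ext (V i) _ _ fun j => ?_
    change N.presheaf.map _ (t _ _) = _
    rw [ht]
    exact (hn j i _ _ _ _ (hc (V i) (m i) j).symm).symm

/-- A morphism from a locally generated sheaf can be prescribed on generators. -/
theorem exists_hom_of_generators {M N : Y.Modules} {ι : Type*} (V : ι → Y.Opens)
    (hV : ∀ y : Y, ∃ i, y ∈ V i) (m : ∀ i, Γ(M, V i)) (hm : ∀ i, IsGenerator M (m i))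
    (n : ∀ i, Γ(N, V i))
    (hn : ∀ (i j : ι) (W : Y.Opens) (hi : W ≤ V i) (hj : W ≤ V j) (a : Γ(Y, W)),
      M.presheaf.map (homOfLE hj).op (m j) = a • M.presheaf.map (homOfLE hi).op (m i) →
      N.presheaf.map (homOfLE hj).op (n j) = a • N.presheaf.map (homOfLE hi).op (n i)) :
    ∃ β : M ⟶ N, ∀ i, β.app (V i) (m i) = n i := by
  obtain ⟨β, hβ⟩ := exists_hom_pushforward_of_generators (𝟙 Y) V hV m hm n
    fun i j W hi hj a ha => (hn i j W hi hj a ha).trans (by simp; rfl)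
  exact ⟨β ≫ (pushforwardId Y).hom.app N, hβ⟩

theorem hom_ext_of_generators {M N : Y.Modules} {ι : Type*} (V : ι → Y.Opens)
    (hV : ∀ y : Y, ∃ i, y ∈ V i) (m : ∀ i, Γ(M, V i)) (hm : ∀ i, IsGenerator M (m i))
    (β β' : M ⟶ N) (h : ∀ i, β.app (V i) (m i) = β'.app (V i) (m i)) : β = β' := by
  refine Scheme.Modules.hom_ext _ _ fun U => ?_
  ext s
  refine eq_of_map_eq N V (fun x _ => hV x) _ _ fun i => ?_
  obtain ⟨a, ha⟩ := (hm i (U ⊓ V i) inf_le_right).surjective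
    (M.presheaf.map (homOfLE inf_le_left).op s)
  dsimp only at ha
  rw [← app_map, ← app_map, ← ha, Hom.app_smul, Hom.app_smul, app_map, app_map, h]

/-- If `η : E → ψ_* M` sends local generators of `E` to local generators of `M`, on open subsets
whose preimages cover `Y`, then its transpose `ψ^* E → M` is an isomorphism. -/
theorem isIso_transpose (ψ : Y ⟶ Z) {E : Z.Modules} {M : Y.Modules}
    (η : E ⟶ (pushforward ψ).obj M) {ι : Type*} (W : ι → Z.Opens)
    (hW : ∀ y : Y, ∃ i, y ∈ ψ ⁻¹ᵁ W i) (e : ∀ i, Γ(E, W i)) (he : ∀ i, IsGenerator E (e i))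
    (hm : ∀ i, IsGenerator M (transApp η (W i) (e i))) :
    IsIso (((pullbackPushforwardAdjunction ψ).homEquiv _ _).symm η) := by
  refine isIso_of_coyoneda_map_bijective _ fun N => ?_
  -- it suffices that composition with `η` is a bijection `Hom (M, N) → Hom (E, ψ_* N)`
  rw [← ((pullbackPushforwardAdjunction ψ).homEquiv E N).bijective.of_comp_iff']
  have key : ((pullbackPushforwardAdjunction ψ).homEquiv E N) ∘
      (fun β : M ⟶ N => ((pullbackPushforwardAdjunction ψ).homEquiv _ _).symm η ≫ β) =
      fun β => η ≫ (pushforward ψ).map β := by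
    funext β
    rw [Function.comp_apply, Adjunction.homEquiv_naturality_right, Equiv.apply_symm_apply]
  rw [key]
  constructor
  · intro β β' h
    refine hom_ext_of_generators _ hW _ hm β β' fun i => ?_
    exact congr(($h).app (W i) (e i))
  · intro γ
    obtain ⟨β, hβ⟩ := exists_hom_of_generators (N := N) (fun i => ψ ⁻¹ᵁ W i) hW _ hm
      (fun i => transApp γ (W i) (e i)) fun i j V hi hj a ha => by
        obtain ⟨b, hb⟩ := (he i (W i ⊓ W j) inf_le_left).surjective
          (E.presheaf.map (homOfLE inf_le_right).op (e j))
        dsimp only at hb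
        have hV : V ≤ ψ ⁻¹ᵁ (W i ⊓ W j) := le_inf hi hj
        have h1 := congrArg (M.presheaf.map (homOfLE hV).op) (congrArg (transApp η _) hb)
        have h2 := congrArg (N.presheaf.map (homOfLE hV).op) (congrArg (transApp γ _) hb)
        rw [transApp_smul, transApp_map, transApp_map, Scheme.Modules.map_smul,
          map_map_apply M _ _ (homOfLE hi), map_map_apply M _ _ (homOfLE hj), ha] at h1
        rw [transApp_smul, transApp_map, transApp_map, Scheme.Modules.map_smul,
          map_map_apply N _ _ (homOfLE hi), map_map_apply N _ _ (homOfLE hj)] at h2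
        rw [← h2, (hm i V hi).injective h1]
    refine ⟨β, Scheme.Modules.hom_ext _ _ fun U => ?_⟩
    ext s
    refine eq_of_map_eq N (U := ψ ⁻¹ᵁ U) (fun i => ψ ⁻¹ᵁ W i) (fun x _ => hW x) _ _ fun i => ?_
    change N.presheaf.map (homOfLE (ψ.preimage_mono (inf_le_left : U ⊓ W i ≤ U))).op
      (β.app (ψ ⁻¹ᵁ U) (transApp η U s)) =
      N.presheaf.map (homOfLE (ψ.preimage_mono (inf_le_left : U ⊓ W i ≤ U))).op (transApp γ U s)
    obtain ⟨b, hb⟩ := (he i (U ⊓ W i) inf_le_right).surjective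
      (E.presheaf.map (homOfLE inf_le_left).op s)
    dsimp only at hb
    rw [← app_map, ← transApp_map η inf_le_left, ← transApp_map γ inf_le_left, ← hb,
      transApp_smul, transApp_smul, transApp_map, transApp_map, Hom.app_smul, app_map, hβ]

/-- A sheaf of modules with local generators is a line bundle. -/
theorem isLineBundle_of_generators {M : Y.Modules}
    (h : ∀ y : Y, ∃ (U : Y.Opens) (m : Γ(M, U)), y ∈ U ∧ IsGenerator M m) : IsLineBundle M := by
  intro y
  obtain ⟨U, m, hy, hm⟩ := h y
  refine ⟨U, hy, ⟨?_⟩⟩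
  have hle : ∀ V : U.toScheme.Opens, U.ι ''ᵁ V ≤ U := fun V => U.ι_image_le V
  let α : SheafOfModules.unit U.toScheme.ringCatSheaf ⟶ M.restrict U.ι :=
    (SheafOfModules.unitHomEquiv _).symm (PresheafOfModules.sectionsMk
      (fun V => M.presheaf.map (homOfLE (hle V.unop)).op m) (fun V W i => map_map_apply M _ _ _ m))
  let α' : Scheme.Modules.Hom (X := U.toScheme) (SheafOfModules.unit U.toScheme.ringCatSheaf)
    (M.restrict U.ι) := α
  have : IsIso (C := U.toScheme.Modules) α' := by
    refine (Hom.isIso_iff_isIso_app (φ := α')).2 fun V => ?_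
    rw [ConcreteCategory.isIso_iff_bijective]
    have e : ∀ a : Γ(Y, U.ι ''ᵁ V), α'.app V a =
        a • M.presheaf.map (homOfLE (hle V)).op m := by
      intro a
      change ((U.ι.appIso V).inv a) • M.presheaf.map (homOfLE (hle V)).op m = _
      rw [Scheme.Opens.ι_appIso]
      rfl
    exact (show (α'.app V : _ → _) = _ from funext e) ▸ hm (U.ι ''ᵁ V) (hle V)
  exact (@asIso _ _ _ _ _ this).symm

end Generators

/-! ### Local generators of the twisting sheaves -/

section TwistGenerators

open Scheme.Modules

theorem IsGenerator.restrict {Y : Scheme.{u}} {M : Y.Modules} {W : Y.Opens} {m : Γ(M, W)}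
    (hm : IsGenerator M m) (U : Y.Opens) (V : U.toScheme.Opens) (h : U.ι ''ᵁ V ≤ W) :
    IsGenerator (M.restrict U.ι) (W := V)
      ((M.restrictAppIso U.ι V).inv (M.presheaf.map (homOfLE h).op m)) := by
  intro V' h'
  have e : ∀ a : Γ(Y, U.ι ''ᵁ V'),
      (show Γ(U.toScheme, V') from a) • (M.restrict U.ι).presheaf.map (homOfLE h').op
        ((M.restrictAppIso U.ι V).inv (M.presheaf.map (homOfLE h).op m)) =
      (M.restrictAppIso U.ι V').inv (a • M.presheaf.map
        (homOfLE ((U.ι.image_mono h').trans h)).op m) := by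
    intro a
    change ((U.ι.appIso V').inv a) • M.presheaf.map (homOfLE (U.ι.image_mono h')).op
      (M.presheaf.map (homOfLE h).op m) = _
    rw [Scheme.Opens.ι_appIso, map_map_apply M _ _ (homOfLE ((U.ι.image_mono h').trans h))]
    rfl
  exact (show _ = _ from funext e) ▸ hm (U.ι ''ᵁ V') ((U.ι.image_mono h').trans h)

variable {k A : Type u} [CommRing k] [CommRing A] [Algebra k A]
  (𝒜 : ℕ → Submodule k A) [GradedAlgebra 𝒜]

theorem mk_mul_algebraMap {A : Type*} [CommRing A] {M : Submonoid A} (a t f : A) (h : t * f ∈ M)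
    (h' : t ∈ M) : Localization.mk a (⟨t * f, h⟩ : M) * algebraMap A (Localization M) f =
      Localization.mk a ⟨t, h'⟩ := by
  rw [← Localization.mk_one_eq_algebraMap, Localization.mk_mul, Localization.mk_eq_mk_iff,
    Localization.r_iff_exists]
  exact ⟨1, by simp; ring⟩

/-- An element `f` of degree `r` is a generator of `𝒪(r)` where it does not vanish. -/
theorem isGenerator_twistSection {r : ℕ} {f : A} (hf : f ∈ 𝒜 r) :
    IsGenerator (twistingSheaf 𝒜 r) (twistSection 𝒜 hf (Proj.basicOpen 𝒜 f)) := by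
  intro W h
  have hu : ∀ x : W, IsUnit (algebraMap A (ProjFiber 𝒜 x.1) f) := fun x =>
    IsLocalization.map_units (M := fiberPrimeCompl 𝒜 x.1) (ProjFiber 𝒜 x.1) ⟨f, h x.2⟩
  constructor
  · intro a b hab
    refine Subtype.ext (funext fun x => HomogeneousLocalization.val_injective _ ?_)
    have := congrFun (congrArg Subtype.val hab) x
    exact (hu x).mul_right_cancel this
  · intro s
    obtain ⟨s, hs⟩ := s
    have key : ∀ x : W, ∃ z : HomogeneousLocalization 𝒜 (fiberPrimeCompl 𝒜 x.1),
        z.val * algebraMap A (ProjFiber 𝒜 x.1) f = s x := by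
      intro x
      obtain ⟨V, hV, i, m, a, t, ht, hst⟩ := hs x
      refine ⟨HomogeneousLocalization.mk ⟨m + r, a, ⟨t.1 * f, SetLike.mul_mem_graded t.2 hf⟩,
        mul_mem (ht ⟨x.1, hV⟩) (h x.2)⟩, ?_⟩
      exact (mk_mul_algebraMap _ _ _ _ (ht ⟨x.1, hV⟩)).trans (hst ⟨x.1, hV⟩).symm
    choose z hz using key
    refine ⟨⟨z, fun x => ?_⟩, Subtype.ext (funext hz)⟩
    obtain ⟨V, hV, i, m, a, t, ht, hst⟩ := hs x
    refine ⟨V, hV, i, m + r, a, ⟨t.1 * f, SetLike.mul_mem_graded t.2 hf⟩,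
      fun y => mul_mem (ht y) (h (i.le y.2)), fun y => ?_⟩
    refine HomogeneousLocalization.val_injective _ ((hu ⟨y.1, i.le y.2⟩).mul_right_cancel ?_)
    exact (hz ⟨y.1, i.le y.2⟩).trans ((hst y).trans (mk_mul_algebraMap _ _ _ _ (ht y)).symm)

end TwistGenerators

/-! ### Functions on open subschemes -/

section OpenFunctions

theorem homOfLE_appTop_topIso_inv {Z : Scheme.{u}} {U V : Z.Opens} (h : V ≤ U) (s : Γ(Z, U)) :
    (Z.homOfLE h).appTop (U.topIso.inv s) = V.topIso.inv (Z.presheaf.map (homOfLE h).op s) := by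
  rw [Scheme.homOfLE_appTop, Scheme.Opens.topIso_inv, Scheme.Opens.topIso_inv]
  have e : ∀ {W₁ W₂ W₃ : Z.Opens} (i : W₂ ⟶ W₁) (j : W₃ ⟶ W₂) (k : W₃ ⟶ W₁),
      Z.presheaf.map i.op ≫ Z.presheaf.map j.op = Z.presheaf.map k.op := by
    intro W₁ W₂ W₃ i j k
    rw [← Functor.map_comp]
    rfl
  have h3 : V.ι ''ᵁ ⊤ ≤ U := by simpa using h
  exact congr($((e _ _ (homOfLE h3)).trans (e _ _ (homOfLE h3)).symm) s)

theorem appTop_topIso_inv {Y Z : Scheme.{u}} {U : Z.Opens} (a : Y ⟶ U.toScheme)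
    (h : ⊤ ≤ (a ≫ U.ι) ⁻¹ᵁ U) (s : Γ(Z, U)) :
    a.appTop (U.topIso.inv s) = (a ≫ U.ι).appLE U ⊤ h s := by
  have e : (a ≫ U.ι).appLE U ⊤ h = U.topIso.inv ≫ a.appTop := by
    rw [← Scheme.Hom.appLE_comp_appLE a U.ι _ ⊤ ⊤ U.ι_preimage_self.ge le_top,
      Scheme.Opens.ι_appLE, Scheme.Opens.topIso_inv, Scheme.Hom.appTop, Scheme.Hom.app_eq_appLE]
    rfl
  rw [e]
  rfl

theorem ι_appLE_top {Z : Scheme.{u}} (U : Z.Opens) (h : ⊤ ≤ U.ι ⁻¹ᵁ U) :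
    U.ι.appLE U ⊤ h = U.topIso.inv := by
  rw [Scheme.Opens.ι_appLE, Scheme.Opens.topIso_inv]
  rfl

theorem morphismRestrict_appTop_topIso_inv {Y Z : Scheme.{u}} (f : Y ⟶ Z) (U : Z.Opens)
    (s : Γ(Z, U)) :
    (f ∣_ U).appTop (U.topIso.inv s) = (f ⁻¹ᵁ U).topIso.inv (f.app U s) := by
  have h : (⊤ : (f ⁻¹ᵁ U).toScheme.Opens) ≤ (f ∣_ U ≫ U.ι) ⁻¹ᵁ U := by
    rw [Scheme.Hom.comp_preimage, Scheme.Opens.ι_preimage_self]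
    exact le_top
  rw [appTop_topIso_inv _ h]
  have h2 : ∀ (g : (f ⁻¹ᵁ U).toScheme ⟶ Z) (hg : g = (f ⁻¹ᵁ U).ι ≫ f) (h : ⊤ ≤ g ⁻¹ᵁ U),
      g.appLE U ⊤ h s = (f ⁻¹ᵁ U).topIso.inv (f.app U s) := by
    rintro _ rfl h
    rw [Scheme.Hom.comp_appLE]
    exact congr($(ι_appLE_top (f ⁻¹ᵁ U) h) (f.app U s))
  exact h2 _ (morphismRestrict_ι f U) h

theorem map_map_section {Z : Scheme.{u}} {U V W : Z.Opens} (i : V ⟶ U) (j : W ⟶ V) (k : W ⟶ U)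
    (s : Γ(Z, U)) : Z.presheaf.map j.op (Z.presheaf.map i.op s) = Z.presheaf.map k.op s := by
  rw [← ConcreteCategory.comp_apply, ← Z.presheaf.map_comp]
  rfl

theorem basicOpen_topIso_inv {Z : Scheme.{u}} (U : Z.Opens) (s : Γ(Z, U)) :
    U.toScheme.basicOpen (U.topIso.inv s) = U.ι ⁻¹ᵁ Z.basicOpen s := by
  have e : U.topIso.inv s = U.toScheme.presheaf.map
      (homOfLE U.ι_preimage_self.ge).op (U.ι.app U s) := by
    rw [Scheme.Opens.topIso_inv, Scheme.Opens.ι_app, Scheme.Opens.toScheme_presheaf_map]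
    exact (map_map_section _ _ _ s).symm
  rw [e, Scheme.basicOpen_res, Scheme.preimage_basicOpen, top_inf_eq]

end OpenFunctions

/-! ### Morphisms to `Proj` defined by functions on open subsets -/

section LocalSections

variable {σ : Type*} {B : Type u} [CommRing B] [SetLike σ B] [AddSubgroupClass σ B]
  {ℬ : ℕ → σ} [GradedRing ℬ]

/-- Compatible local homogeneous coordinates, given as functions on open subsets of `Z`, define a
unique morphism to `Proj`. -/
theorem existsUnique_of_local_sections {Z : Scheme.{u}} {U : Z.Opens} {ι : Type*}
    (V : ι → Z.Opens) (hVU : ∀ i, V i ≤ U) (hcov : ∀ x ∈ U, ∃ i, x ∈ V i)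
    (v : ∀ i, B →+* Γ(Z, V i))
    (hv : ∀ i, (HomogeneousIdeal.irrelevant ℬ).toIdeal.map
      ((V i).topIso.inv.hom.comp (v i)) = ⊤)
    (hcompat : ∀ i j, ∃ g : Γ(Z, V i ⊓ V j), ∀ n, ∀ b ∈ ℬ n,
      Z.presheaf.map (homOfLE (inf_le_right : V i ⊓ V j ≤ V j)).op (v j b) =
        g ^ n * Z.presheaf.map (homOfLE (inf_le_left : V i ⊓ V j ≤ V i)).op (v i b)) :
    ∃! φ : U.toScheme ⟶ Proj ℬ, ∀ i, Z.homOfLE (hVU i) ≫ φ =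
      Proj.fromOfGlobalSections ℬ ((V i).topIso.inv.hom.comp (v i)) (hv i) := by
  refine existsUnique_of_local_coordinates V hVU hcov _ hv fun i j => ?_
  obtain ⟨g, hg⟩ := hcompat i j
  refine ⟨(V i ⊓ V j).topIso.inv g, fun n b hb => ?_⟩
  have h1 := homOfLE_appTop_topIso_inv (inf_le_right : V i ⊓ V j ≤ V j) (v j b)
  have h2 := homOfLE_appTop_topIso_inv (inf_le_left : V i ⊓ V j ≤ V i) (v i b)
  refine h1.trans ?_
  rw [hg n b hb, map_mul, map_pow]
  exact congrArg _ h2.symm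

/-- Functions on `D₊(t)` pull back along a morphism to `Spec B_(t) ⊆ Proj B` as expected. -/
theorem appLE_awayToSection {Y : Scheme.{u}} (g : Y ⟶ Proj ℬ) {t : B} {d : ℕ} (hd : t ∈ ℬ d)
    (h0 : 0 < d) (ρ : HomogeneousLocalization.Away ℬ t →+* Γ(Y, ⊤))
    (hg : g = Y.toSpecΓ ≫ Spec.map (CommRingCat.ofHom ρ) ≫ Proj.awayι ℬ t hd h0)
    (h : ⊤ ≤ g ⁻¹ᵁ Proj.basicOpen ℬ t) (z : HomogeneousLocalization.Away ℬ t) :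
    g.appLE (Proj.basicOpen ℬ t) ⊤ h (Proj.awayToSection ℬ t z) = ρ z := by
  obtain ⟨g', e, e2⟩ : ∃ g' : Y ⟶ (Proj.basicOpen ℬ t).toScheme,
      g = g' ≫ (Proj.basicOpen ℬ t).ι ∧
      g' ≫ Proj.basicOpenToSpec ℬ t = Y.toSpecΓ ≫ Spec.map (CommRingCat.ofHom ρ) := by
    refine ⟨Y.toSpecΓ ≫ Spec.map (CommRingCat.ofHom ρ) ≫ (Proj.basicOpenIsoSpec ℬ t hd h0).inv,
      ?_, ?_⟩
    · rw [hg, Category.assoc, Category.assoc, Proj.basicOpenIsoSpec_inv_ι]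
    · rw [← Proj.basicOpenIsoSpec_hom ℬ t hd h0]
      simp
  have e3 := congrArg Scheme.Hom.appTop e2
  rw [Scheme.Hom.comp_appTop, Scheme.Hom.comp_appTop, Scheme.toSpecΓ_appTop] at e3
  have e4 := Proj.basicOpenToSpec_app_top ℬ t
  rw [show (Proj.basicOpenToSpec ℬ t).appTop = _ from e4, Scheme.ΓSpecIso_naturality,
    Category.assoc, Iso.cancel_iso_hom_left, Category.assoc] at e3
  subst e
  exact (appTop_topIso_inv g' h _).symm.trans congr($e3 z)

end LocalSections

/-! ### Points and functions on `Proj` -/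

section ProjPoints

variable {k A : Type u} [CommRing k] [CommRing A] [Algebra k A]
  {𝒜 : ℕ → Submodule k A} [GradedAlgebra 𝒜]

/-- The value of a function on an open subset of `Proj A` at a point `x`, as an element of the
localization of `A` at the homogeneous prime ideal `x`. -/
def valueAt {W : (Proj 𝒜).Opens} (x : Proj 𝒜) (hx : x ∈ W) :
    Γ(Proj 𝒜, W) →+* ProjFiber 𝒜 x where
  toFun s := (s.1 ⟨x, hx⟩).val
  map_one' := HomogeneousLocalization.val_one
  map_mul' _ _ := HomogeneousLocalization.val_mul _ _
  map_zero' := HomogeneousLocalization.val_zero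
  map_add' _ _ := HomogeneousLocalization.val_add _ _

theorem ext_valueAt {W : (Proj 𝒜).Opens} {s t : Γ(Proj 𝒜, W)}
    (h : ∀ x hx, valueAt x hx s = valueAt x hx t) : s = t :=
  Subtype.ext (funext fun x => HomogeneousLocalization.val_injective _ (h x.1 x.2))

theorem valueAt_map {W V : (Proj 𝒜).Opens} (i : V ⟶ W) (x : Proj 𝒜) (hx : x ∈ V)
    (s : Γ(Proj 𝒜, W)) :
    valueAt x hx ((Proj 𝒜).presheaf.map i.op s) = valueAt x (i.le hx) s := rfl

/-- A function on an open subset of `Proj A` is invertible at the points where its value is. -/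
theorem mem_basicOpen_iff_valueAt {W : (Proj 𝒜).Opens} (s : Γ(Proj 𝒜, W)) (x : Proj 𝒜)
    (hx : x ∈ W) : x ∈ (Proj 𝒜).basicOpen s ↔ IsUnit (valueAt x hx s) := by
  have : x.asHomogeneousIdeal.toIdeal.IsPrime := ProjectiveSpectrum.isPrime x
  rw [Scheme.mem_basicOpen _ _ _ hx]
  change _ ↔ IsUnit (HomogeneousLocalization.val
    (𝒜 := 𝒜) (x := x.asHomogeneousIdeal.toIdeal.primeCompl) (s.1 ⟨x, hx⟩))
  rw [HomogeneousLocalization.isUnit_iff_isUnit_val, ← Proj.stalkIso'_germ 𝒜 W x hx s]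
  exact (MulEquiv.isUnit_map (Proj.stalkIso' 𝒜 x)).symm

theorem valueAt_awayToSection_mul {f : A} {d : ℕ} (hf : f ∈ 𝒜 d) (n : ℕ) (a : A)
    (ha : a ∈ 𝒜 (n • d)) (x : Proj 𝒜) (hx : x ∈ Proj.basicOpen 𝒜 f) :
    valueAt x hx (Proj.awayToSection 𝒜 f (HomogeneousLocalization.Away.mk 𝒜 hf n a ha)) *
      algebraMap A (ProjFiber 𝒜 x) f ^ n = algebraMap A (ProjFiber 𝒜 x) a := by
  have e := ProjectiveSpectrum.Proj.awayToSection_apply (𝒜 := 𝒜) f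
    (HomogeneousLocalization.Away.mk 𝒜 hf n a ha) ⟨x, hx⟩
  refine (congrArg (· * algebraMap A (ProjFiber 𝒜 x) f ^ n) e).trans ?_
  dsimp only
  rw [HomogeneousLocalization.Away.val_mk, Localization.mk_eq_mk', IsLocalization.map_mk',
    ← map_pow]
  exact IsLocalization.mk'_spec _ _ _

theorem isUnit_algebraMap_projFiber {f : A} (x : Proj 𝒜) :
    IsUnit (algebraMap A (ProjFiber 𝒜 x) f) ↔ x ∈ Proj.basicOpen 𝒜 f := by
  have : x.asHomogeneousIdeal.toIdeal.IsPrime := ProjectiveSpectrum.isPrime x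
  rw [Proj.mem_basicOpen]
  exact IsLocalization.AtPrime.isUnit_to_map_iff _ x.asHomogeneousIdeal.toIdeal f

end ProjPoints

/-! ### The rational map of `Proj` schemes defined by a linear system -/

section Dehomogenize

open HomogeneousLocalization

variable {k A B : Type u} [CommRing k] [CommRing A] [Algebra k A] [CommRing B] [Algebra k B]
  (ℬ : ℕ → Submodule k B) [GradedAlgebra ℬ] {𝒜 : ℕ → Submodule k A} [GradedAlgebra 𝒜]
  (θ : B →ₐ[k] A) {r : ℕ} (hθ : ∀ n, ∀ b ∈ ℬ n, θ b ∈ 𝒜 (n • r))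

/-- The homomorphism `B → A_(f)` which sends `b` of degree `n` to `θ b / f ^ n`. -/
def dehomogenize {f : A} (hf : f ∈ 𝒜 r) : B →+* Away 𝒜 f :=
  (DirectSum.toSemiring (A := fun n => ℬ n) (fun n => AddMonoidHom.mk'
      (fun b : ℬ n => Away.mk 𝒜 hf n (θ b.1) (hθ n b.1 b.2)) fun b c => by
        apply val_injective
        simp [Localization.add_mk_self])
    (by
      apply val_injective
      simp)
    (fun {i j} b c => by
      apply val_injective
      simp [Localization.mk_mul, pow_add])).comp
  (DirectSum.decomposeRingEquiv ℬ).toRingHom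

theorem dehomogenize_apply {f : A} (hf : f ∈ 𝒜 r) {n : ℕ} {b : B} (hb : b ∈ ℬ n) :
    dehomogenize ℬ θ hθ hf b = Away.mk 𝒜 hf n (θ b) (hθ n b hb) := by
  rw [dehomogenize, RingHom.comp_apply]
  change DirectSum.toSemiring _ _ _ (DirectSum.decompose ℬ b) = _
  rw [DirectSum.decompose_of_mem ℬ hb]
  exact DirectSum.toSemiring_of _ _ _ _ _

end Dehomogenize

/-! ### The morphism defined by a linear system -/

section LinearSystem

open HomogeneousLocalization

variable {k A B : Type u} [CommRing k] [CommRing A] [Algebra k A] [CommRing B] [Algebra k B]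
  (ℬ : ℕ → Submodule k B) [GradedAlgebra ℬ] {𝒜 : ℕ → Submodule k A} [GradedAlgebra 𝒜]
  (θ : B →ₐ[k] A) {r : ℕ} (hθ : ∀ n, ∀ b ∈ ℬ n, θ b ∈ 𝒜 (n • r))

omit [GradedAlgebra ℬ] [GradedAlgebra 𝒜] in
include hθ in
theorem map_mem_degree {t : B} (ht : t ∈ ℬ 1) : θ t ∈ 𝒜 r := by
  simpa using hθ 1 t ht

theorem dehomogenize_self {t : B} (ht : t ∈ ℬ 1) :
    dehomogenize ℬ θ hθ (map_mem_degree ℬ θ hθ ht) t = 1 := by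
  rw [dehomogenize_apply ℬ θ hθ _ ht]
  apply val_injective
  rw [Away.val_mk, val_one, ← Localization.mk_one]
  exact Localization.mk_eq_mk_iff.2 (Localization.r_of_eq (by simp))

theorem dehomogenize_algebraMap {f : A} (hf : f ∈ 𝒜 r) (c : k) :
    dehomogenize ℬ θ hθ hf (algebraMap k B c) = algebraMap k (Away 𝒜 f) c := by
  have h0 : algebraMap k B c ∈ ℬ 0 := (algebraMap k (ℬ 0) c).2
  rw [dehomogenize_apply ℬ θ hθ _ h0]
  apply val_injective
  rw [Away.val_mk]
  simp only [AlgHom.commutes, pow_zero]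
  exact Localization.mk_eq_mk_iff.2 (Localization.r_of_eq (by simp))

/-- The homogeneous coordinates on `D₊(θ t)`, normalised such that `t` becomes `1`: an element `b`
of degree `n` is sent to the function `θ b / θ t ^ n`. -/
def coordOn {t : B} (ht : t ∈ ℬ 1) : B →+* Γ(Proj 𝒜, Proj.basicOpen 𝒜 (θ t)) :=
  (Proj.awayToSection 𝒜 (θ t)).hom.comp (dehomogenize ℬ θ hθ (map_mem_degree ℬ θ hθ ht))

variable {ℬ θ}

theorem coordOn_self {t : B} (ht : t ∈ ℬ 1) : coordOn ℬ θ hθ ht t = 1 := by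
  rw [coordOn, RingHom.comp_apply, dehomogenize_self ℬ θ hθ ht, map_one]

theorem valueAt_coordOn_mul {t : B} (ht : t ∈ ℬ 1) {n : ℕ} {b : B} (hb : b ∈ ℬ n)
    (x : Proj 𝒜) (hx : x ∈ Proj.basicOpen 𝒜 (θ t)) :
    valueAt x hx (coordOn ℬ θ hθ ht b) * algebraMap A (ProjFiber 𝒜 x) (θ t) ^ n =
      algebraMap A (ProjFiber 𝒜 x) (θ b) := by
  rw [coordOn, RingHom.comp_apply, dehomogenize_apply ℬ θ hθ _ hb]
  exact valueAt_awayToSection_mul _ n _ (hθ n b hb) x hx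

theorem coordOn_irrelevant {t : B} (ht : t ∈ ℬ 1) :
    (HomogeneousIdeal.irrelevant ℬ).toIdeal.map
      ((Proj.basicOpen 𝒜 (θ t)).topIso.inv.hom.comp (coordOn ℬ θ hθ ht)) = ⊤ := by
  rw [Ideal.eq_top_iff_one]
  have := Ideal.mem_map_of_mem ((Proj.basicOpen 𝒜 (θ t)).topIso.inv.hom.comp (coordOn ℬ θ hθ ht))
    (HomogeneousIdeal.mem_irrelevant_of_mem ℬ one_pos ht)
  rwa [RingHom.comp_apply, coordOn_self, map_one] at this

/-- The morphism `D₊(θ t) → Proj B` given by the coordinates `coordOn`. -/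
def localLinearMap {t : B} (ht : t ∈ ℬ 1) : (Proj.basicOpen 𝒜 (θ t)).toScheme ⟶ Proj ℬ :=
  Proj.fromOfGlobalSections ℬ
    ((Proj.basicOpen 𝒜 (θ t)).topIso.inv.hom.comp (coordOn ℬ θ hθ ht)) (coordOn_irrelevant hθ ht)

/-- The morphisms to `Proj B` given by the ratios of the `θ b` glue on the union of the
open sets `D₊(θ t)`. -/
theorem exists_linearMap {𝒰 : (Proj 𝒜).Opens} {ι : Type*} (t : ι → B) (ht : ∀ i, t i ∈ ℬ 1)
    (hle : ∀ i, Proj.basicOpen 𝒜 (θ (t i)) ≤ 𝒰)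
    (hcov : ∀ x ∈ 𝒰, ∃ i, x ∈ Proj.basicOpen 𝒜 (θ (t i))) :
    ∃ φ : 𝒰.toScheme ⟶ Proj ℬ,
      ∀ i, (Proj 𝒜).homOfLE (hle i) ≫ φ = localLinearMap hθ (ht i) := by
  refine (existsUnique_of_local_sections _ hle hcov (fun i => coordOn ℬ θ hθ (ht i))
    (fun i => coordOn_irrelevant hθ (ht i)) fun i j => ?_).exists
  refine ⟨(Proj 𝒜).presheaf.map (homOfLE inf_le_right).op (coordOn ℬ θ hθ (ht j) (t i)),
    fun n b hb => ext_valueAt fun x hx => ?_⟩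
  have hj : IsUnit (algebraMap A (ProjFiber 𝒜 x) (θ (t j))) :=
    (isUnit_algebraMap_projFiber x).2 hx.2
  rw [map_mul, map_pow, valueAt_map, valueAt_map, valueAt_map]
  refine (hj.pow n).mul_right_cancel ?_
  rw [valueAt_coordOn_mul hθ (ht j) hb, mul_right_comm, ← mul_pow,
    ← pow_one (algebraMap A _ (θ (t j))),
    valueAt_coordOn_mul hθ (ht j) (ht i), mul_comm, valueAt_coordOn_mul hθ (ht i) hb]

/-- The homogeneous coordinate `b` on `D₊(θ t)` vanishes exactly where `θ b` does. -/
theorem localLinearMap_preimage {t : B} (ht : t ∈ ℬ 1) {n : ℕ} (hn : 0 < n) {b : B} (hb : b ∈ ℬ n) :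
    localLinearMap hθ ht ⁻¹ᵁ Proj.basicOpen ℬ b =
      (Proj.basicOpen 𝒜 (θ t)).ι ⁻¹ᵁ Proj.basicOpen 𝒜 (θ b) := by
  rw [localLinearMap, Proj.fromOfGlobalSections_preimage_basicOpen ℬ _ _ hn hb, RingHom.comp_apply]
  refine (basicOpen_topIso_inv _ _).trans ?_
  ext ⟨x, hx⟩
  change x ∈ (Proj 𝒜).basicOpen _ ↔ x ∈ Proj.basicOpen 𝒜 (θ b)
  rw [mem_basicOpen_iff_valueAt _ x hx, ← isUnit_algebraMap_projFiber,
    ← valueAt_coordOn_mul hθ ht hb x hx]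
  have hu : IsUnit (algebraMap A (ProjFiber 𝒜 x) (θ t)) := (isUnit_algebraMap_projFiber x).2 hx
  exact ⟨fun h => h.mul (hu.pow n), fun h => isUnit_of_mul_isUnit_left h⟩

theorem isUnit_topIso_coordOn_self {t : B} (ht : t ∈ ℬ 1) :
    IsUnit (((Proj.basicOpen 𝒜 (θ t)).topIso.inv.hom.comp (coordOn ℬ θ hθ ht)) t) := by
  rw [RingHom.comp_apply, coordOn_self hθ ht]
  exact IsUnit.map (Proj.basicOpen 𝒜 (θ t)).topIso.inv.hom isUnit_one

theorem isUnit_dehomogenize_self {t : B} (ht : t ∈ ℬ 1) :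
    IsUnit (dehomogenize ℬ θ hθ (map_mem_degree ℬ θ hθ ht) t) := by
  rw [dehomogenize_self ℬ θ hθ ht]
  exact isUnit_one

/-- The functions on `D₊(f)` given by the fractions of degree `0` with denominator a power
of `f`. -/
def awayToGlobal (f : A) : Away 𝒜 f →+* Γ((Proj.basicOpen 𝒜 f).toScheme, ⊤) :=
  (Proj.basicOpen 𝒜 f).topIso.inv.hom.comp (Proj.awayToSection 𝒜 f).hom

/-- The homomorphism `B_(t) → A_(θ t)` which sends `b / t ^ n` to `θ b / θ t ^ n`. -/
def awayMapOfLinear {t : B} (ht : t ∈ ℬ 1) : Away ℬ t →+* Away 𝒜 (θ t) :=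
  awayEval ℬ (dehomogenize ℬ θ hθ (map_mem_degree ℬ θ hθ ht)) (isUnit_dehomogenize_self hθ ht)

theorem awayMapOfLinear_mk {t : B} (ht : t ∈ ℬ 1) {n : ℕ} {b : B} (hb : b ∈ ℬ (n • 1)) :
    awayMapOfLinear hθ ht (Away.mk ℬ ht n b hb) =
      dehomogenize ℬ θ hθ (map_mem_degree ℬ θ hθ ht) b := by
  have := awayEval_mk_mul (dehomogenize ℬ θ hθ (map_mem_degree ℬ θ hθ ht))
    (isUnit_dehomogenize_self hθ ht) ht n b hb
  rwa [dehomogenize_self ℬ θ hθ ht, one_pow, mul_one] at this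

/-- On `D₊(θ t)` the morphism is `Spec` of the homomorphism `B_(t) → A_(θ t)`. -/
theorem localLinearMap_eq {t : B} (ht : t ∈ ℬ 1) :
    localLinearMap hθ ht = (Proj.basicOpen 𝒜 (θ t)).toScheme.toSpecΓ ≫
      Spec.map (CommRingCat.ofHom (S := Γ((Proj.basicOpen 𝒜 (θ t)).toScheme, ⊤))
        ((awayToGlobal (θ t)).comp (awayMapOfLinear hθ ht))) ≫
        Proj.awayι ℬ t ht one_pos := by
  have hu := isUnit_topIso_coordOn_self hθ ht
  have h1 := comp_fromOfGlobalSections (𝟙 _) _ (coordOn_irrelevant hθ ht) ht one_pos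
    (by simpa using hu)
  rw [Category.id_comp] at h1
  rw [localLinearMap, h1]
  congr 4
  have h2 : awayEval ℬ ((awayToGlobal (θ t)).comp (dehomogenize ℬ θ hθ (map_mem_degree ℬ θ hθ ht)))
      hu = (awayToGlobal (θ t)).comp (awayMapOfLinear hθ ht) :=
    awayEval_comp _ _ (isUnit_dehomogenize_self hθ ht) hu
  rw [← h2]
  congr 1

end LinearSystem

/-! ### Pullbacks along the morphism defined by a linear system -/

section LinearSystemMap

open HomogeneousLocalization

variable {k A B : Type u} [CommRing k] [CommRing A] [Algebra k A] [CommRing B] [Algebra k B]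
  {ℬ : ℕ → Submodule k B} [GradedAlgebra ℬ] {𝒜 : ℕ → Submodule k A} [GradedAlgebra 𝒜]
  {θ : B →ₐ[k] A} {r : ℕ} (hθ : ∀ n, ∀ b ∈ ℬ n, θ b ∈ 𝒜 (n • r))
  {𝒰 : (Proj 𝒜).Opens} {ι : Type*} (t : ι → B) (ht : ∀ i, t i ∈ ℬ 1)
  (hle : ∀ i, Proj.basicOpen 𝒜 (θ (t i)) ≤ 𝒰)
  (hcov : ∀ x ∈ 𝒰, ∃ i, x ∈ Proj.basicOpen 𝒜 (θ (t i)))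
  (φ : 𝒰.toScheme ⟶ Proj ℬ)
  (hφ : ∀ i, (Proj 𝒜).homOfLE (hle i) ≫ φ = localLinearMap hθ (ht i))

include hcov hφ in
/-- The section `b` of `𝒪(n)` pulls back to `θ b`, so the preimage of `D₊(b)` is `D₊(θ b)`. -/
theorem linearMap_preimage {n : ℕ} (hn : 0 < n) {b : B} (hb : b ∈ ℬ n) :
    φ ⁻¹ᵁ Proj.basicOpen ℬ b = 𝒰.ι ⁻¹ᵁ Proj.basicOpen 𝒜 (θ b) := by
  ext ⟨x, hx⟩
  obtain ⟨i, hi⟩ := hcov x hx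
  have h1 : (Proj 𝒜).homOfLE (hle i) (⟨x, hi⟩ : (Proj.basicOpen 𝒜 (θ (t i))).toScheme) = ⟨x, hx⟩ :=
    Scheme.homOfLE_apply' _ _ _
  have h2 := localLinearMap_preimage hθ (ht i) hn hb
  rw [← hφ i, Scheme.Hom.comp_preimage] at h2
  have h3 := iff_of_eq (congrArg
    (fun U => (⟨x, hi⟩ : (Proj.basicOpen 𝒜 (θ (t i))).toScheme) ∈ U) h2)
  change (Proj 𝒜).homOfLE (hle i) (⟨x, hi⟩ : (Proj.basicOpen 𝒜 (θ (t i))).toScheme) ∈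
    φ ⁻¹ᵁ Proj.basicOpen ℬ b ↔ x ∈ Proj.basicOpen 𝒜 (θ b) at h3
  rw [h1] at h3
  exact h3

include hcov hφ in
theorem exists_mem_linearMap_preimage (x : 𝒰.toScheme) :
    ∃ i, x ∈ φ ⁻¹ᵁ Proj.basicOpen ℬ (t i) := by
  obtain ⟨i, hi⟩ := hcov x.1 x.2
  refine ⟨i, ?_⟩
  rw [linearMap_preimage hθ t ht hle hcov φ hφ one_pos (ht i)]
  exact hi

include hcov hφ in
/-- The function `b / t ^ n` pulls back to `θ b / θ t ^ n`. -/
theorem valueAt_linearMap_mul (i : ι) {n : ℕ} {b : B} (hb : b ∈ ℬ (n • 1)) {W : (Proj ℬ).Opens}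
    (hW : W ≤ Proj.basicOpen ℬ (t i)) (x : Proj 𝒜) (hx : x ∈ 𝒰.ι ''ᵁ (φ ⁻¹ᵁ W)) :
    valueAt (W := 𝒰.ι ''ᵁ (φ ⁻¹ᵁ W)) x hx (φ.app W ((Proj ℬ).presheaf.map (homOfLE hW).op
      (Proj.awayToSection ℬ (t i) (Away.mk ℬ (ht i) n b hb)))) *
        algebraMap A (ProjFiber 𝒜 x) (θ (t i)) ^ n = algebraMap A (ProjFiber 𝒜 x) (θ b) := by
  rw [← map_app_apply φ hW]
  set s := Proj.awayToSection ℬ (t i) (Away.mk ℬ (ht i) n b hb)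
  have hx' : x ∈ 𝒰.ι ''ᵁ (φ ⁻¹ᵁ Proj.basicOpen ℬ (t i)) :=
    𝒰.ι.image_mono (φ.preimage_mono hW) hx
  change valueAt (W := 𝒰.ι ''ᵁ (φ ⁻¹ᵁ Proj.basicOpen ℬ (t i))) x hx'
    (φ.app (Proj.basicOpen ℬ (t i)) s) * _ = _
  have hpre := linearMap_preimage hθ t ht hle hcov φ hφ one_pos (ht i)
  have hxi : x ∈ Proj.basicOpen 𝒜 (θ (t i)) := by
    rw [hpre] at hx'
    obtain ⟨y, hy, rfl⟩ := hx'
    exact hy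
  have htop : (⊤ : (Proj.basicOpen 𝒜 (θ (t i))).toScheme.Opens) ≤
      localLinearMap hθ (ht i) ⁻¹ᵁ Proj.basicOpen ℬ (t i) := by
    rw [localLinearMap_preimage hθ (ht i) one_pos (ht i), Scheme.Opens.ι_preimage_self]
  have h1 := appLE_awayToSection _ (ht i) one_pos _ (localLinearMap_eq hθ (ht i)) htop
    (Away.mk ℬ (ht i) n b hb)
  have htop' : (⊤ : (Proj.basicOpen 𝒜 (θ (t i))).toScheme.Opens) ≤
      (Proj 𝒜).homOfLE (hle i) ⁻¹ᵁ (φ ⁻¹ᵁ Proj.basicOpen ℬ (t i)) := by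
    rw [← Scheme.Hom.comp_preimage, hφ]
    exact htop
  have h2 : ∀ (g : _ ⟶ Proj ℬ) (hg : (Proj 𝒜).homOfLE (hle i) ≫ φ = g)
      (h : ⊤ ≤ g ⁻¹ᵁ Proj.basicOpen ℬ (t i)), g.appLE (Proj.basicOpen ℬ (t i)) ⊤ h s =
      ((Proj 𝒜).homOfLE (hle i)).appLE _ ⊤ htop' (φ.app (Proj.basicOpen ℬ (t i)) s) := by
    rintro _ rfl h
    rw [Scheme.Hom.comp_appLE]
    rfl
  have hxt : x ∈ (Proj.basicOpen 𝒜 (θ (t i))).ι ''ᵁ ⊤ := by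
    rw [Scheme.Opens.ι_image_top]
    exact hxi
  have h3 := (h2 _ (hφ i) htop).symm.trans h1
  rw [Scheme.homOfLE_appLE, RingHom.comp_apply, awayMapOfLinear_mk] at h3
  have h4 : valueAt x hx' (φ.app (Proj.basicOpen ℬ (t i)) s) =
      valueAt x hxi (coordOn ℬ θ hθ (ht i) b) :=
    congrArg (valueAt (W := (Proj.basicOpen 𝒜 (θ (t i))).ι ''ᵁ ⊤) x hxt) h3
  refine (congrArg (· * algebraMap A (ProjFiber 𝒜 x) (θ (t i)) ^ n) h4).trans ?_
  exact valueAt_coordOn_mul hθ (ht i) (by simpa using hb) x hxi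

end LinearSystemMap

/-! ### The line bundle of a linear system -/

section LinearSystemSheaf

open HomogeneousLocalization Scheme.Modules

variable {k A : Type u} [CommRing k] [CommRing A] [Algebra k A]
  {𝒜 : ℕ → Submodule k A} [GradedAlgebra 𝒜] {r : ℕ}

/-- The restriction to an open subscheme `𝒰` of the section of `𝒪(r)` given by an element of
degree `r`. -/
def restrictTwistSection (𝒰 : (Proj 𝒜).Opens) {a : A} (ha : a ∈ 𝒜 r) (V : 𝒰.toScheme.Opens) :
    Γ((twistingSheaf 𝒜 r).restrict 𝒰.ι, V) :=
  ((twistingSheaf 𝒜 r).restrictAppIso 𝒰.ι V).inv (twistSection 𝒜 ha (𝒰.ι ''ᵁ V))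

theorem restrictTwistSection_map (𝒰 : (Proj 𝒜).Opens) {a : A} (ha : a ∈ 𝒜 r)
    {V W : 𝒰.toScheme.Opens} (h : W ≤ V) :
    ((twistingSheaf 𝒜 r).restrict 𝒰.ι).presheaf.map (homOfLE h).op
      (restrictTwistSection 𝒰 ha V) = restrictTwistSection 𝒰 ha W := rfl

theorem smul_restrictTwistSection (𝒰 : (Proj 𝒜).Opens) {a b : A} (ha : a ∈ 𝒜 r) (hb : b ∈ 𝒜 r)
    {V : 𝒰.toScheme.Opens} (c : Γ(𝒰.toScheme, V))
    (h : ∀ (x : Proj 𝒜) (hx : x ∈ 𝒰.ι ''ᵁ V), valueAt (W := 𝒰.ι ''ᵁ V) x hx c *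
      algebraMap A (ProjFiber 𝒜 x) a = algebraMap A (ProjFiber 𝒜 x) b) :
    c • restrictTwistSection 𝒰 ha V = restrictTwistSection 𝒰 hb V := by
  change ((𝒰.ι.appIso V).inv c) • twistSection 𝒜 ha (𝒰.ι ''ᵁ V) = _
  rw [Scheme.Opens.ι_appIso]
  exact Subtype.ext (funext fun x => h x.1 x.2)

theorem isGenerator_restrictTwistSection (𝒰 : (Proj 𝒜).Opens) {a : A} (ha : a ∈ 𝒜 r)
    {V : 𝒰.toScheme.Opens} (h : V ≤ 𝒰.ι ⁻¹ᵁ Proj.basicOpen 𝒜 a) :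
    IsGenerator ((twistingSheaf 𝒜 r).restrict 𝒰.ι) (restrictTwistSection 𝒰 ha V) :=
  (isGenerator_twistSection 𝒜 ha).restrict 𝒰 V ((𝒰.ι.image_mono h).trans (by
    rintro _ ⟨y, hy, rfl⟩
    exact hy))

/-- `𝒪(r)` is a line bundle on each open subset covered by open sets `D₊(f)` with `f` of
degree `r`. -/
theorem isLineBundle_restrict_twistingSheaf (𝒰 : (Proj 𝒜).Opens)
    (h : ∀ x ∈ 𝒰, ∃ f ∈ 𝒜 r, x ∈ Proj.basicOpen 𝒜 f) :
    IsLineBundle ((twistingSheaf 𝒜 r).restrict 𝒰.ι) := by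
  refine isLineBundle_of_generators fun y => ?_
  obtain ⟨f, hf, hy⟩ := h y.1 y.2
  exact ⟨𝒰.ι ⁻¹ᵁ Proj.basicOpen 𝒜 f, restrictTwistSection 𝒰 hf _, hy,
    isGenerator_restrictTwistSection 𝒰 hf le_rfl⟩

variable {B : Type u} [CommRing B] [Algebra k B]
  {ℬ : ℕ → Submodule k B} [GradedAlgebra ℬ]
  {θ : B →ₐ[k] A} (hθ : ∀ n, ∀ b ∈ ℬ n, θ b ∈ 𝒜 (n • r))
  {𝒰 : (Proj 𝒜).Opens} {ι : Type*} (t : ι → B) (ht : ∀ i, t i ∈ ℬ 1)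
  (hle : ∀ i, Proj.basicOpen 𝒜 (θ (t i)) ≤ 𝒰)
  (hcov : ∀ x ∈ 𝒰, ∃ i, x ∈ Proj.basicOpen 𝒜 (θ (t i)))
  (φ : 𝒰.toScheme ⟶ Proj ℬ)
  (hφ : ∀ i, (Proj 𝒜).homOfLE (hle i) ≫ φ = localLinearMap hθ (ht i))

theorem smul_twistSection_eq {t b : B} (ht : t ∈ ℬ 1) (hb : b ∈ ℬ 1) {W : (Proj ℬ).Opens}
    (hW : W ≤ Proj.basicOpen ℬ t) :
    (Proj ℬ).presheaf.map (homOfLE hW).op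
      (Proj.awayToSection ℬ t (Away.mk ℬ ht 1 b (by simpa using hb))) •
      twistSection ℬ ht W = twistSection ℬ hb W := by
  refine Subtype.ext (funext fun x => ?_)
  have := valueAt_awayToSection_mul ht 1 b (by simpa using hb) x.1 (hW x.2)
  rw [pow_one] at this
  exact this

include hcov hφ in
/-- The sheaf `𝒪(1)` pulls back to `𝒪(r)` under the morphism defined by elements of degree `r`. -/
theorem exists_twist_transpose :
    ∃ η : twistingSheaf ℬ 1 ⟶ (pushforward φ).obj ((twistingSheaf 𝒜 r).restrict 𝒰.ι),
      IsIso (((pullbackPushforwardAdjunction φ).homEquiv _ _).symm η) ∧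
      ∀ (b : B) (hb : b ∈ ℬ 1), η.app ⊤ (twistSection ℬ hb ⊤) =
        restrictTwistSection 𝒰 (map_mem_degree ℬ θ hθ hb) ⊤ := by
  have hV := exists_mem_linearMap_preimage hθ t ht hle hcov φ hφ
  -- multiplication by the pullback of the function `b / t i`
  have key : ∀ (i : ι) (b : B) (hb : b ∈ ℬ 1) (W : (Proj ℬ).Opens)
      (hW : W ≤ Proj.basicOpen ℬ (t i)),
      φ.app W ((Proj ℬ).presheaf.map (homOfLE hW).op
        (Proj.awayToSection ℬ (t i) (Away.mk ℬ (ht i) 1 b (by simpa using hb)))) •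
        restrictTwistSection 𝒰 (map_mem_degree ℬ θ hθ (ht i)) (φ ⁻¹ᵁ W) =
        restrictTwistSection 𝒰 (map_mem_degree ℬ θ hθ hb) (φ ⁻¹ᵁ W) := by
    intro i b hb W hW
    refine smul_restrictTwistSection 𝒰 _ _ _ fun x hx => ?_
    have := valueAt_linearMap_mul hθ t ht hle hcov φ hφ i (n := 1) (b := b)
      (by simpa using hb) hW x hx
    rwa [pow_one] at this
  obtain ⟨η, hη⟩ := exists_hom_pushforward_of_generators φ
    (E := twistingSheaf ℬ 1) (N := (twistingSheaf 𝒜 r).restrict 𝒰.ι)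
    (fun i => Proj.basicOpen ℬ (t i)) hV (fun i => twistSection ℬ (ht i) _)
    (fun i => isGenerator_twistSection ℬ (ht i))
    (fun i => restrictTwistSection 𝒰 (map_mem_degree ℬ θ hθ (ht i)) _)
    fun i j W hi hj a ha => by
      rw [restrictTwistSection_map, restrictTwistSection_map, ← key i (t j) (ht j) W hi]
      congr 2
      refine (isGenerator_twistSection ℬ (ht i) W hi).injective ?_
      exact (smul_twistSection_eq (ht i) (ht j) hi).trans ha
  refine ⟨η, isIso_transpose φ η _ hV _ (fun i => isGenerator_twistSection ℬ (ht i)) fun i => ?_,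
    fun b hb => ?_⟩
  · rw [hη]
    refine isGenerator_restrictTwistSection 𝒰 _ ?_
    rw [linearMap_preimage hθ t ht hle hcov φ hφ one_pos (ht i)]
  · refine eq_of_map_eq ((twistingSheaf 𝒜 r).restrict 𝒰.ι) (U := ⊤)
      (fun i => φ ⁻¹ᵁ Proj.basicOpen ℬ (t i)) (fun x _ => hV x) _ _ fun i => ?_
    have hl : ⊤ ⊓ Proj.basicOpen ℬ (t i) ≤ ⊤ := inf_le_left
    refine (transApp_map η hl (twistSection ℬ hb ⊤)).symm.trans ?_
    change transApp η _ (twistSection ℬ hb (⊤ ⊓ Proj.basicOpen ℬ (t i))) =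
      restrictTwistSection 𝒰 (map_mem_degree ℬ θ hθ hb)
        (φ ⁻¹ᵁ (⊤ ⊓ Proj.basicOpen ℬ (t i)))
    rw [← smul_twistSection_eq (ht i) hb inf_le_right, transApp_smul, ← key i b hb _ inf_le_right]
    congr 1
    exact (transApp_map η inf_le_right (twistSection ℬ (ht i) _)).trans
      (congrArg _ (hη i))

end LinearSystemSheaf

/-! ### Immersions defined by linear systems -/

section LinearSystemImmersion

open HomogeneousLocalization

variable {k A B : Type u} [CommRing k] [CommRing A] [Algebra k A] [CommRing B] [Algebra k B]
  {ℬ : ℕ → Submodule k B} [GradedAlgebra ℬ] {𝒜 : ℕ → Submodule k A} [GradedAlgebra 𝒜]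
  {θ : B →ₐ[k] A} {r : ℕ} (hθ : ∀ n, ∀ b ∈ ℬ n, θ b ∈ 𝒜 (n • r))
  {𝒰 : (Proj 𝒜).Opens} {ι : Type*} (t : ι → B) (ht : ∀ i, t i ∈ ℬ 1)
  (hle : ∀ i, Proj.basicOpen 𝒜 (θ (t i)) ≤ 𝒰)
  (hcov : ∀ x ∈ 𝒰, ∃ i, x ∈ Proj.basicOpen 𝒜 (θ (t i)))
  (φ : 𝒰.toScheme ⟶ Proj ℬ)
  (hφ : ∀ i, (Proj 𝒜).homOfLE (hle i) ≫ φ = localLinearMap hθ (ht i))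

/-- An open subscheme of `U` which is contained in `V ≤ U` is a subscheme of `V`. -/
theorem exists_lift_homOfLE {Z : Scheme.{u}} {U V : Z.Opens} (h : V ≤ U) {W : U.toScheme.Opens}
    (hW : W ≤ U.ι ⁻¹ᵁ V) :
    ∃ e : W.toScheme ⟶ V.toScheme, IsImmersion e ∧ W.ι = e ≫ Z.homOfLE h := by
  obtain ⟨e, he⟩ : ∃ e : W.toScheme ⟶ V.toScheme, e ≫ Z.homOfLE h = W.ι :=
    ⟨IsOpenImmersion.lift (Z.homOfLE h) W.ι (by
      rintro _ ⟨y, rfl⟩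
      exact ⟨⟨y.1.1, hW y.2⟩, Scheme.homOfLE_apply' _ _ _⟩), IsOpenImmersion.lift_fac _ _ _⟩
  have : IsImmersion (e ≫ Z.homOfLE h) := by rw [he]; infer_instance
  exact ⟨e, IsImmersion.of_comp e (Z.homOfLE h), he.symm⟩

theorem isImmersion_localLinearMap (hr : 0 < r) {t : B} (ht : t ∈ ℬ 1)
    (hsurj : Function.Surjective (awayMapOfLinear hθ ht)) :
    IsImmersion (localLinearMap hθ ht) := by
  have hf := map_mem_degree ℬ θ hθ ht
  have : IsAffine (Proj.basicOpen 𝒜 (θ t)).toScheme := Proj.isAffineOpen_basicOpen 𝒜 (θ t) hf hr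
  have hiso : IsIso (Proj.awayToSection 𝒜 (θ t)) := by
    rw [← Proj.basicOpenIsoAway_hom 𝒜 (θ t) hf hr]
    infer_instance
  have hs : Function.Surjective ((awayToGlobal (θ t)).comp (awayMapOfLinear hθ ht)) := by
    have h1 : Function.Surjective (awayToGlobal (𝒜 := 𝒜) (θ t)) :=
      Function.Surjective.comp (g := (Proj.basicOpen 𝒜 (θ t)).topIso.inv)
        (ConcreteCategory.bijective_of_isIso (Proj.basicOpen 𝒜 (θ t)).topIso.inv).2
        (ConcreteCategory.bijective_of_isIso (Proj.awayToSection 𝒜 (θ t))).2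
    rw [RingHom.coe_comp]
    exact h1.comp hsurj
  have := IsClosedImmersion.spec_of_surjective
    (CommRingCat.ofHom (S := Γ((Proj.basicOpen 𝒜 (θ t)).toScheme, ⊤))
      ((awayToGlobal (θ t)).comp (awayMapOfLinear hθ ht))) hs
  rw [localLinearMap_eq]
  infer_instance

include hcov hφ in
/-- If the homomorphisms `B_(t) → A_(θ t)` are surjective, the morphism is an immersion: it is a
closed immersion of affine schemes over the open sets `D₊(t)`. -/
theorem isImmersion_linearMap (hr : 0 < r)
    (hsurj : ∀ i, Function.Surjective (awayMapOfLinear hθ (ht i))) : IsImmersion φ := by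
  have : MorphismProperty.RespectsRight @IsImmersion @IsOpenImmersion :=
    ⟨fun i hi f hf => by
      have : IsOpenImmersion i := hi
      have : IsImmersion f := hf
      infer_instance⟩
  have : MorphismProperty.HasOfPostcompProperty @IsImmersion @IsOpenImmersion :=
    ⟨fun f g _ hfg => by
      have : IsImmersion (f ≫ g) := hfg
      exact IsImmersion.of_comp f g⟩
  -- an immersion need not be closed, so it is enough that the preimages of the open sets `D₊(t)`
  -- cover the source
  refine IsZariskiLocalAtTarget.of_forall_source_exists_preimage φ fun x => ?_
  obtain ⟨i, hi⟩ := exists_mem_linearMap_preimage hθ t ht hle hcov φ hφ x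
  refine ⟨Proj.basicOpen ℬ (t i), hi, ?_⟩
  obtain ⟨e, he, h⟩ := exists_lift_homOfLE (hle i)
    (linearMap_preimage hθ t ht hle hcov φ hφ one_pos (ht i)).le
  have := isImmersion_localLinearMap hθ hr (ht i) (hsurj i)
  rw [h, Category.assoc, hφ]
  infer_instance

theorem basicOpen_ι_projToSpec (hr : 0 < r) {f : A} (hf : f ∈ 𝒜 r) :
    (Proj.basicOpen 𝒜 f).ι ≫ projToSpec 𝒜 = (Proj.basicOpen 𝒜 f).toScheme.toSpecΓ ≫
      Spec.map (CommRingCat.ofHom (S := Γ((Proj.basicOpen 𝒜 f).toScheme, ⊤))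
        ((awayToGlobal (𝒜 := 𝒜) f).comp (algebraMap k (Away 𝒜 f)))) := by
  have h1 : (Proj.basicOpen 𝒜 f).ι =
      (Proj.basicOpenIsoSpec 𝒜 f hf hr).hom ≫ Proj.awayι 𝒜 f hf hr := by
    rw [← Proj.basicOpenIsoSpec_inv_ι, Iso.hom_inv_id_assoc]
  rw [h1, projToSpec, Category.assoc, Proj.awayι_toSpecZero_assoc, Proj.basicOpenIsoSpec_hom,
    Proj.basicOpenToSpec, Scheme.Opens.toSpecΓ]
  simp only [Category.assoc, ← Spec.map_comp]
  rfl

theorem localLinearMap_projToSpec (hr : 0 < r) {t : B} (ht : t ∈ ℬ 1) :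
    localLinearMap hθ ht ≫ projToSpec ℬ = (Proj.basicOpen 𝒜 (θ t)).ι ≫ projToSpec 𝒜 := by
  rw [basicOpen_ι_projToSpec hr (map_mem_degree ℬ θ hθ ht), localLinearMap, projToSpec,
    Proj.fromOfGlobalSections_toSpecZero_assoc, ← Spec.map_comp, ← CommRingCat.ofHom_comp]
  congr 3
  ext c
  exact congrArg (awayToGlobal (θ t)) (dehomogenize_algebraMap ℬ θ hθ _ c)

include hcov hφ in
theorem linearMap_projToSpec (hr : 0 < r) : φ ≫ projToSpec ℬ = 𝒰.ι ≫ projToSpec 𝒜 := by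
  refine Scheme.hom_ext_of_forall _ _ fun x => ?_
  obtain ⟨i, hi⟩ := hcov x.1 x.2
  refine ⟨𝒰.ι ⁻¹ᵁ Proj.basicOpen 𝒜 (θ (t i)), hi, ?_⟩
  obtain ⟨e, he, h⟩ := exists_lift_homOfLE (hle i) (le_refl (𝒰.ι ⁻¹ᵁ Proj.basicOpen 𝒜 (θ (t i))))
  rw [h, Category.assoc, Category.assoc, reassoc_of% hφ i, Scheme.homOfLE_ι_assoc,
    localLinearMap_projToSpec hθ hr]

end LinearSystemImmersion

/-! ### Generators of algebras of fractions -/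

section AwayGenerators

open HomogeneousLocalization

variable {k A : Type u} [CommRing k] [CommRing A] [Algebra k A]
  {𝒜 : ℕ → Submodule k A} [GradedAlgebra 𝒜]

theorem awayMap_algebraMap {f g x : A} {e : ℕ} (hg : g ∈ 𝒜 e) (hx : x = f * g) (c : k) :
    awayMap 𝒜 hg hx (algebraMap k (Away 𝒜 f) c) = algebraMap k (Away 𝒜 x) c :=
  awayMap_fromZeroRingHom 𝒜 hg hx _

/-- The algebra `A_(f g)` is a localization of `A_(f)` at one element, if `f` has
positive degree. -/
theorem finiteType_away_mul {f g : A} {d e : ℕ} (hf : f ∈ 𝒜 d) (hg : g ∈ 𝒜 e) (hd : 0 < d)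
    (h : Algebra.FiniteType k (Away 𝒜 f)) : Algebra.FiniteType k (Away 𝒜 (f * g)) := by
  have h1 : (awayMap 𝒜 hg (rfl : f * g = f * g)).FiniteType := by
    let := (awayMap 𝒜 hg (rfl : f * g = f * g)).toAlgebra
    have := Away.isLocalization_mul hf hg rfl hd.ne'
    exact IsLocalization.finiteType_of_monoid_fg
      (Submonoid.powers (Away.isLocalizationElem hf hg)) _
  rw [← RingHom.finiteType_algebraMap] at h ⊢
  have h2 := h1.comp h
  rwa [show (awayMap 𝒜 hg rfl).comp (algebraMap k (Away 𝒜 f)) = algebraMap k (Away 𝒜 (f * g)) from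
    RingHom.ext (awayMap_algebraMap hg rfl)] at h2

/-- The fraction `a / f ^ n` written with the denominator `(f ^ e) ^ m`. -/
theorem awayMap_pow_mk {f : A} {d e r : ℕ} (hf : f ∈ 𝒜 d) (he : 0 < e)
    (hfe : f ^ e ∈ 𝒜 r) (hr : e * d = r) (n m : ℕ) (hn : n ≤ m * e) (a : A) (ha : a ∈ 𝒜 (n • d))
    (ha' : a * f ^ (m * e - n) ∈ 𝒜 (m • r)) :
    awayMap 𝒜 (SetLike.pow_mem_graded (e - 1) hf) (mul_pow_sub_one he.ne' f).symm
      (Away.mk 𝒜 hf n a ha) = Away.mk 𝒜 hfe m (a * f ^ (m * e - n)) ha' := by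
  rw [awayMap_mk]
  apply val_injective
  rw [Away.val_mk, Away.val_mk, Localization.mk_eq_mk_iff]
  refine Localization.r_of_eq ?_
  simp only [← pow_mul, mul_left_comm (f ^ _) a, ← pow_add]
  congr 2
  obtain ⟨e, rfl⟩ := Nat.exists_eq_add_of_lt he
  have : n ≤ m * (0 + e + 1) := hn
  zify [hn]
  simp
  ring

theorem mul_pow_mem_degree {f a : A} {d e r n m : ℕ} (hf : f ∈ 𝒜 d) (hr : e * d = r)
    (hn : n ≤ m * e) (ha : a ∈ 𝒜 (n • d)) : a * f ^ (m * e - n) ∈ 𝒜 (m • r) := by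
  have := SetLike.mul_mem_graded ha (SetLike.pow_mem_graded (m * e - n) hf)
  rwa [← add_smul, Nat.add_sub_cancel' hn, smul_eq_mul, mul_assoc, hr] at this

/-- The canonical map `A_(f) → A_(f ^ e)` is surjective. -/
theorem awayMap_pow_surjective {f : A} {d e : ℕ} (hf : f ∈ 𝒜 d) (he : 0 < e) :
    Function.Surjective (awayMap 𝒜 (SetLike.pow_mem_graded (e - 1) hf)
      (mul_pow_sub_one he.ne' f).symm) := by
  intro y
  have hfe : f ^ e ∈ 𝒜 (e * d) := SetLike.pow_mem_graded e hf
  obtain ⟨m, a, ha, rfl⟩ := Away.mk_surjective 𝒜 hfe y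
  have ha' : a ∈ 𝒜 ((m * e) • d) := by
    rwa [smul_eq_mul, mul_assoc]
  refine ⟨Away.mk 𝒜 hf (m * e) a ha', ?_⟩
  rw [awayMap_pow_mk hf he hfe rfl _ m le_rfl a ha' (by simpa using ha)]
  congr 1
  simp

/-- The `k`-algebra homomorphism `A_(f) → A_(f ^ e)`. -/
def awayPowMap {f : A} {d e : ℕ} (hf : f ∈ 𝒜 d) (he : 0 < e) :
    Away 𝒜 f →ₐ[k] Away 𝒜 (f ^ e) where
  __ := awayMap 𝒜 (SetLike.pow_mem_graded (e - 1) hf) (mul_pow_sub_one he.ne' f).symm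
  commutes' c := awayMap_algebraMap _ _ c

theorem finiteType_away_pow {f : A} {d e : ℕ} (hf : f ∈ 𝒜 d) (he : 0 < e)
    (h : Algebra.FiniteType k (Away 𝒜 f)) : Algebra.FiniteType k (Away 𝒜 (f ^ e)) :=
  h.of_surjective (awayPowMap hf he) (awayMap_pow_surjective hf he)

/-- If `A_(f)` is finitely generated, then for all large `e` the algebra `A_(f ^ e)` is generated
by finitely many fractions with denominator `f ^ e`. -/
theorem exists_adjoin_fractions {f : A} {d : ℕ} (hf : f ∈ 𝒜 d)
    (h : Algebra.FiniteType k (Away 𝒜 f)) :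
    ∃ N, ∀ e, 0 < e → N ≤ e → ∀ r, e * d = r → ∀ hfe : f ^ e ∈ 𝒜 r,
      ∃ F : Set A, F.Finite ∧ (∀ v ∈ F, v ∈ 𝒜 r) ∧
        Algebra.adjoin k {y : Away 𝒜 (f ^ e) | ∃ (v : A) (hv : v ∈ 𝒜 (1 • r)),
          v ∈ F ∧ y = Away.mk 𝒜 hfe 1 v hv} = ⊤ := by
  obtain ⟨s, hs⟩ := h
  choose n a ha hna using Away.mk_surjective 𝒜 hf
  refine ⟨s.sup n, fun e he hNe r hr hfe => ?_⟩
  have hne : ∀ y ∈ s, n y ≤ 1 * e := fun y hy => by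
    rw [one_mul]; exact (Finset.le_sup hy).trans hNe
  refine ⟨(fun y => a y * f ^ (1 * e - n y)) '' s, s.finite_toSet.image _, ?_, ?_⟩
  · rintro _ ⟨y, hy, rfl⟩
    simpa using mul_pow_mem_degree hf hr (hne y hy) (ha y)
  · rw [eq_top_iff, ← (AlgHom.range_eq_top (awayPowMap (k := k) hf he)).2
      (awayMap_pow_surjective hf he), ← Algebra.map_top, ← hs, AlgHom.map_adjoin]
    refine Algebra.adjoin_mono ?_
    rintro _ ⟨y, hy, rfl⟩
    refine ⟨_, mul_pow_mem_degree hf hr (hne y hy) (ha y), ⟨y, hy, rfl⟩, ?_⟩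
    rw [← awayMap_pow_mk hf he hfe hr (n y) 1 (hne y hy) (a y) (ha y), hna]
    rfl

/-- A quasi-compact open set which is covered by open sets `Spec A_(f)` with `A_(f)` finitely
generated is a finite union of such open sets. -/
theorem exists_finite_basicOpen_cover {𝒰 : (Proj 𝒜).Opens}
    (hc : IsCompact (𝒰 : Set (Proj 𝒜)))
    (h : ∀ x ∈ 𝒰, ∃ d, 0 < d ∧ ∃ f ∈ 𝒜 d, Algebra.FiniteType k (Away 𝒜 f) ∧
      x ∈ Proj.basicOpen 𝒜 f) :
    ∃ s : Set A, s.Finite ∧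
      (∀ f ∈ s, ∃ d, 0 < d ∧ f ∈ 𝒜 d ∧ Algebra.FiniteType k (Away 𝒜 f)) ∧
      𝒰 = ⨆ f ∈ s, Proj.basicOpen 𝒜 f := by
  -- shrink `D₊(f)` to `D₊(f g)`, which lies in `𝒰`, for some homogeneous `g`
  have key : ∀ x : 𝒰, ∃ f : A, (∃ d, 0 < d ∧ f ∈ 𝒜 d ∧ Algebra.FiniteType k (Away 𝒜 f)) ∧
      x.1 ∈ Proj.basicOpen 𝒜 f ∧ Proj.basicOpen 𝒜 f ≤ 𝒰 := by
    rintro ⟨x, hx⟩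
    obtain ⟨d, hd, f, hf, hfg, hxf⟩ := h x hx
    obtain ⟨_, ⟨g, rfl⟩, hxg, hg⟩ := Opens.isBasis_iff_nbhd.1 (Proj.isBasis_basicOpen 𝒜) hx
    rw [Proj.basicOpen_eq_iSup_proj] at hxg
    obtain ⟨e, he⟩ := Opens.mem_iSup.1 hxg
    have hge : GradedRing.proj 𝒜 e g ∈ 𝒜 e := SetLike.coe_mem _
    refine ⟨f * GradedRing.proj 𝒜 e g, ⟨d + e, by omega, SetLike.mul_mem_graded hf hge,
      finiteType_away_mul hf hge hd hfg⟩, ?_, ?_⟩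
    · rw [Proj.basicOpen_mul]; exact ⟨hxf, he⟩
    · rw [Proj.basicOpen_mul]
      refine inf_le_right.trans (le_trans ?_ hg)
      rw [Proj.basicOpen_eq_iSup_proj 𝒜 g]
      exact le_iSup (fun i => Proj.basicOpen 𝒜 (GradedRing.proj 𝒜 i g)) e
  choose f hf hxf hle using key
  obtain ⟨T, hT⟩ := hc.elim_finite_subcover (fun x : 𝒰 => (Proj.basicOpen 𝒜 (f x) : Set (Proj 𝒜)))
    (fun x => (Proj.basicOpen 𝒜 (f x)).isOpen) fun x hx => Set.mem_iUnion.2 ⟨⟨x, hx⟩, hxf ⟨x, hx⟩⟩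
  refine ⟨f '' T, T.finite_toSet.image f, ?_, le_antisymm (fun x hx => ?_) ?_⟩
  · rintro _ ⟨x, -, rfl⟩
    exact hf x
  · obtain ⟨y, hy, hxy⟩ := Set.mem_iUnion₂.1 (hT hx)
    exact Opens.mem_iSup.2 ⟨f y, Opens.mem_iSup.2 ⟨⟨y, hy, rfl⟩, hxy⟩⟩
  · refine iSup₂_le ?_
    rintro _ ⟨y, -, rfl⟩
    exact hle y

/-- Replacing finitely many elements `f` by powers, they get the same degree `r`, and the algebras
`A_(f)` are generated by the fractions `v / f`, for `v` in a finite set of elements of degree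
`r`. -/
theorem exists_common_degree {s : Set A} (hs : s.Finite)
    (h : ∀ f ∈ s, ∃ d, 0 < d ∧ f ∈ 𝒜 d ∧ Algebra.FiniteType k (Away 𝒜 f)) :
    ∃ (r : ℕ) (S F : Set A), 0 < r ∧ S.Finite ∧ F.Finite ∧ S ⊆ F ∧ (∀ v ∈ F, v ∈ 𝒜 r) ∧
      (⨆ f ∈ S, Proj.basicOpen 𝒜 f) = ⨆ f ∈ s, Proj.basicOpen 𝒜 f ∧
      ∀ f ∈ S, Algebra.FiniteType k (Away 𝒜 f) ∧ ∀ hf : f ∈ 𝒜 r,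
        Algebra.adjoin k {y : Away 𝒜 f | ∃ (v : A) (hv : v ∈ 𝒜 (1 • r)),
          v ∈ F ∧ y = Away.mk 𝒜 hf 1 v hv} = ⊤ := by
  have := hs.fintype
  choose d hd hf hfg using fun f : s => h f.1 f.2
  choose N hN using fun f : s => exists_adjoin_fractions (hf f) (hfg f)
  choose c hc using fun f : s => Finset.dvd_prod_of_mem d (Finset.mem_univ f)
  have hprod : 0 < ∏ f, d f := Finset.prod_pos fun f _ => hd f
  -- all elements get the degree `(∏ f, d f) * M`; the factor `M` makes the exponents large enough
  set M := 1 + ∑ f, N f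
  have hM : 0 < M := by omega
  have hcpos : ∀ f, 0 < c f := fun f => Nat.pos_of_ne_zero fun h0 => by
    have := hc f
    rw [h0, mul_zero] at this
    omega
  have he : ∀ f, 0 < c f * M := fun f => Nat.mul_pos (hcpos f) hM
  have hNe : ∀ f, N f ≤ c f * M := fun f => by
    have h1 : N f ≤ ∑ f, N f := Finset.single_le_sum (fun _ _ => Nat.zero_le _) (Finset.mem_univ f)
    have h2 : M ≤ c f * M := Nat.le_mul_of_pos_left M (hcpos f)
    omega
  have hr : ∀ f, c f * M * d f = (∏ f, d f) * M := fun f => by rw [hc f]; ring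
  have hmem : ∀ f : s, f.1 ^ (c f * M) ∈ 𝒜 ((∏ f, d f) * M) := fun f =>
    hr f ▸ SetLike.pow_mem_graded _ (hf f)
  choose F hFfin hFmem hF using fun f => hN f _ (he f) (hNe f) _ (hr f) (hmem f)
  refine ⟨(∏ f, d f) * M, Set.range fun f : s => f.1 ^ (c f * M),
    (Set.range fun f : s => f.1 ^ (c f * M)) ∪ ⋃ f, F f, Nat.mul_pos hprod hM, Set.finite_range _,
    (Set.finite_range _).union (Set.finite_iUnion hFfin), Set.subset_union_left, ?_, ?_, ?_⟩
  · rintro v (⟨f, rfl⟩ | hv)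
    · exact hmem f
    · obtain ⟨f, hv⟩ := Set.mem_iUnion.1 hv
      exact hFmem f v hv
  · rw [iSup_range, iSup_subtype']
    exact iSup_congr fun f => Proj.basicOpen_pow 𝒜 _ _ (he f)
  · rintro _ ⟨f, rfl⟩
    refine ⟨finiteType_away_pow (hf f) (he f) (hfg f), fun hf' => ?_⟩
    rw [eq_top_iff, ← hF f]
    refine Algebra.adjoin_mono ?_
    rintro y ⟨v, hv, hvF, rfl⟩
    exact ⟨v, hv, Or.inr (Set.mem_iUnion.2 ⟨f, hvF⟩), rfl⟩

/-- The fractions with denominator `f ^ n` generate if those with denominator `f` do, since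
`v / f = v f ^ (n - 1) / f ^ n`. -/
theorem adjoin_fractions_pow {f x : A} {r n : ℕ} (hn : 0 < n) (hf : f ∈ 𝒜 r) (hx : x = f ^ n)
    (hxr : x ∈ 𝒜 (n * r)) {F F' : Set A} (hF : ∀ v ∈ F, v * f ^ (n - 1) ∈ F')
    (h : Algebra.adjoin k {y : Away 𝒜 f | ∃ (v : A) (hv : v ∈ 𝒜 (1 • r)),
      v ∈ F ∧ y = Away.mk 𝒜 hf 1 v hv} = ⊤) :
    Algebra.adjoin k {y : Away 𝒜 x | ∃ (v : A) (hv : v ∈ 𝒜 (1 • (n * r))),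
      v ∈ F' ∧ y = Away.mk 𝒜 hxr 1 v hv} = ⊤ := by
  subst hx
  rw [eq_top_iff, ← (AlgHom.range_eq_top (awayPowMap (k := k) hf hn)).2
    (awayMap_pow_surjective hf hn), ← Algebra.map_top, ← h, AlgHom.map_adjoin]
  refine Algebra.adjoin_mono ?_
  rintro _ ⟨_, ⟨v, hv, hvF, rfl⟩, rfl⟩
  have hle : 1 ≤ 1 * n := by omega
  refine ⟨_, mul_pow_mem_degree hf rfl hle hv, by simpa using hF v hvF, ?_⟩
  rw [← awayMap_pow_mk hf hn hxr rfl 1 1 hle v hv]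
  rfl

end AwayGenerators

/-! ### Linear systems and symmetric algebras -/

section SymLinear

open HomogeneousLocalization

variable {k A V : Type u} [Field k] [CommRing A] [Algebra k A] [AddCommGroup V] [Module k V]
  {𝒜 : ℕ → Submodule k A} {r : ℕ} (j : V →ₗ[k] A) (hj : ∀ v, j v ∈ 𝒜 r)

include hj in
theorem lift_mem_degree [SetLike.GradedMonoid 𝒜] (n : ℕ) (b : SymmetricAlgebra k V)
    (hb : b ∈ symGrading k V n) :
    SymmetricAlgebra.lift j b ∈ 𝒜 (n • r) := by
  induction hb using Submodule.pow_induction_on_left' with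
  | algebraMap c =>
    rw [AlgHom.commutes, zero_smul]
    exact SetLike.algebraMap_mem_graded 𝒜 c
  | add x y i hx hy ihx ihy =>
    rw [map_add]
    exact add_mem ihx ihy
  | mem_mul m hm i x hx ih =>
    obtain ⟨v, rfl⟩ := hm
    rw [map_mul, SymmetricAlgebra.lift_ι_apply, Nat.succ_eq_add_one, add_comm, add_smul, one_smul]
    exact SetLike.mul_mem_graded (hj v) ih

/-- The homomorphism from the degree `0` part of `Sym V [1/w]` to `A_(w)` is surjective if `A_(w)`
is generated by the fractions `v / w` with `v ∈ V`. -/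
theorem awayMapOfLinear_lift_surjective [GradedAlgebra 𝒜] (w : V) {f : A}
    (hfw : f = SymmetricAlgebra.lift j (SymmetricAlgebra.ι k V w)) (hf : f ∈ 𝒜 r)
    (h : Algebra.adjoin k {y : Away 𝒜 f |
      ∃ (v : V) (hv : j v ∈ 𝒜 (1 • r)), y = Away.mk 𝒜 hf 1 (j v) hv} = ⊤) :
    Function.Surjective (awayMapOfLinear (lift_mem_degree j hj) (ι_mem_symGrading k V w)) := by
  subst hfw
  intro y
  have hy : y ∈ Algebra.adjoin k _ := h ▸ Algebra.mem_top
  change y ∈ (awayMapOfLinear (lift_mem_degree j hj) (ι_mem_symGrading k V w)).range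
  induction hy using Algebra.adjoin_induction with
  | mem y hy =>
    obtain ⟨v, hv, rfl⟩ := hy
    have h1 : SymmetricAlgebra.ι k V v ∈ symGrading k V (1 • 1) := ι_mem_symGrading k V v
    refine ⟨Away.mk _ (ι_mem_symGrading k V w) 1 (SymmetricAlgebra.ι k V v) h1, ?_⟩
    rw [awayMapOfLinear_mk, dehomogenize_apply _ _ _ _ (ι_mem_symGrading k V v)]
    congr 1
    exact SymmetricAlgebra.lift_ι_apply _ _
  | algebraMap c =>
    have h1 : algebraMap k (SymmetricAlgebra k V) c ∈ symGrading k V (0 • 1) :=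
      SetLike.algebraMap_mem_graded (symGrading k V) c
    refine ⟨Away.mk _ (ι_mem_symGrading k V w) 0 _ h1, ?_⟩
    rw [awayMapOfLinear_mk, dehomogenize_algebraMap]
  | add x y _ _ hx hy => exact add_mem hx hy
  | mul x y _ _ hx hy => exact mul_mem hx hy

end SymLinear

/-! ### Morphisms defined by sections of the tensor powers of a linearised line bundle -/

/-- Let `φ` be a morphism from an open subset `U` to `Proj B` and `f` an endomorphism which
preserves `U`. Then `φ` and `φ ∘ f` agree on `f⁻¹ V` if the homogeneous coordinates of `φ` on `V`
pull back to those on `f⁻¹ V`. -/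
theorem homOfLE_resLE_comp_eq {σ : Type*} {B : Type u} [CommRing B] [SetLike σ B]
    [AddSubgroupClass σ B] {ℬ : ℕ → σ} [GradedRing ℬ] {Z : Scheme.{u}} (f : Z ⟶ Z) {U V : Z.Opens}
    (hU : U ≤ f ⁻¹ᵁ U) (hV : V ≤ U) (hV' : f ⁻¹ᵁ V ≤ U) (φ : U.toScheme ⟶ Proj ℬ)
    (v : B →+* Γ(Z, V)) (v' : B →+* Γ(Z, f ⁻¹ᵁ V)) (hvv' : ∀ b, v' b = f.app V (v b))
    (hv : (HomogeneousIdeal.irrelevant ℬ).toIdeal.map (V.topIso.inv.hom.comp v) = ⊤)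
    (hv' : (HomogeneousIdeal.irrelevant ℬ).toIdeal.map ((f ⁻¹ᵁ V).topIso.inv.hom.comp v') = ⊤)
    (h1 : Z.homOfLE hV ≫ φ = Proj.fromOfGlobalSections ℬ (V.topIso.inv.hom.comp v) hv)
    (h2 : Z.homOfLE hV' ≫ φ =
      Proj.fromOfGlobalSections ℬ ((f ⁻¹ᵁ V).topIso.inv.hom.comp v') hv') :
    (U.ι ⁻¹ᵁ (f ⁻¹ᵁ V)).ι ≫ f.resLE U U hU ≫ φ = (U.ι ⁻¹ᵁ (f ⁻¹ᵁ V)).ι ≫ φ := by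
  obtain ⟨e, -, he⟩ := exists_lift_homOfLE hV' (le_refl (U.ι ⁻¹ᵁ (f ⁻¹ᵁ V)))
  rw [he, Category.assoc, Category.assoc]
  congr 1
  have h3 : Z.homOfLE hV' ≫ f.resLE U U hU = f ∣_ V ≫ Z.homOfLE hV := by
    rw [← cancel_mono U.ι]
    simp only [Category.assoc, Scheme.Hom.resLE_comp_ι, Scheme.homOfLE_ι_assoc, Scheme.homOfLE_ι]
    exact (morphismRestrict_ι _ _).symm
  rw [reassoc_of% h3, h1, h2]
  refine comp_fromOfGlobalSections_of_proportional (f ∣_ V) _ _ hv hv' 1 fun n b hb => ?_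
  rw [one_pow, one_mul]
  refine Eq.trans ?_ (morphismRestrict_appTop_topIso_inv f V (v b)).symm
  rw [← hvv']
  rfl

/-- Pulling back along a retraction `g` of `f`, and then along `f`, is the identity on functions. -/
theorem app_appLE_eq_self {Z : Scheme.{u}} (f g : Z ⟶ Z) (hfg : f ≫ g = 𝟙 Z) (V : Z.Opens)
    (h : V ≤ g ⁻¹ᵁ (f ⁻¹ᵁ V)) (z : Γ(Z, f ⁻¹ᵁ V)) :
    f.app V (g.appLE (f ⁻¹ᵁ V) V h z) = z := by
  have h2 : ∀ (g' : Z ⟶ Z) (_ : 𝟙 _ = g') (W : Z.Opens) (hW : W ≤ g' ⁻¹ᵁ W),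
      g'.appLE W W hW = 𝟙 _ := by
    rintro _ rfl W hW
    rw [Scheme.Hom.appLE, Scheme.Hom.id_app]
    exact (Category.id_comp _).trans (Z.presheaf.map_id _)
  have h3 : g.appLE (f ⁻¹ᵁ V) V h ≫ f.appLE V (f ⁻¹ᵁ V) le_rfl = 𝟙 _ := by
    rw [Scheme.Hom.appLE_comp_appLE]
    exact h2 _ hfg.symm _ _
  rw [Scheme.Hom.app_eq_appLE, ← ConcreteCategory.comp_apply, h3]
  rfl

namespace Linearisation

variable {k : Type u} [Field k] {H X : Sch k} [GrpObj H] [ModObj H X] (L : Linearisation H X)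

theorem evalAt_res {n : ℕ} {s : L.LocalFunctions} (hs : s ∈ L.sections n) (c : L.Coord)
    {V : X.left.Opens} (hV : V ≤ c.U) :
    L.evalAt (c.res V hV) s = X.left.presheaf.map (homOfLE hV).op (L.evalAt c s) := hs.1 c V hV

/-- Around a point where a section does not vanish there is a coordinate in which it is
invertible. -/
theorem exists_coord_isUnit {n : ℕ} {s : L.LocalFunctions} (hs : s ∈ L.sections n) {x : X.left}
    (hx : x ∈ L.nonvanishing s) :
    ∃ c : L.Coord, x ∈ c.U ∧ c.U ≤ L.nonvanishing s ∧ IsUnit (L.evalAt c s) := by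
  obtain ⟨c, hc⟩ := Opens.mem_iSup.1 hx
  refine ⟨c.res _ (X.left.basicOpen_le (L.evalAt c s)), hc,
    le_iSup (fun c => X.left.basicOpen (L.evalAt c s)) c, ?_⟩
  rw [L.evalAt_res hs]
  exact RingedSpace.isUnit_res_basicOpen X.left.toRingedSpace (L.evalAt c s)

variable {L} in
/-- The values of a section of `L^{⊗ n}` in two coordinates differ by the `n`-th power of a
function which depends only on the coordinates. -/
theorem exists_transition (c c' : L.Coord) : ∃ g : Γ(X.left, c.U ⊓ c'.U),
    ∀ n, ∀ s ∈ L.sections n,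
      X.left.presheaf.map (homOfLE (inf_le_right : c.U ⊓ c'.U ≤ c'.U)).op (L.evalAt c' s) =
        g ^ n * X.left.presheaf.map (homOfLE (inf_le_left : c.U ⊓ c'.U ≤ c.U)).op
          (L.evalAt c s) := by
  obtain ⟨g, hg⟩ := (L.isCoord_iff _ _ _ (c.res (c.U ⊓ c'.U) inf_le_left).isCoord).1
    (c'.res (c.U ⊓ c'.U) inf_le_right).isCoord
  refine ⟨g.1, fun n s hs => ?_⟩
  rw [← L.evalAt_res hs c inf_le_left, ← L.evalAt_res hs c' inf_le_right]
  have key : ∀ (W : X.left.Opens) (t t' : Γ(L.total, L.proj ⁻¹ᵁ W)) (ht : L.IsCoord W t)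
      (ht' : L.IsCoord W t') (g : Γ(X.left, W)ˣ), t' = L.proj.app W g * t →
      L.evalAt ⟨W, t', ht'⟩ s = g.1 ^ n * L.evalAt ⟨W, t, ht⟩ s := by
    rintro W t _ ht ht' g rfl
    exact hs.2 ⟨W, t, ht⟩ g
  exact key _ _ _ _ _ g hg

section MapDefinedBy

variable {σ : Type*} {B : Type u} [CommRing B] [SetLike σ B] [AddSubgroupClass σ B]
  {ℬ : ℕ → σ} [GradedRing ℬ] {u : B →+* L.LocalFunctions} {m : ℕ}

theorem irrelevant_map_eq_top {d : ℕ} (hd : 0 < d) {b : B} (hb : b ∈ ℬ d) (c : L.Coord)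
    (h : IsUnit (L.evalAt c (u b))) :
    (HomogeneousIdeal.irrelevant ℬ).toIdeal.map
      ((c.U.topIso.inv.hom.comp (L.evalAt c)).comp u) = ⊤ :=
  Ideal.eq_top_of_isUnit_mem _ (Ideal.mem_map_of_mem _
    (HomogeneousIdeal.mem_irrelevant_of_mem ℬ hd hb)) (h.map c.U.topIso.inv.hom)

/-- Sections without common zeros on `U` define a unique morphism from `U` to `Proj`. -/
theorem existsUnique_isMapDefinedBy (hu : ∀ n, ∀ b ∈ ℬ n, u b ∈ L.sections (n * m))
    {U : X.left.Opens} (hU : ∀ x ∈ U, ∃ d, 0 < d ∧ ∃ b ∈ ℬ d,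
      x ∈ L.nonvanishing (u b) ∧ L.nonvanishing (u b) ≤ U) :
    ∃! φ : U.toScheme ⟶ Proj ℬ, L.IsMapDefinedBy ℬ u U φ := by
  have := existsUnique_of_local_sections (Z := X.left) (U := U) (ℬ := ℬ)
    (ι := {c : L.Coord // c.U ≤ U ∧ (HomogeneousIdeal.irrelevant ℬ).toIdeal.map
      ((c.U.topIso.inv.hom.comp (L.evalAt c)).comp u) = ⊤})
    (fun c => c.1.U) (fun c => c.2.1) (fun x hx => by
      obtain ⟨d, hd, b, hb, hxb, hle⟩ := hU x hx
      obtain ⟨c, hxc, hc, hunit⟩ := L.exists_coord_isUnit (hu d b hb) hxb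
      exact ⟨⟨c, hc.trans hle, L.irrelevant_map_eq_top hd hb c hunit⟩, hxc⟩)
    (fun c => (L.evalAt c.1).comp u) (fun c => c.2.2) fun c c' => by
      obtain ⟨g, hg⟩ := exists_transition c.1 c'.1
      refine ⟨g ^ m, fun n b hb => ?_⟩
      rw [← pow_mul, mul_comm m]
      exact hg _ _ (hu n b hb)
  refine (existsUnique_congr fun φ => ?_).1 this
  exact ⟨fun h c hc hgen => h ⟨c, hc, hgen⟩, fun h c => h c.1 c.2.1 c.2.2⟩

/-- The morphism defined by `u` maps the points where `u b` does not vanish to `D₊(b)`. -/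
theorem IsMapDefinedBy.preimage_basicOpen {U : X.left.Opens} {φ : U.toScheme ⟶ Proj ℬ}
    (hφ : L.IsMapDefinedBy ℬ u U φ) {d n : ℕ} (hd : 0 < d) {b : B} (hb : b ∈ ℬ d)
    (hu : u b ∈ L.sections n) (hU : L.nonvanishing (u b) ≤ U) :
    U.ι ⁻¹ᵁ L.nonvanishing (u b) ≤ φ ⁻¹ᵁ Proj.basicOpen ℬ b := by
  rintro ⟨x, hx⟩ hxb
  obtain ⟨c, hxc, hc, hunit⟩ := L.exists_coord_isUnit hu hxb
  have h1 := hφ c (hc.trans hU) (L.irrelevant_map_eq_top hd hb c hunit)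
  have h2 := Proj.fromOfGlobalSections_preimage_basicOpen ℬ _
    (L.irrelevant_map_eq_top hd hb c hunit) hd hb
  rw [← h1, Scheme.Hom.comp_preimage] at h2
  have h3 : (⟨x, hxc⟩ : c.U.toScheme) ∈ c.U.toScheme.basicOpen
      (((c.U.topIso.inv.hom.comp (L.evalAt c)).comp u) b) :=
    (Scheme.basicOpen_of_isUnit _ (hunit.map c.U.topIso.inv.hom)).ge trivial
  rw [← h2] at h3
  have h4 : X.left.homOfLE (hc.trans hU) (⟨x, hxc⟩ : c.U.toScheme) = ⟨x, hx⟩ :=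
    Scheme.homOfLE_apply' _ _ _
  change X.left.homOfLE (hc.trans hU) (⟨x, hxc⟩ : c.U.toScheme) ∈ φ ⁻¹ᵁ Proj.basicOpen ℬ b at h3
  rwa [h4] at h3

end MapDefinedBy

/-! ### Invariance -/

open MonoidalCategory CartesianMonoidalCategory MonObj

theorem translate_comp_inv (h : Pt H) :
    (translate X h).left ≫ (translate X h⁻¹).left = 𝟙 X.left := by
  have := congrArg Over.Hom.left (translate_inv X h⁻¹)
  rwa [inv_inv] at this

theorem evalAt_act (h : Pt H) (s : L.LocalFunctions) (c : L.Coord) :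
    L.evalAt c (L.act h s) = (translate X h⁻¹).left.appLE ((translate X h).left ⁻¹ᵁ c.U) c.U
      (le_preimage_preimage h c.U) (L.evalAt (L.pullCoord h c) s) := rfl

/-- The value of an invariant section in the coordinate `t ∘ h` is the translate of its value in
the coordinate `t`. -/
theorem evalAt_pullCoord {s : L.LocalFunctions} (h : Pt H) (hs : L.act h s = s) (c : L.Coord) :
    L.evalAt (L.pullCoord h c) s = (translate X h).left.app c.U (L.evalAt c s) := by
  have h1 := L.evalAt_act h s c
  rw [hs] at h1
  rw [h1]
  exact (app_appLE_eq_self _ _ (translate_comp_inv h) c.U _ _).symm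

theorem preimage_nonvanishing_le {s : L.LocalFunctions} (h : Pt H) (hs : L.act h s = s) :
    (translate X h).left ⁻¹ᵁ L.nonvanishing s ≤ L.nonvanishing s := by
  intro x hx
  obtain ⟨c, hc⟩ := Opens.mem_iSup.1 hx
  refine Opens.mem_iSup.2 ⟨L.pullCoord h c, ?_⟩
  rw [L.evalAt_pullCoord h hs]
  have := Scheme.preimage_basicOpen (translate X h).left (L.evalAt c s)
  exact this.le hc

theorem preimage_eq_of_forall_le {U : X.left.Opens}
    (hU : ∀ h : Pt H, (translate X h).left ⁻¹ᵁ U ≤ U) (h : Pt H) :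
    (translate X h).left ⁻¹ᵁ U = U := by
  refine le_antisymm (hU h) ?_
  have := (translate X h).left.preimage_mono (hU h⁻¹)
  rwa [← Scheme.Hom.comp_preimage, translate_comp_inv] at this

section Invariance

variable {σ : Type*} {B : Type u} [CommRing B] [SetLike σ B] [AddSubgroupClass σ B]
  {ℬ : ℕ → σ} [GradedRing ℬ] {u : B →+* L.LocalFunctions} {m : ℕ}

/-- A morphism defined by invariant sections is invariant. -/
theorem IsMapDefinedBy.invariant (hu : ∀ n, ∀ b ∈ ℬ n, u b ∈ L.sections (n * m))
    {U : X.left.Opens} (hU : ∀ x ∈ U, ∃ d, 0 < d ∧ ∃ b ∈ ℬ d,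
      x ∈ L.nonvanishing (u b) ∧ L.nonvanishing (u b) ≤ U)
    {φ : U.toScheme ⟶ Proj ℬ} (hφ : L.IsMapDefinedBy ℬ u U φ)
    (hinv : ∀ (h : Pt H) (b : B), L.act h (u b) = u b) (h : Pt H) :
    ∃ τ : U.toScheme ⟶ U.toScheme, τ ≫ U.ι = U.ι ≫ (translate X h).left ∧ τ ≫ φ = φ := by
  have hUle : ∀ h : Pt H, (translate X h).left ⁻¹ᵁ U ≤ U := fun h x hx => by
    obtain ⟨d, hd, b, hb, hxb, hle⟩ := hU _ hx
    exact hle (L.preimage_nonvanishing_le h (hinv h b) hxb)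
  have hUeq := preimage_eq_of_forall_le hUle h
  refine ⟨(translate X h).left.resLE U U hUeq.ge, Scheme.Hom.resLE_comp_ι _ _, ?_⟩
  refine Scheme.hom_ext_of_forall _ _ fun x => ?_
  have hx : (translate X h).left x.1 ∈ U := hUeq.ge x.2
  obtain ⟨d, hd, b, hb, hxb, hle⟩ := hU _ hx
  obtain ⟨c, hxc, hc, hunit⟩ := L.exists_coord_isUnit (hu d b hb) hxb
  have hcU : (L.pullCoord h c).U ≤ U :=
    ((translate X h).left.preimage_mono (hc.trans hle)).trans (hUle h)
  have hunit' : IsUnit (L.evalAt (L.pullCoord h c) (u b)) := by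
    rw [L.evalAt_pullCoord h (hinv h b)]
    exact hunit.map ((translate X h).left.app c.U).hom
  exact ⟨U.ι ⁻¹ᵁ ((translate X h).left ⁻¹ᵁ c.U), hxc,
    homOfLE_resLE_comp_eq (translate X h).left hUeq.ge (hc.trans hle) hcU φ
      ((L.evalAt c).comp u) ((L.evalAt (L.pullCoord h c)).comp u)
      (fun b => L.evalAt_pullCoord h (hinv h b) c) _ _
      (hφ c (hc.trans hle) (L.irrelevant_map_eq_top hd hb c hunit))
      (hφ (L.pullCoord h c) hcU (L.irrelevant_map_eq_top hd hb _ hunit'))⟩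

end Invariance
end Linearisation

namespace Linearisation

variable {k : Type u} [Field k] {H X : Sch k} [GrpObj H] [ModObj H X] (L : Linearisation H X)

/-! ### The linear system of an enveloping system -/

theorem toRingHom_toRing {r : ℕ} (f : L.invariants r) :
    GradedSum.toRingHom L.invariants (L.toRing f) = f.1 :=
  DirectSum.coeAlgHom_of L.invariants r f

theorem toRing_injective (r : ℕ) : Function.Injective (L.toRing : L.invariants r → _) :=
  fun f g h => Subtype.ext (by rw [← L.toRingHom_toRing f, h, L.toRingHom_toRing])

theorem toRing_powInvariant {r : ℕ} (n : ℕ) (f : L.invariants r) :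
    L.toRing (L.powInvariant n f) = L.toRing f ^ n :=
  (DirectSum.ofPow (A := fun n => L.invariants n) f n).symm

theorem toRingHom_mem_sections {n : ℕ} {b : L.InvariantRing} (hb : b ∈ L.grading n) :
    GradedSum.toRingHom L.invariants b ∈ L.sections n := by
  obtain ⟨f, rfl⟩ := hb
  exact (L.toRingHom_toRing f).symm ▸ f.2.1

section Embedding

variable {r : ℕ} {W : Submodule k L.LocalFunctions} (hW : W ≤ L.invariants r)

variable {L} in
/-- The inclusion of a space of invariant sections in the ring of invariants. -/
def toRingMap : W →ₗ[k] L.InvariantRing := GradedSum.of L.invariants r ∘ₗ Submodule.inclusion hW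

variable {L}

theorem toRingMap_mem (w : W) : toRingMap hW w ∈ L.grading r := L.toRing_mem _

/-- The homomorphism `Sym W → S^H` followed by the inclusion of `S^H` in the section ring is the one
given by the inclusion of `W`. -/
theorem toRingHom_lift (b : SymmetricAlgebra k W) :
    GradedSum.toRingHom L.invariants (SymmetricAlgebra.lift (toRingMap hW) b) =
      SymmetricAlgebra.lift W.subtype b := by
  let e : L.InvariantRing →ₐ[k] L.LocalFunctions := DirectSum.coeAlgHom L.invariants
  have : e.comp (SymmetricAlgebra.lift (toRingMap hW)) = SymmetricAlgebra.lift W.subtype := by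
    apply SymmetricAlgebra.algHom_ext
    ext w
    change e (SymmetricAlgebra.lift (toRingMap hW) (SymmetricAlgebra.ι k W w)) =
      SymmetricAlgebra.lift W.subtype (SymmetricAlgebra.ι k W w)
    rw [SymmetricAlgebra.lift_ι_apply, SymmetricAlgebra.lift_ι_apply]
    exact L.toRingHom_toRing (Submodule.inclusion hW w)
  exact congr($this b)

theorem restrictTwistSection_congr {A : Type u} [CommRing A] [Algebra k A] {𝒜 : ℕ → Submodule k A}
    [GradedAlgebra 𝒜] (𝒰 : (Proj 𝒜).Opens) {a b : A} (h : a = b) (ha : a ∈ 𝒜 r) (hb : b ∈ 𝒜 r)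
    (V : 𝒰.toScheme.Opens) : restrictTwistSection 𝒰 ha V = restrictTwistSection 𝒰 hb V := by
  subst h
  rfl

theorem isLineBundle_twist (S : Set (L.invariants r)) :
    IsLineBundle (L.twist (L.unionBasicOpen S) r) := by
  refine isLineBundle_restrict_twistingSheaf _ fun x hx => ?_
  obtain ⟨f, hx⟩ := Opens.mem_iSup.1 hx
  obtain ⟨-, hx⟩ := Opens.mem_iSup.1 hx
  exact ⟨L.toRing f, L.toRing_mem f, hx⟩

/-- A space `W` of invariant sections which contains `S`, and whose fractions with denominator
`f` generate the algebras `(S^H)_(f)` for `f ∈ S`, defines an embedding of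
`⋃_{f ∈ S} Spec (S^H)_(f)` in the projective space of `W`. -/
theorem exists_embedding (hr : 0 < r) {S : Set (L.invariants r)} (hS : ∀ f ∈ S, f.1 ∈ W)
    (hgen : ∀ f ∈ S, Algebra.adjoin k
      {y | ∃ v : L.invariants r, v.1 ∈ W ∧ y = L.fraction v f} = ⊤) :
    ∃ φ : (L.unionBasicOpen S).toScheme ⟶ ProjSpace k W, IsImmersion φ ∧
      φ ≫ projToSpec (symGrading k W) = L.structureMap (L.unionBasicOpen S) ∧
      IsDefinedByLinearSystem k φ (L.twist (L.unionBasicOpen S) r)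
        (fun v => L.naturalMap (L.unionBasicOpen S) ⟨v.1, hW v.2⟩) ∧
      ∀ (w : W), (⟨w.1, hW w.2⟩ : L.invariants r) ∈ S →
        ∀ hle : Proj.basicOpen L.grading (SymmetricAlgebra.lift (toRingMap hW)
          (SymmetricAlgebra.ι k W w)) ≤ L.unionBasicOpen S,
        (Proj L.grading).homOfLE hle ≫ φ = localLinearMap
          (lift_mem_degree (toRingMap hW) (toRingMap_mem hW)) (ι_mem_symGrading k W w) := by
  have hι : ∀ w : W, SymmetricAlgebra.lift (toRingMap hW) (SymmetricAlgebra.ι k W w) =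
      L.toRing ⟨w.1, hW w.2⟩ := fun w => SymmetricAlgebra.lift_ι_apply _ _
  let ι := {w : W // (⟨w.1, hW w.2⟩ : L.invariants r) ∈ S}
  let t : ι → SymmetricAlgebra k W := fun w => SymmetricAlgebra.ι k W w.1
  have ht : ∀ i, t i ∈ symGrading k W 1 := fun w => ι_mem_symGrading k W w.1
  have hθ := lift_mem_degree (toRingMap hW) (toRingMap_mem hW)
  have hle : ∀ i, Proj.basicOpen L.grading (SymmetricAlgebra.lift (toRingMap hW) (t i)) ≤
      L.unionBasicOpen S := fun w => by
    rw [hι]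
    exact le_iSup₂ (f := fun f _ => Proj.basicOpen L.grading (L.toRing f)) _ w.2
  have hcov : ∀ x ∈ L.unionBasicOpen S, ∃ i,
      x ∈ Proj.basicOpen L.grading (SymmetricAlgebra.lift (toRingMap hW) (t i)) := fun x hx => by
    obtain ⟨f, hx⟩ := Opens.mem_iSup.1 hx
    obtain ⟨hf, hx⟩ := Opens.mem_iSup.1 hx
    exact ⟨⟨⟨f.1, hS f hf⟩, hf⟩, (hι ⟨f.1, hS f hf⟩).symm ▸ hx⟩
  obtain ⟨φ, hφ⟩ := exists_linearMap hθ t ht hle hcov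
  refine ⟨φ, isImmersion_linearMap hθ t ht hle hcov φ hφ hr fun w => ?_,
    linearMap_projToSpec hθ t ht hle hcov φ hφ hr, ?_, fun w hw hle => hφ ⟨w, hw⟩⟩
  · refine awayMapOfLinear_lift_surjective (toRingMap hW) (toRingMap_mem hW) w.1 (hι w.1).symm
      (L.toRing_mem _) ?_
    rw [eq_top_iff, ← hgen _ w.2]
    refine Algebra.adjoin_mono ?_
    rintro _ ⟨v, hv, rfl⟩
    exact ⟨⟨v.1, hv⟩, (one_smul ℕ r).symm ▸ L.toRing_mem v, rfl⟩
  · obtain ⟨η, hη, h⟩ := exists_twist_transpose hθ t ht hle hcov φ hφ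
    refine ⟨η, hη, fun v => (h _ (ι_mem_symGrading k W v)).trans ?_⟩
    exact restrictTwistSection_congr _ (hι v) _ _ _

end Embedding

end Linearisation

namespace Linearisation

variable {k : Type u} [Field k] {H X : Sch k} [GrpObj H] [ModObj H X] (L : Linearisation H X)

/-! ### The canonical morphism to the enveloping quotient -/

theorem le_semistableFG {r : ℕ} (hr : 0 < r) {f : L.invariants r} (hf : L.IsFG f) :
    L.nonvanishing f.1 ≤ L.semistableFG :=
  (le_iSup₂_of_le (f := fun (f : L.invariants r) (_ : L.IsFG f) => L.nonvanishing f.1)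
    f hf le_rfl).trans (le_iSup₂ (f := fun r (_ : 0 < r) =>
      ⨆ (f : L.invariants r) (_ : L.IsFG f), L.nonvanishing f.1) r hr)

theorem le_envelopingQuotient {r : ℕ} (hr : 0 < r) {f : L.invariants r} (hf : L.IsFG f) :
    Proj.basicOpen L.grading (L.toRing f) ≤ L.envelopingQuotient :=
  (le_iSup₂_of_le (f := fun (f : L.invariants r) (_ : L.IsFG f) =>
    Proj.basicOpen L.grading (L.toRing f)) f hf le_rfl).trans (le_iSup₂ (f := fun r (_ : 0 < r) =>
      ⨆ (f : L.invariants r) (_ : L.IsFG f), Proj.basicOpen L.grading (L.toRing f)) r hr)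

theorem mem_semistableFG {x : X.left} (hx : x ∈ L.semistableFG) :
    ∃ r, 0 < r ∧ ∃ f : L.invariants r, L.IsFG f ∧ x ∈ L.nonvanishing f.1 := by
  obtain ⟨r, hx⟩ := Opens.mem_iSup.1 hx
  obtain ⟨hr, hx⟩ := Opens.mem_iSup.1 hx
  obtain ⟨f, hx⟩ := Opens.mem_iSup.1 hx
  obtain ⟨hf, hx⟩ := Opens.mem_iSup.1 hx
  exact ⟨r, hr, f, hf, hx⟩

theorem mem_envelopingQuotient {x : Proj L.grading} (hx : x ∈ L.envelopingQuotient) :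
    ∃ r, 0 < r ∧ ∃ f : L.invariants r, L.IsFG f ∧ x ∈ Proj.basicOpen L.grading (L.toRing f) := by
  obtain ⟨r, hx⟩ := Opens.mem_iSup.1 hx
  obtain ⟨hr, hx⟩ := Opens.mem_iSup.1 hx
  obtain ⟨f, hx⟩ := Opens.mem_iSup.1 hx
  obtain ⟨hf, hx⟩ := Opens.mem_iSup.1 hx
  exact ⟨r, hr, f, hf, hx⟩

/-- The canonical morphism maps `X_f` to `Spec (S^H)_(f)`. -/
theorem preimage_toRing {U : X.left.Opens} {Q : U.toScheme ⟶ Proj L.grading}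
    (hQ : L.IsMapDefinedBy L.grading (GradedSum.toRingHom L.invariants) U Q) {r : ℕ} (hr : 0 < r)
    (f : L.invariants r) (hf : L.nonvanishing f.1 ≤ U) :
    U.ι ⁻¹ᵁ L.nonvanishing f.1 ≤ Q ⁻¹ᵁ Proj.basicOpen L.grading (L.toRing f) := by
  have := hQ.preimage_basicOpen (b := L.toRing f) L hr (L.toRing_mem f)
    (L.toRingHom_mem_sections (L.toRing_mem f))
  rw [L.toRingHom_toRing] at this
  exact this hf

/-- The canonical morphism `X^{ss,fg} ⟶ X⫽H` exists and is unique. -/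
theorem existsUnique_envelopingQuotientMap :
    ∃! q : L.semistableFG.toScheme ⟶ L.envelopingQuotient.toScheme,
      L.IsEnvelopingQuotientMap q := by
  obtain ⟨Q, hQ, hQu⟩ := L.existsUnique_isMapDefinedBy (ℬ := L.grading)
    (u := GradedSum.toRingHom L.invariants) (m := 1)
    (fun n b hb => by rw [mul_one]; exact L.toRingHom_mem_sections hb) (U := L.semistableFG)
    fun x hx => by
      obtain ⟨r, hr, f, hf, hx⟩ := L.mem_semistableFG hx
      refine ⟨r, hr, L.toRing f, L.toRing_mem f, ?_⟩
      rw [L.toRingHom_toRing]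
      exact ⟨hx, L.le_semistableFG hr hf⟩
  have hrange : Set.range Q ⊆ Set.range L.envelopingQuotient.ι := by
    rw [Scheme.Opens.range_ι]
    rintro _ ⟨x, rfl⟩
    obtain ⟨r, hr, f, hf, hx⟩ := L.mem_semistableFG x.2
    exact L.le_envelopingQuotient hr hf
      (L.preimage_toRing hQ hr f (L.le_semistableFG hr hf) hx)
  have hfac := IsOpenImmersion.lift_fac L.envelopingQuotient.ι Q hrange
  refine ⟨IsOpenImmersion.lift L.envelopingQuotient.ι Q hrange, ?_, fun q hq => ?_⟩
  · change L.IsMapDefinedBy _ _ _ (_ ≫ _)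
    rw [hfac]
    exact hQ
  · rw [← cancel_mono L.envelopingQuotient.ι, hfac]
    exact hQu _ hq

/-! ### Compatibility of the embedding with the canonical morphism -/

section Compatibility

variable {L} {r : ℕ} {W : Submodule k L.LocalFunctions} (hW : W ≤ L.invariants r)

/-- Near the points where the section `w ∈ W` does not vanish, the morphism defined by `W` is the
composite of the canonical morphism and the embedding defined by `W`. -/
theorem homOfLE_comp_eq (hr : 0 < r) {U : X.left.Opens} {𝒰 : (Proj L.grading).Opens}
    (Q : U.toScheme ⟶ Proj L.grading) (qU : U.toScheme ⟶ 𝒰.toScheme) (hqU : qU ≫ 𝒰.ι = Q)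
    (φ : U.toScheme ⟶ ProjSpace k W) (ψ : 𝒰.toScheme ⟶ ProjSpace k W) (c : L.Coord)
    (hc : c.U ≤ U) (w : W) (hw : IsUnit (L.evalAt c w.1))
    (hgenQ : (HomogeneousIdeal.irrelevant L.grading).toIdeal.map
      ((c.U.topIso.inv.hom.comp (L.evalAt c)).comp (GradedSum.toRingHom L.invariants)) = ⊤)
    (hQ : X.left.homOfLE hc ≫ Q = Proj.fromOfGlobalSections L.grading
      ((c.U.topIso.inv.hom.comp (L.evalAt c)).comp (GradedSum.toRingHom L.invariants)) hgenQ)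
    (hgenφ : (HomogeneousIdeal.irrelevant (symGrading k W)).toIdeal.map
      ((c.U.topIso.inv.hom.comp (L.evalAt c)).comp
        (SymmetricAlgebra.lift W.subtype).toRingHom) = ⊤)
    (hφ : X.left.homOfLE hc ≫ φ = Proj.fromOfGlobalSections (symGrading k W)
      ((c.U.topIso.inv.hom.comp (L.evalAt c)).comp
        (SymmetricAlgebra.lift W.subtype).toRingHom) hgenφ)
    (hle : Proj.basicOpen L.grading (SymmetricAlgebra.lift (toRingMap hW)
      (SymmetricAlgebra.ι k W w)) ≤ 𝒰)
    (hψ : (Proj L.grading).homOfLE hle ≫ ψ = localLinearMap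
      (lift_mem_degree (toRingMap hW) (toRingMap_mem hW)) (ι_mem_symGrading k W w)) :
    X.left.homOfLE hc ≫ φ = X.left.homOfLE hc ≫ qU ≫ ψ := by
  have hθ := lift_mem_degree (toRingMap hW) (toRingMap_mem hW)
  set θ := SymmetricAlgebra.lift (toRingMap hW) with hθdef
  set t := SymmetricAlgebra.ι k W w
  have ht : t ∈ symGrading k W 1 := ι_mem_symGrading k W w
  have hf := map_mem_degree (symGrading k W) θ hθ ht
  set v := (c.U.topIso.inv.hom.comp (L.evalAt c)).comp (GradedSum.toRingHom L.invariants) with hv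
  have hvθ : ∀ b, v (θ b) = c.U.topIso.inv (L.evalAt c (SymmetricAlgebra.lift W.subtype b)) :=
    fun b => congrArg (fun s => c.U.topIso.inv (L.evalAt c s)) (toRingHom_lift hW b)
  have hunit : IsUnit (v (θ t)) := by
    rw [hvθ, SymmetricAlgebra.lift_ι_apply]
    exact hw.map c.U.topIso.inv.hom
  -- the canonical morphism maps the domain of `c` to `D₊(w)`
  obtain ⟨qc, hqc⟩ : ∃ qc : c.U.toScheme ⟶ (Proj.basicOpen L.grading (θ t)).toScheme,
      qc ≫ (Proj.basicOpen L.grading (θ t)).ι = X.left.homOfLE hc ≫ Q := by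
    refine ⟨IsOpenImmersion.lift (Proj.basicOpen L.grading (θ t)).ι _ ?_,
      IsOpenImmersion.lift_fac _ _ _⟩
    rw [Scheme.Opens.range_ι]
    rintro _ ⟨y, rfl⟩
    have h1 := Proj.fromOfGlobalSections_preimage_basicOpen L.grading v hgenQ hr hf
    rw [Scheme.basicOpen_of_isUnit _ hunit, ← hQ] at h1
    exact h1.ge trivial
  have h2 : X.left.homOfLE hc ≫ qU = qc ≫ (Proj L.grading).homOfLE hle := by
    rw [← cancel_mono 𝒰.ι, Category.assoc, Category.assoc, hqU, Scheme.homOfLE_ι, hqc]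
  rw [reassoc_of% h2, hψ, hφ]
  have h3 : X.left.homOfLE hc ≫ Q = c.U.toScheme.toSpecΓ ≫
      Spec.map (CommRingCat.ofHom (awayEval L.grading v hunit)) ≫
        Proj.awayι L.grading (θ t) hf hr := by
    have := comp_fromOfGlobalSections (𝟙 _) v hgenQ hf hr (by simpa using hunit)
    rw [Category.id_comp, ← hQ] at this
    rw [this]
    congr 4
  rw [← hqc] at h3
  have htop : (⊤ : c.U.toScheme.Opens) ≤
      (qc ≫ (Proj.basicOpen L.grading (θ t)).ι) ⁻¹ᵁ Proj.basicOpen L.grading (θ t) := by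
    rw [Scheme.Hom.comp_preimage, Scheme.Opens.ι_preimage_self]
    exact le_top
  refine (comp_fromOfGlobalSections_of_proportional qc _ _ (coordOn_irrelevant hθ ht) hgenφ
    (v (θ t)) fun n b hb => ?_).symm
  have h4 := appLE_awayToSection _ hf hr _ h3 htop
    (HomogeneousLocalization.Away.mk L.grading hf n (θ b) (hθ n b hb))
  rw [← appTop_topIso_inv qc htop] at h4
  have h5 := awayEval_mk_mul v hunit hf n (θ b) (hθ n b hb)
  rw [← h4, hvθ b, mul_comm] at h5
  have h6 : coordOn (symGrading k W) θ hθ ht b = Proj.awayToSection L.grading (θ t)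
      (HomogeneousLocalization.Away.mk L.grading hf n (θ b) (hθ n b hb)) :=
    congrArg (Proj.awayToSection L.grading (θ t)) (dehomogenize_apply (symGrading k W) θ hθ hf hb)
  rw [← h6] at h5
  exact h5.symm

end Compatibility

/-! ### Images of enveloping systems under multiplication -/

theorem mulImage_eq_span (V : Submodule k L.LocalFunctions) (n : ℕ) :
    L.mulImage V n = Submodule.span k (Set.range fun v : Fin n → V => ∏ i, (v i).1) := by
  rw [mulImage, LinearMap.range_eq_map, ← PiTensorProduct.span_tprod_eq_top, Submodule.map_span,
    ← Set.range_comp]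
  congr 2
  funext v
  simp

variable {L} in
theorem IsEnvelopingSystem.mulImage {r : ℕ} {S : Set (L.invariants r)}
    {V : Submodule k L.LocalFunctions} (h : L.IsEnvelopingSystem r S V) {n : ℕ} (hn : 0 < n) :
    L.IsEnvelopingSystem (n * r) (L.powInvariant n '' S) (L.mulImage V n) where
  pos := Nat.mul_pos hn h.pos
  finite := h.finite.image _
  le_sections := by
    rw [mulImage_eq_span, Submodule.span_le]
    rintro _ ⟨v, rfl⟩
    have := SetLike.prod_mem_graded (A := L.sections) (F := Finset.univ) (fun _ : Fin n => r)
      (fun i => (v i).1) fun i _ => h.le_sections (v i).2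
    simpa using this
  finiteDimensional := by
    have := h.finiteDimensional
    have hfg : (V ^ n).FG := (Module.Finite.iff_fg.1 h.finiteDimensional).pow n
    have : FiniteDimensional k ↥(V ^ n) := Module.Finite.iff_fg.2 hfg
    refine Submodule.finiteDimensional_of_le (S₂ := V ^ n) ?_
    rw [mulImage_eq_span, Submodule.span_le]
    rintro _ ⟨v, rfl⟩
    have := SetLike.prod_mem_graded (A := (V ^ · : ℕ → _)) (F := Finset.univ) (fun _ : Fin n => 1)
      (fun i => (v i).1) fun i _ => by simp
    simpa using this
  mem := by
    rintro _ ⟨f, hf, rfl⟩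
    rw [mulImage_eq_span]
    refine Submodule.subset_span ⟨fun _ => ⟨f.1, h.mem f hf⟩, ?_⟩
    simp [powInvariant]
  stable := by
    intro g v hv
    rw [mulImage_eq_span] at hv ⊢
    refine (Submodule.span_le (p := (Submodule.span k _).comap (L.act g).toLinearMap)).2 ?_ hv
    rintro _ ⟨v, rfl⟩
    refine Submodule.subset_span ⟨fun i => ⟨_, h.stable g _ (v i).2⟩, ?_⟩
    simp
  isFG := by
    rintro _ ⟨f, hf, rfl⟩
    rw [IsFG, toRing_powInvariant]
    exact finiteType_away_pow (L.toRing_mem f) hn (h.isFG f hf)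
  adjoin_eq_top := by
    rintro _ ⟨f, hf, rfl⟩
    have hgen := h.adjoin_eq_top f hf
    have key := adjoin_fractions_pow (k := k)
      (F := {b | ∃ v : L.invariants r, v.1 ∈ V ∧ L.toRing v = b})
      (F' := {b | ∃ v : L.invariants (n * r), v.1 ∈ L.mulImage V n ∧ L.toRing v = b}) hn
      (L.toRing_mem f) (L.toRing_powInvariant n f) (L.toRing_mem (L.powInvariant n f)) ?_ ?_
    · rw [eq_top_iff, ← key]
      refine Algebra.adjoin_mono ?_
      rintro _ ⟨_, hv, ⟨v, hvV, rfl⟩, rfl⟩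
      exact ⟨v, hvV, rfl⟩
    · -- the numerator `v f ^ (n - 1)` is a product of `n` elements of `V`
      rintro _ ⟨v, hv, rfl⟩
      obtain ⟨m, rfl⟩ := Nat.exists_eq_succ_of_ne_zero hn.ne'
      obtain ⟨a, ha⟩ : L.toRing v * L.toRing f ^ m ∈ L.grading ((m + 1) * r) := by
        have := SetLike.mul_mem_graded (L.toRing_mem v) (SetLike.pow_mem_graded m (L.toRing_mem f))
        rwa [show r + m • r = (m + 1) * r by rw [smul_eq_mul]; ring] at this
      refine ⟨a, ?_, ha⟩
      have ha' := congrArg (GradedSum.toRingHom L.invariants) ha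
      rw [map_mul, map_pow, L.toRingHom_toRing, L.toRingHom_toRing] at ha'
      rw [← L.toRingHom_toRing a, mulImage_eq_span]
      refine Submodule.subset_span ⟨Fin.cons ⟨v.1, hv⟩ fun _ => ⟨f.1, h.mem f hf⟩, ?_⟩
      refine Eq.trans ?_ ha'.symm
      simp [Fin.prod_univ_succ]
    · rw [eq_top_iff, ← hgen]
      refine Algebra.adjoin_mono ?_
      rintro _ ⟨v, hv, rfl⟩
      exact ⟨L.toRing v, (one_smul ℕ r).symm ▸ L.toRing_mem v, ⟨v, hv, rfl⟩, rfl⟩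

end Linearisation

namespace Linearisation

variable {k : Type u} [Field k] {H X : Sch k} [GrpObj H] [ModObj H X] (L : Linearisation H X)

/-! ### Quasi-compact open subschemes of the enveloping quotient -/

/-- A quasi-compact open subscheme of the enveloping quotient is covered by the basic open sets of
an enveloping system of invariant sections. -/
theorem exists_isEnvelopingSystem_of_isCompact {𝒰 : (Proj L.grading).Opens}
    (h𝒰 : 𝒰 ≤ L.envelopingQuotient) (hc : IsCompact (𝒰 : Set (Proj L.grading))) :
    ∃ (r : ℕ) (S : Set (L.invariants r)) (V : Submodule k L.LocalFunctions),
      V ≤ L.invariants r ∧ L.IsEnvelopingSystem r S V ∧ 𝒰 = L.unionBasicOpen S := by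
  obtain ⟨s, hs, hfg, rfl⟩ := exists_finite_basicOpen_cover (k := k) hc fun x hx => by
    obtain ⟨r, hr, f, hf, hx⟩ := L.mem_envelopingQuotient (h𝒰 hx)
    exact ⟨r, hr, L.toRing f, L.toRing_mem f, hf, hx⟩
  obtain ⟨r, S, F, hr, hS, hF, hSF, hFr, hcov, hgen⟩ := exists_common_degree hs hfg
  have hV : Submodule.span k (GradedSum.toRingHom L.invariants '' F) ≤ L.invariants r := by
    rw [Submodule.span_le]
    rintro _ ⟨v, hv, rfl⟩
    obtain ⟨v, rfl⟩ := hFr v hv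
    exact (L.toRingHom_toRing v).symm ▸ v.2
  have hmem : ∀ v : L.invariants r, L.toRing v ∈ F →
      v.1 ∈ Submodule.span k (GradedSum.toRingHom L.invariants '' F) := fun v hv =>
    Submodule.subset_span ⟨_, hv, L.toRingHom_toRing v⟩
  refine ⟨r, L.toRing ⁻¹' S, Submodule.span k (GradedSum.toRingHom L.invariants '' F), hV, {
    pos := hr
    finite := hS.preimage (L.toRing_injective r).injOn
    le_sections := hV.trans fun v hv => hv.1
    finiteDimensional := FiniteDimensional.span_of_finite k (hF.image _)
    mem := fun f hf => hmem f (hSF hf)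
    stable := fun h v hv => ((hV hv).2 h).symm ▸ hv
    isFG := fun f hf => (hgen _ hf).1
    adjoin_eq_top := fun f hf => ?_ }, ?_⟩
  · rw [eq_top_iff, ← (hgen _ hf).2 (L.toRing_mem f)]
    refine Algebra.adjoin_mono ?_
    rintro _ ⟨v, -, hv, rfl⟩
    obtain ⟨v, rfl⟩ := hFr v hv
    exact ⟨v, hmem v hv, rfl⟩
  · rw [← hcov]
    refine le_antisymm (iSup₂_le fun f hf => ?_) (iSup₂_le fun f hf => ?_)
    · obtain ⟨f, rfl⟩ := hFr f (hSF hf)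
      exact le_iSup₂ (f := fun f _ => Proj.basicOpen L.grading (L.toRing f)) f hf
    · exact le_iSup₂ (f := fun f _ => Proj.basicOpen L.grading f) (L.toRing f) hf

/-! ### The morphism defined by an enveloping system -/

section EnvelopingSystem

variable {L} {r : ℕ} {S : Set (L.invariants r)} {V : Submodule k L.LocalFunctions}

theorem IsEnvelopingSystem.unionBasicOpen_le (h : L.IsEnvelopingSystem r S V) :
    L.unionBasicOpen S ≤ L.envelopingQuotient :=
  iSup₂_le fun f hf => L.le_envelopingQuotient h.pos (h.isFG f hf)

theorem IsEnvelopingSystem.unionNonvanishing_le (h : L.IsEnvelopingSystem r S V) :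
    L.unionNonvanishing S ≤ L.semistableFG :=
  iSup₂_le fun f hf => L.le_semistableFG h.pos (h.isFG f hf)

theorem exists_mem_of_mem_unionNonvanishing {x : X.left} (hx : x ∈ L.unionNonvanishing S) :
    ∃ f ∈ S, x ∈ L.nonvanishing f.1 := by
  obtain ⟨f, hx⟩ := Opens.mem_iSup.1 hx
  obtain ⟨hf, hx⟩ := Opens.mem_iSup.1 hx
  exact ⟨f, hf, hx⟩

theorem nonvanishing_le_unionNonvanishing {f : L.invariants r} (hf : f ∈ S) :
    L.nonvanishing f.1 ≤ L.unionNonvanishing S :=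
  le_iSup₂ (f := fun f (_ : f ∈ S) => L.nonvanishing f.1) f hf

theorem basicOpen_le_unionBasicOpen {f : L.invariants r} (hf : f ∈ S) :
    Proj.basicOpen L.grading (L.toRing f) ≤ L.unionBasicOpen S :=
  le_iSup₂ (f := fun f (_ : f ∈ S) => Proj.basicOpen L.grading (L.toRing f)) f hf

variable {W : Submodule k L.LocalFunctions}

theorem lift_subtype_mem_sections (hW : W ≤ L.invariants r) (n : ℕ)
    (b : SymmetricAlgebra k W) (hb : b ∈ symGrading k W n) :
    SymmetricAlgebra.lift W.subtype b ∈ L.sections (n * r) :=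
  lift_mem_degree (𝒜 := L.sections) W.subtype (fun w => (hW w.2).1) n b hb

theorem act_lift_subtype (hW : W ≤ L.invariants r) (h : Pt H) (b : SymmetricAlgebra k W) :
    L.act h (SymmetricAlgebra.lift W.subtype b) = SymmetricAlgebra.lift W.subtype b := by
  have : (L.act h).comp (SymmetricAlgebra.lift W.subtype) = SymmetricAlgebra.lift W.subtype := by
    apply SymmetricAlgebra.algHom_ext
    ext w
    change L.act h (SymmetricAlgebra.lift W.subtype (SymmetricAlgebra.ι k W w)) =
      SymmetricAlgebra.lift W.subtype (SymmetricAlgebra.ι k W w)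
    rw [SymmetricAlgebra.lift_ι_apply]
    exact (hW w.2).2 h
  exact congr($this b)

/-- The sections in `W`, as elements of degree `1` of `Sym W`, have no common zeros on
`⋃_{f ∈ S} X_f`. -/
theorem exists_nonvanishing_lift_subtype (hS : ∀ f ∈ S, f.1 ∈ W) :
    ∀ x ∈ L.unionNonvanishing S, ∃ d, 0 < d ∧ ∃ b ∈ symGrading k W d,
      x ∈ L.nonvanishing ((SymmetricAlgebra.lift W.subtype).toRingHom b) ∧
        L.nonvanishing ((SymmetricAlgebra.lift W.subtype).toRingHom b) ≤
          L.unionNonvanishing S := by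
  intro x hx
  obtain ⟨f, hf, hx⟩ := exists_mem_of_mem_unionNonvanishing hx
  have : (SymmetricAlgebra.lift W.subtype).toRingHom (SymmetricAlgebra.ι k W ⟨f.1, hS f hf⟩) =
      f.1 := SymmetricAlgebra.lift_ι_apply _ _
  refine ⟨1, one_pos, _, ι_mem_symGrading k W ⟨f.1, hS f hf⟩, ?_⟩
  rw [this]
  exact ⟨hx, nonvanishing_le_unionNonvanishing hf⟩

/-- The morphism defined by a space `W` of invariant sections which contains `S` factors through
the canonical morphism and the embedding defined by `W`. -/
theorem exists_factorization (hW : W ≤ L.invariants r) (hr : 0 < r) (hS : ∀ f ∈ S, f.1 ∈ W)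
    (hU : L.unionNonvanishing S ≤ L.semistableFG)
    {φ : (L.unionNonvanishing S).toScheme ⟶ ProjSpace k W}
    (hφ : L.IsMapDefinedBy (symGrading k W) (SymmetricAlgebra.lift W.subtype).toRingHom
      (L.unionNonvanishing S) φ)
    {φbar : (L.unionBasicOpen S).toScheme ⟶ ProjSpace k W}
    (hφbar : ∀ (w : W), (⟨w.1, hW w.2⟩ : L.invariants r) ∈ S →
        ∀ hle : Proj.basicOpen L.grading (SymmetricAlgebra.lift (toRingMap hW)
          (SymmetricAlgebra.ι k W w)) ≤ L.unionBasicOpen S,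
        (Proj L.grading).homOfLE hle ≫ φbar = localLinearMap
          (lift_mem_degree (toRingMap hW) (toRingMap_mem hW)) (ι_mem_symGrading k W w))
    {q : L.semistableFG.toScheme ⟶ L.envelopingQuotient.toScheme}
    (hq : L.IsEnvelopingQuotientMap q) :
    ∃ qU : (L.unionNonvanishing S).toScheme ⟶ (L.unionBasicOpen S).toScheme,
      qU ≫ (L.unionBasicOpen S).ι = X.left.homOfLE hU ≫ q ≫ L.envelopingQuotient.ι ∧
      φ = qU ≫ φbar := by
  set Q := X.left.homOfLE hU ≫ q ≫ L.envelopingQuotient.ι with hQdef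
  have hQ : L.IsMapDefinedBy L.grading (GradedSum.toRingHom L.invariants)
      (L.unionNonvanishing S) Q := fun c hc hgen => by
    rw [hQdef, Scheme.homOfLE_homOfLE_assoc]
    exact hq c (hc.trans hU) hgen
  have hrange : Set.range Q ⊆ Set.range (L.unionBasicOpen S).ι := by
    rw [Scheme.Opens.range_ι]
    rintro _ ⟨x, rfl⟩
    obtain ⟨f, hf, hx⟩ := exists_mem_of_mem_unionNonvanishing x.2
    exact basicOpen_le_unionBasicOpen hf
      (L.preimage_toRing hQ hr f (nonvanishing_le_unionNonvanishing hf) hx)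
  have hfac := IsOpenImmersion.lift_fac (L.unionBasicOpen S).ι Q hrange
  refine ⟨IsOpenImmersion.lift (L.unionBasicOpen S).ι Q hrange, hfac,
    Scheme.hom_ext_of_forall _ _ fun x => ?_⟩
  obtain ⟨f, hf, hx⟩ := exists_mem_of_mem_unionNonvanishing x.2
  obtain ⟨c, hxc, hc, hunit⟩ := L.exists_coord_isUnit f.2.1 hx
  have hcU := hc.trans (nonvanishing_le_unionNonvanishing hf)
  have hw : SymmetricAlgebra.lift (toRingMap hW) (SymmetricAlgebra.ι k W ⟨f.1, hS f hf⟩) =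
      L.toRing f := SymmetricAlgebra.lift_ι_apply _ _
  have hle : Proj.basicOpen L.grading (SymmetricAlgebra.lift (toRingMap hW)
      (SymmetricAlgebra.ι k W ⟨f.1, hS f hf⟩)) ≤ L.unionBasicOpen S :=
    hw ▸ basicOpen_le_unionBasicOpen hf
  have hgenQ := L.irrelevant_map_eq_top (ℬ := L.grading)
    (u := GradedSum.toRingHom L.invariants) hr (L.toRing_mem f) c
    (by rwa [L.toRingHom_toRing])
  have hgenφ := L.irrelevant_map_eq_top (ℬ := symGrading k W)
    (u := (SymmetricAlgebra.lift W.subtype).toRingHom) one_pos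
    (ι_mem_symGrading k W ⟨f.1, hS f hf⟩) c
    (by
      change IsUnit (L.evalAt c (SymmetricAlgebra.lift W.subtype _))
      rwa [SymmetricAlgebra.lift_ι_apply])
  obtain ⟨e, -, he⟩ := exists_lift_homOfLE hcU (le_refl ((L.unionNonvanishing S).ι ⁻¹ᵁ c.U))
  refine ⟨(L.unionNonvanishing S).ι ⁻¹ᵁ c.U, hxc, ?_⟩
  rw [he, Category.assoc, Category.assoc]
  congr 1
  exact homOfLE_comp_eq hW hr Q _ hfac φ φbar c hcU ⟨f.1, hS f hf⟩ hunit hgenQ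
    (hQ c hcU hgenQ) hgenφ (hφ c hcU hgenφ) hle (hφbar _ hf hle)

end EnvelopingSystem

end Linearisation
end NonReductiveGIT
end

theorem proposition3p9 {k : Type u} [Field k] [IsAlgClosed k] [CharZero k]
    (H X : NonReductiveGIT.Sch k) [GrpObj H] [ModObj H X]
    (hH : NonReductiveGIT.IsLinearAlgebraicGroup H) (hX : NonReductiveGIT.IsVariety X)
    (L : NonReductiveGIT.Linearisation H X) :
    -- the enveloping quotient map is well defined
    (∃! q : L.semistableFG.toScheme ⟶ L.envelopingQuotient.toScheme,
      L.IsEnvelopingQuotientMap q) ∧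
    -- quasi-compact open subschemes of the enveloping quotient come from enveloping systems
    (∀ 𝒰 : (Proj L.grading).Opens, 𝒰 ≤ L.envelopingQuotient →
      IsCompact (𝒰 : Set (Proj L.grading)) →
      ∃ (r : ℕ) (S : Set (L.invariants r)) (V : Submodule k L.LocalFunctions)
        (hV : V ≤ L.invariants r), 0 < r ∧ L.IsEnvelopingSystem r S V ∧
        𝒰 = L.unionBasicOpen S ∧
        NonReductiveGIT.IsVeryAmple k (L.structureMap 𝒰) (L.twist 𝒰 r) ∧
        ∃ ψ : 𝒰.toScheme ⟶ NonReductiveGIT.ProjSpace k V,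
          ψ ≫ NonReductiveGIT.projToSpec (NonReductiveGIT.symGrading k V) = L.structureMap 𝒰 ∧
          NonReductiveGIT.IsDefinedByLinearSystem k ψ (L.twist 𝒰 r)
            (fun v => L.naturalMap 𝒰 ⟨v.1, hV v.2⟩) ∧
          IsImmersion ψ) ∧
    -- enveloping systems define locally closed embeddings which are compatible with the quotient
    (∀ (r : ℕ) (S : Set (L.invariants r)) (V : Submodule k L.LocalFunctions),
      L.IsEnvelopingSystem r S V →
      L.unionBasicOpen S ≤ L.envelopingQuotient ∧
      ∃ (hU : L.unionNonvanishing S ≤ L.semistableFG)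
        (φ : (L.unionNonvanishing S).toScheme ⟶
          NonReductiveGIT.ProjSpace k ↥(V ⊓ L.invariants r)),
        (∀ φ' : (L.unionNonvanishing S).toScheme ⟶
            NonReductiveGIT.ProjSpace k ↥(V ⊓ L.invariants r),
          L.IsMapDefinedBy (NonReductiveGIT.symGrading k ↥(V ⊓ L.invariants r))
            (SymmetricAlgebra.lift (V ⊓ L.invariants r).subtype).toRingHom
            (L.unionNonvanishing S) φ' ↔ φ' = φ) ∧
        (∀ h : NonReductiveGIT.Pt H,
          ∃ τ : (L.unionNonvanishing S).toScheme ⟶ (L.unionNonvanishing S).toScheme,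
            τ ≫ (L.unionNonvanishing S).ι =
              (L.unionNonvanishing S).ι ≫ (NonReductiveGIT.translate X h).left ∧
            τ ≫ φ = φ) ∧
        ∃ φbar : (L.unionBasicOpen S).toScheme ⟶
            NonReductiveGIT.ProjSpace k ↥(V ⊓ L.invariants r),
          IsImmersion φbar ∧
          φbar ≫ NonReductiveGIT.projToSpec
            (NonReductiveGIT.symGrading k ↥(V ⊓ L.invariants r)) =
              L.structureMap (L.unionBasicOpen S) ∧
          NonReductiveGIT.IsDefinedByLinearSystem k φbar (L.twist (L.unionBasicOpen S) r)
            (fun v => L.naturalMap (L.unionBasicOpen S) ⟨v.1, v.2.2⟩) ∧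
          ∀ q : L.semistableFG.toScheme ⟶ L.envelopingQuotient.toScheme,
            L.IsEnvelopingQuotientMap q →
            ∃ qU : (L.unionNonvanishing S).toScheme ⟶ (L.unionBasicOpen S).toScheme,
              qU ≫ (L.unionBasicOpen S).ι =
                X.left.homOfLE hU ≫ q ≫ L.envelopingQuotient.ι ∧
              φ = qU ≫ φbar) ∧
    -- images under the multiplication maps
    (∀ (r : ℕ) (S : Set (L.invariants r)) (V : Submodule k L.LocalFunctions),
      L.IsEnvelopingSystem r S V → ∀ n : ℕ, 0 < n →
      L.IsEnvelopingSystem (n * r) (L.powInvariant n '' S) (L.mulImage V n)) := by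
  refine ⟨L.existsUnique_envelopingQuotientMap, ?_, ?_, fun r S V h n hn => h.mulImage hn⟩
  · intro 𝒰 h𝒰 hc
    obtain ⟨r, S, V, hV, h, rfl⟩ := L.exists_isEnvelopingSystem_of_isCompact h𝒰 hc
    obtain ⟨ψ, hψ, hψk, ⟨η, hη, hηv⟩, -⟩ :=
      NonReductiveGIT.Linearisation.exists_embedding hV h.pos h.mem h.adjoin_eq_top
    exact ⟨r, S, V, hV, h.pos, h, rfl,
      ⟨NonReductiveGIT.Linearisation.isLineBundle_twist S, V, inferInstance, inferInstance,
        h.finiteDimensional, ψ, hψ, hψk, ⟨@asIso _ _ _ _ _ hη⟩⟩, ψ, hψk, ⟨η, hη, hηv⟩, hψ⟩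
  · intro r S V h
    have hW : V ⊓ L.invariants r ≤ L.invariants r := inf_le_right
    have hS : ∀ f ∈ S, f.1 ∈ V ⊓ L.invariants r := fun f hf => ⟨h.mem f hf, f.2⟩
    have hu := NonReductiveGIT.Linearisation.lift_subtype_mem_sections hW
    have hcov := NonReductiveGIT.Linearisation.exists_nonvanishing_lift_subtype hS
    obtain ⟨φ, hφ, hφu⟩ := L.existsUnique_isMapDefinedBy hu hcov
    obtain ⟨φbar, himm, hk, hlin, hloc⟩ :=
      NonReductiveGIT.Linearisation.exists_embedding hW h.pos hS fun f hf => by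
        rw [eq_top_iff, ← h.adjoin_eq_top f hf]
        refine Algebra.adjoin_mono ?_
        rintro _ ⟨v, hv, rfl⟩
        exact ⟨v, ⟨hv, v.2⟩, rfl⟩
    refine ⟨h.unionBasicOpen_le, h.unionNonvanishing_le, φ,
      fun φ' => ⟨hφu φ', fun h' => h' ▸ hφ⟩,
      hφ.invariant L hu hcov (NonReductiveGIT.Linearisation.act_lift_subtype hW),
      φbar, himm, hk, hlin, fun q hq => ?_⟩
    exact NonReductiveGIT.Linearisation.exists_factorization hW h.pos hS h.unionNonvanishing_le
      hφ hloc hq
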